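/- **Setting.** Let $(\mathbb S,\omega)$ be a simply connected solvable (real, finite-dimensional) symplectic Lie group: $\omega$ is a left-invariant symplectic form on the simply connected solvable Lie group $\mathbb S$. Let $\mathfrak s$ be the Lie algebra of $\mathbb S$, let $\mathfrak g$ be a finite-dimensional real Lie algebra containing $\mathfrak s$ as a Lie subalgebra, and let $e$ be the unit of $\mathbb S$. For $Y\in\mathfrak s$ write $Y^\star_x=\frac{d}{dt}\big|_{0}\exp(-tY)x$. Functions are complex-valued, $C^\infty(\mathbb S)=C^\infty(\mathbb S,\mathbb C)$; $\mathcal D(\mathbb S)$ denotes the compactly supported ones and $\mathcal D'(\mathbb S)$ the distributions; $dy$ is a left Haar measure, $\langle u,\varphi\rangle$ is the bilinear pairing extending $\int u\,\varphi\,dy$, and $\Delta\in C^\infty(\mathbb S)$ is defined by $d(y^{-1})=\Delta(y)\,dy$. A *star-product* on $(\mathbb S,\omega)$ is an associative $\mathbb C[[\nu]]$-bilinear product on $C^\infty(\mathbb S)[[\nu]]$ of the form $u\star v=\sum_k\nu^kC_k(u,v)$ for $u,v\in C^\infty(\mathbb S)$, with bidifferential operators $C_k$, $C_0(u,v)=uv$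 and $C_1(u,v)-C_1(v,u)=\{u,v\}^\omega$. We write $\star'=T(\star)$ when $T=\mathrm{id}+\sum_{k\ge1}\nu^kT_k$ is a formal series of differential operators with $T(u)\star'T(v)=T(u\star v)$; the star-products are $\mathbb S$-*equivariantly equivalent* if moreover $T$ can be chosen to commute with left translations. $\mathfrak{Der}(\star)$ is the Lie algebra of formal series of differential operators that are derivations of $\star$. Fix a left-invariant star-product $\star$ on $(\mathbb S,\omega)$. Let $\mathrm{Hom}_{\mathfrak s}(\mathfrak g,\mathfrak{Der}(\star))$ be the set of ($\mathbb R$-linear) Lie algebra homomorphisms $D:\mathfrak g\to\mathfrak{Der}(\star)$ with $D_Y=Y^\star$ for all $Y\in\mathfrak s$ and such that each operator $X^\star_D:=D_X \bmod \nu$ $(X\in\mathfrak g)$ maps real functions to real functions (so that $X^\star_D$ is a vector field on $\mathbb S$). The map $X\mapsto X_D^\star$ is the infinitesimal action of $\mathfrak g$ defined by $D$; put $\mathfrak k=\{X\in\mathfrak g: X^\star_D|_e=0\}$. A *$D$-retract* is an element $u\in\mathcal D'(\mathbb S)[[\nu]]$ such that (a) $D_Zu=0$ for all $Z\in\mathfrak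 k$ in the sense of distributions, i.e. $\langle u,D_Z^{t}\varphi\rangle=0$ for all $\varphi\in\mathcal D(\mathbb S)$, where $D_Z^t$ is the transpose of $D_Z$ on $\mathcal D(\mathbb S)$ with respect to $\int\varphi\,\psi\,dy$; (b) $\operatorname{supp}(u)=\{e\}$; (c) $u\bmod\nu=\delta_e$. Its *inverse retract operator* $\tau_u$ is the formal series of differential operators on $C^\infty(\mathbb S)$ given on $\varphi\in\mathcal D(\mathbb S)$ by $\tau_u\varphi(x)=\langle u,\ y\mapsto\Delta(y)\,\varphi(xy^{-1})\rangle$, and its *direct retract operator* is $T_u=\tau_u^{-1}$. **Theorem (Retract method II).** (i) Let $D\in\mathrm{Hom}_{\mathfrak s}(\mathfrak g,\mathfrak{Der}(\star))$ and let $u$ be a $D$-retract. Then the direct retract operator $T_u$ exists and is unique, and $\sharp^u:=T_u(\star)$ is a star-product on $(\mathbb S,\omega)$ that is $\mathfrak g$-invariant for the infinitesimal action $X\mapsto X_D^\star$: every $X_D^\star$ is a derivation of $\sharp^u$. (ii) Let $\rho:\mathfrak g\to\Gamma^\infty(T\mathbb S)$ be an infinitesimal action of $\mathfrak g$ by symplectic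 vector fields with $\rho(Y)=Y^\star$ for all $Y\in\mathfrak s$, and let $\sharp$ be a star-product on $(\mathbb S,\omega)$ that is $\mathfrak g$-invariant (every $\rho(X)$ is a derivation of $\sharp$) and $\mathbb S$-equivariantly equivalent to $\star$. Then there are $D\in\mathrm{Hom}_{\mathfrak s}(\mathfrak g,\mathfrak{Der}(\star))$ with $X^\star_D=\rho(X)$ for all $X\in\mathfrak g$ and a $D$-retract $u$ such that $\sharp=\sharp^u=T_u(\star)$. -/

import Mathlib

open scoped Manifold ContDiff Topology
open MeasureTheory PowerSeries

noncomputable section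

namespace Retract

instance : ENat.LEInfty (minSmoothness ℝ 3) :=
  ⟨by rw [minSmoothness_of_isRCLikeNormedField]; exact ENat.LEInfty.out⟩

section Manifolds

variable (E : Type*) [NormedAddCommGroup E] [NormedSpace ℝ E]
  (S : Type*) [TopologicalSpace S] [ChartedSpace E S]

instance [FiniteDimensional ℝ E] (x : S) : FiniteDimensional ℝ (TangentSpace 𝓘(ℝ, E) x) :=
  inferInstanceAs (FiniteDimensional ℝ E)

/-! ### Smooth functions, operators, formal power series -/

/-- The algebra `C^∞(S)` of smooth complex-valued functions on the real manifold `S`. -/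
def smoothSubalgebra : Subalgebra ℂ (S → ℂ) where
  carrier := {f | ContMDiff 𝓘(ℝ, E) 𝓘(ℝ, ℂ) ∞ f}
  mul_mem' := fun {f g} hf hg => by
    have h : ContDiff ℝ ∞ (fun p : ℂ × ℂ => p.1 * p.2) := contDiff_fst.mul contDiff_snd
    exact h.contMDiff.comp (hf.prodMk_space hg)
  add_mem' := fun {f g} hf hg => by
    have h : ContDiff ℝ ∞ (fun p : ℂ × ℂ => p.1 + p.2) := contDiff_fst.add contDiff_snd
    exact h.contMDiff.comp (hf.prodMk_space hg)
  algebraMap_mem' := fun c => contMDiff_const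

/-- `C^∞(S)`. -/
abbrev SmoothFun : Type _ := smoothSubalgebra E S

/-- Linear operators on `C^∞(S)`. -/
abbrev SmoothOp : Type _ := Module.End ℂ (SmoothFun E S)

/-- `C^∞(S)[[ν]]`. -/
abbrev FormalFun : Type _ := (SmoothFun E S)⟦X⟧

/-- Formal power series in `ν` of linear operators on `C^∞(S)`; the product of power series is the
composition of the associated operators on `C^∞(S)[[ν]]`. -/
abbrev FormalOp : Type _ := (SmoothOp E S)⟦X⟧

variable {E S}

/-- The `ℂ[[ν]]`-linear operator on `C^∞(S)[[ν]]` given by a formal series of operators. -/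
def FormalOp.app (T : FormalOp E S) (f : FormalFun E S) : FormalFun E S :=
  PowerSeries.mk fun n =>
    ∑ p ∈ Finset.HasAntidiagonal.antidiagonal n, (PowerSeries.coeff p.1 T) (PowerSeries.coeff p.2 f)

/-! ### Differential operators -/

/-- Linear differential operators on `C^∞(S)` of order at most `n`: order `≤ 0` means commuting
with multiplication by every function, and `P` has order `≤ n + 1` if all its commutators with
multiplication operators have order `≤ n`. -/
def IsDiffOpOfOrder : ℕ → SmoothOp E S → Prop
  | 0, P => ∀ f : SmoothFun E S,
      P * LinearMap.mulLeft ℂ f - LinearMap.mulLeft ℂ f * P = 0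
  | n + 1, P => ∀ f : SmoothFun E S,
      IsDiffOpOfOrder n (P * LinearMap.mulLeft ℂ f - LinearMap.mulLeft ℂ f * P)

/-- Differential operators on `C^∞(S)`. -/
def IsDiffOp (P : SmoothOp E S) : Prop := ∃ n, IsDiffOpOfOrder n P

/-- Bidifferential operators on `C^∞(S)`: differential, of bounded order, in each argument. -/
def IsBiDiffOp (C : SmoothFun E S →ₗ[ℂ] SmoothFun E S →ₗ[ℂ] SmoothFun E S) : Prop :=
  ∃ n, ∀ f, IsDiffOpOfOrder n (C f) ∧ IsDiffOpOfOrder n (C.flip f)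

/-- `P` maps real-valued functions to real-valued functions. -/
def IsRealOp (P : SmoothOp E S) : Prop :=
  ∀ f : SmoothFun E S, (∀ x, (f.1 x).im = 0) → ∀ x, ((P f).1 x).im = 0

/-! ### Vector fields -/

/-- The differential at `x` of a complex-valued function on `S`. -/
def dfun (f : S → ℂ) (x : S) : TangentSpace 𝓘(ℝ, E) x →L[ℝ] ℂ :=
  mfderiv 𝓘(ℝ, E) 𝓘(ℝ, ℂ) f x

/-- The differential at `x` of a real-valued function on `S`. -/
def dreal (f : S → ℝ) (x : S) : TangentSpace 𝓘(ℝ, E) x →L[ℝ] ℝ :=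
  mfderiv 𝓘(ℝ, E) 𝓘(ℝ, ℝ) f x

variable (E S) in
/-- Smooth (real) vector fields on `S`. -/
structure SmoothVF [IsManifold 𝓘(ℝ, E) ∞ S] where
  /-- the value at a point -/
  val : ∀ x : S, TangentSpace 𝓘(ℝ, E) x
  smooth : ContMDiff 𝓘(ℝ, E) (𝓘(ℝ, E)).tangent ∞
    (fun x => (⟨x, val x⟩ : TangentBundle 𝓘(ℝ, E) S))

variable [IsManifold 𝓘(ℝ, E) ∞ S]

theorem SmoothVF.contMDiff_apply (V : SmoothVF E S) {f : S → ℂ}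
    (hf : ContMDiff 𝓘(ℝ, E) 𝓘(ℝ, ℂ) ∞ f) :
    ContMDiff 𝓘(ℝ, E) 𝓘(ℝ, ℂ) ∞ (fun x => dfun f x (V.val x)) := by
  have h1 : ContMDiff (𝓘(ℝ, E)).tangent (𝓘(ℝ, ℂ)).tangent ∞
      (tangentMap 𝓘(ℝ, E) 𝓘(ℝ, ℂ) f) := hf.contMDiff_tangentMap (by simp)
  have h2 := h1.comp V.smooth
  have h3 := (contMDiff_snd_tangentBundle_modelSpace (n := ∞) ℂ 𝓘(ℝ, ℂ))
  exact h3.comp h2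

/-- The derivation `f ↦ V f` of `C^∞(S)` defined by a vector field. -/
def SmoothVF.lieDer (V : SmoothVF E S) : SmoothOp E S where
  toFun f := ⟨fun x => dfun f.1 x (V.val x), V.contMDiff_apply f.2⟩
  map_add' f g := by
    ext x
    have hf := (f.2 : ContMDiff 𝓘(ℝ, E) 𝓘(ℝ, ℂ) ∞ f.1).mdifferentiable (by simp) x
    have hg := (g.2 : ContMDiff 𝓘(ℝ, E) 𝓘(ℝ, ℂ) ∞ g.1).mdifferentiable (by simp) x
    change dfun (f.1 + g.1) x (V.val x) = dfun f.1 x (V.val x) + dfun g.1 x (V.val x)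
    unfold dfun
    rw [mfderiv_add hf hg]
    rfl
  map_smul' c f := by
    ext x
    have hf := (f.2 : ContMDiff 𝓘(ℝ, E) 𝓘(ℝ, ℂ) ∞ f.1).mdifferentiable (by simp) x
    have hL := (ContinuousLinearMap.mul ℝ ℂ c).hasMFDerivAt (x := f.1 x)
    have h := (hL.comp x hf.hasMFDerivAt).mfderiv
    change dfun (c • f.1) x (V.val x) = c * dfun f.1 x (V.val x)
    unfold dfun
    have h' : (c • f.1) = (ContinuousLinearMap.mul ℝ ℂ c) ∘ f.1 := rfl
    rw [h', h]
    rfl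

/-! ### Symplectic forms -/

variable (E S) in
/-- Symplectic forms on `S`: smooth, nondegenerate, closed 2-forms. -/
structure SymplecticForm where
  /-- the value of the form at a point -/
  form : ∀ x : S, LinearMap.BilinForm ℝ (TangentSpace 𝓘(ℝ, E) x)
  alt : ∀ x, (form x).IsAlt
  nondegenerate : ∀ x, (form x).Nondegenerate
  smooth : ∀ V W : SmoothVF E S,
    ContMDiff 𝓘(ℝ, E) 𝓘(ℝ, ℝ) ∞ (fun x => form x (V.val x) (W.val x))
  /-- `dω(U, V, W) = 0` -/
  closed : ∀ (U V W : SmoothVF E S) (x : S),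
    dreal (fun y => form y (V.val y) (W.val y)) x (U.val x)
    - dreal (fun y => form y (U.val y) (W.val y)) x (V.val x)
    + dreal (fun y => form y (U.val y) (V.val y)) x (W.val x)
    - form x (VectorField.mlieBracket 𝓘(ℝ, E) U.val V.val x) (W.val x)
    + form x (VectorField.mlieBracket 𝓘(ℝ, E) U.val W.val x) (V.val x)
    - form x (VectorField.mlieBracket 𝓘(ℝ, E) V.val W.val x) (U.val x) = (0 : ℝ)

namespace SymplecticForm

variable [FiniteDimensional ℝ E] (om : SymplecticForm E S)

/-- The vector `ξ` at `x` with `ω(ξ, w) = α(w)` for all `w`. -/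
def sharp (x : S) (α : TangentSpace 𝓘(ℝ, E) x →L[ℝ] ℝ) : TangentSpace 𝓘(ℝ, E) x :=
  ((om.form x).toDual (om.nondegenerate x)).symm α.toLinearMap

/-- The Poisson bracket: `{f, g} = dg(Ξ_f)` where `ω(Ξ_f, ·) = df` for real `f`, extended
`ℂ`-bilinearly to complex-valued functions. -/
def poisson (f g : S → ℂ) (x : S) : ℂ :=
  dfun g x (om.sharp x (Complex.reCLM.comp (dfun f x)))
    + Complex.I * dfun g x (om.sharp x (Complex.imCLM.comp (dfun f x)))

/-- `L_V ω = 0`. -/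
def IsSymplecticVF (V : SmoothVF E S) : Prop :=
  ∀ (U W : SmoothVF E S) (x : S),
    dreal (fun y => om.form y (U.val y) (W.val y)) x (V.val x)
    = (om.form x (VectorField.mlieBracket 𝓘(ℝ, E) V.val U.val x) (W.val x)
      + om.form x (U.val x) (VectorField.mlieBracket 𝓘(ℝ, E) V.val W.val x) : ℝ)

end SymplecticForm

/-! ### Star-products -/

/-- The `ℂ[[ν]]`-bilinear extension to `C^∞(S)[[ν]]` of `(u, v) ↦ ∑ ν^k C_k(u, v)`. -/
def starMul (C : ℕ → SmoothFun E S →ₗ[ℂ] SmoothFun E S →ₗ[ℂ] SmoothFun E S)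
    (f g : FormalFun E S) : FormalFun E S :=
  PowerSeries.mk fun n => ∑ p ∈ Finset.HasAntidiagonal.antidiagonal n, ∑ q ∈ Finset.HasAntidiagonal.antidiagonal p.2,
    C p.1 (PowerSeries.coeff q.1 f) (PowerSeries.coeff q.2 g)

/-- Star-products on `(S, ω)`. -/
structure StarProduct [FiniteDimensional ℝ E] (om : SymplecticForm E S) where
  /-- the cochains -/
  cochain : ℕ → SmoothFun E S →ₗ[ℂ] SmoothFun E S →ₗ[ℂ] SmoothFun E S
  assoc : ∀ f g h : FormalFun E S,
    starMul cochain (starMul cochain f g) h = starMul cochain f (starMul cochain g h)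
  cochain_zero : ∀ u v, cochain 0 u v = u * v
  cochain_one : ∀ u v x,
    (cochain 1 u v).1 x - (cochain 1 v u).1 x = om.poisson u.1 v.1 x
  bidiff : ∀ k, IsBiDiffOp (cochain k)

namespace StarProduct

variable [FiniteDimensional ℝ E] {om : SymplecticForm E S}

/-- The product `f ⋆ g` of formal functions. -/
def mul (star : StarProduct om) (f g : FormalFun E S) : FormalFun E S := starMul star.cochain f g

/-- `D ∈ Der(⋆)`. -/
structure IsDerivation (star : StarProduct om) (D : FormalOp E S) : Prop where
  diffOp : ∀ k, IsDiffOp (PowerSeries.coeff k D)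
  leibniz : ∀ f g, D.app (star.mul f g) = star.mul (D.app f) g + star.mul f (D.app g)

/-- `T` is an equivalence of star-products with `star' = T(star)`, that is `T = id + O(ν)` is a
formal series of differential operators with `T f ⋆' T g = T (f ⋆ g)`. -/
structure IsTransport (T : FormalOp E S) (star star' : StarProduct om) : Prop where
  diffOp : ∀ k, IsDiffOp (PowerSeries.coeff k T)
  coeff_zero : PowerSeries.coeff 0 T = 1
  map_mul : ∀ f g, star'.mul (T.app f) (T.app g) = T.app (star.mul f g)

end StarProduct

/-! ### Distributions -/

variable (E S) in
/-- The space `𝒟(S)` of compactly supported smooth functions. -/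
def testSubmodule : Submodule ℂ (SmoothFun E S) where
  carrier := {f | HasCompactSupport f.1}
  add_mem' := fun hf hg => HasCompactSupport.add hf hg
  zero_mem' := HasCompactSupport.zero
  smul_mem' := fun c _ hf => HasCompactSupport.smul_left (f := fun _ : S => c) hf

variable (E S) in
/-- `𝒟(S)`. -/
abbrev TestFun : Type _ := testSubmodule E S

variable (E S) in
/-- Distributions on `S`: linear forms on `𝒟(S)` whose restriction to the test functions supported
in any given compact set is continuous for the seminorms `φ ↦ sup |P φ|`, with `P` running over the
differential operators. -/
structure MDistribution where
  /-- the linear form -/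
  toLin : TestFun E S →ₗ[ℂ] ℂ
  continuous : ∀ K : Set S, IsCompact K →
    ∃ (F : Finset (SmoothOp E S)) (C : ℝ), (∀ P ∈ F, IsDiffOp P) ∧
      ∀ (φ : TestFun E S) (B : ℝ), tsupport φ.1.1 ⊆ K →
        (∀ P ∈ F, ∀ x, ‖(P φ.1).1 x‖ ≤ B) → 0 ≤ B → ‖toLin φ‖ ≤ C * B

variable (E S) in
/-- `𝒟'(S)[[ν]]`. -/
abbrev FormalDist : Type _ := ℕ → MDistribution E S

/-- The support of a formal distribution: the complement of the largest open set on which all its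
coefficients vanish. -/
def FormalDist.support (u : FormalDist E S) : Set S :=
  {x | ∀ U ∈ 𝓝 x, ∃ (k : ℕ) (φ : TestFun E S), tsupport φ.1.1 ⊆ U ∧ (u k).toLin φ ≠ 0}

/-- `B` is the transpose on `𝒟(S)` of the operator `P`, with respect to the measure `μ`. -/
def IsTranspose [MeasurableSpace S] (μ : Measure S) (P : SmoothOp E S)
    (B : TestFun E S →ₗ[ℂ] TestFun E S) : Prop :=
  ∀ φ χ : TestFun E S, ∫ y, (B φ).1.1 y * χ.1.1 y ∂μ = ∫ y, φ.1.1 y * (P χ.1).1 y ∂μ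

/-- `D u = 0` in the weak sense, for a formal series `D` of differential operators and a formal
distribution `u`: for all `n` and `φ`, `∑_{i+j=n} ⟨u_j, (D_i)ᵗ φ⟩ = 0`. -/
def IsWeakSolution [MeasurableSpace S] (μ : Measure S) (D : FormalOp E S)
    (u : FormalDist E S) : Prop :=
  ∃ B : ℕ → TestFun E S →ₗ[ℂ] TestFun E S,
    (∀ i, IsTranspose μ (PowerSeries.coeff i D) (B i)) ∧
    ∀ (n : ℕ) (φ : TestFun E S),
      ∑ p ∈ Finset.HasAntidiagonal.antidiagonal n, (u p.2).toLin (B p.1 φ) = 0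

/-- The product of a test function with a smooth function. -/
def TestFun.smoothMul (f : SmoothFun E S) (φ : TestFun E S) : TestFun E S :=
  ⟨f * φ.1, HasCompactSupport.mul_left (f := f.1) φ.2⟩

end Manifolds

/-! ### Lie groups -/

section Groups

variable {E : Type*} [NormedAddCommGroup E] [NormedSpace ℝ E] [FiniteDimensional ℝ E]
  {S : Type*} [TopologicalSpace S] [ChartedSpace E S] [Group S] [LieGroup 𝓘(ℝ, E) ∞ S]

/-- `L_g^⋆ f (x) = f (g x)`. -/
def leftPull (g : S) : SmoothOp E S where
  toFun f := ⟨fun x => f.1 (g * x),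
    (f.2 : ContMDiff 𝓘(ℝ, E) 𝓘(ℝ, ℂ) ∞ f.1).comp contMDiff_mul_left⟩
  map_add' _ _ := rfl
  map_smul' _ _ := rfl

/-- The symplectic form is invariant under left translations. -/
def SymplecticForm.IsLeftInvariant (om : SymplecticForm E S) : Prop :=
  ∀ (g x : S) (v w : TangentSpace 𝓘(ℝ, E) x),
    om.form (g * x) (mfderiv 𝓘(ℝ, E) 𝓘(ℝ, E) (fun y => g * y) x v)
      (mfderiv 𝓘(ℝ, E) 𝓘(ℝ, E) (fun y => g * y) x w) = om.form x v w

/-- The star-product is invariant under left translations. -/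
def StarProduct.IsLeftInvariant {om : SymplecticForm E S} (star : StarProduct om) : Prop :=
  ∀ (g : S) (k : ℕ) (u v : SmoothFun E S),
    leftPull g (star.cochain k u v) = star.cochain k (leftPull g u) (leftPull g v)

/-- `star` and `star'` are equivalent through an equivalence commuting with left translations. -/
def StarProduct.EquivariantlyEquivalent {om : SymplecticForm E S} (star star' : StarProduct om) :
    Prop :=
  ∃ T : FormalOp E S, IsTransport T star star' ∧
    ∀ (g : S) (k : ℕ), leftPull g * PowerSeries.coeff k T = PowerSeries.coeff k T * leftPull g

/-- The fundamental vector field `X^⋆_x = d/dt|₀ exp(-tX) x`, that is the image of `-X` under the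
differential at the unit of `y ↦ y x`. -/
def fundVF (X : GroupLieAlgebra 𝓘(ℝ, E) S) (x : S) : TangentSpace 𝓘(ℝ, E) x :=
  mfderiv 𝓘(ℝ, E) 𝓘(ℝ, E) (fun y : S => y * x) 1 (-X)

variable {𝔤 : Type*} [LieRing 𝔤] [LieAlgebra ℝ 𝔤]

/-- `D` is a homomorphism of Lie algebras from `𝔤` to `Der(⋆)` that is `𝔰`-relative, i.e.
`D_Y = Y^⋆` for `Y ∈ 𝔰`, and such that each `D_X mod ν` is a real operator (hence a vector field
on `S`). Here `𝔰` is the Lie algebra of `S`, viewed in `𝔤` through `ι`. -/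
structure IsRelHom {om : SymplecticForm E S} (ι : GroupLieAlgebra 𝓘(ℝ, E) S →ₗ⁅ℝ⁆ 𝔤)
    (star : StarProduct om) (D : 𝔤 →ₗ[ℝ] FormalOp E S) : Prop where
  derivation : ∀ X, star.IsDerivation (D X)
  map_lie : ∀ X Y, D ⁅X, Y⁆ = D X * D Y - D Y * D X
  rel_zero : ∀ Y f x, (PowerSeries.coeff 0 (D (ι Y)) f).1 x = dfun f.1 x (fundVF Y x)
  rel_succ : ∀ Y k, PowerSeries.coeff (k + 1) (D (ι Y)) = 0
  real : ∀ X, IsRealOp (PowerSeries.coeff 0 (D X))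

/-- `X ∈ 𝔨`: the vector field `X_D^⋆ = D_X mod ν` vanishes at the unit. -/
def InStabilizer (D : 𝔤 →ₗ[ℝ] FormalOp E S) (X : 𝔤) : Prop :=
  ∀ f : SmoothFun E S, (PowerSeries.coeff 0 (D X) f).1 1 = 0

/-- `u` is a `D`-retract. -/
structure IsRetract [MeasurableSpace S] (μ : Measure S) (D : 𝔤 →ₗ[ℝ] FormalOp E S)
    (u : FormalDist E S) : Prop where
  weak : ∀ Z, InStabilizer D Z → IsWeakSolution μ (D Z) u
  support : FormalDist.support u = {1}
  semiclassical : ∀ φ : TestFun E S, (u 0).toLin φ = φ.1.1 1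

/-- `Δ` is the modular function: `d(y⁻¹) = Δ(y) dy`, where `dy` is the measure `μ`. -/
def IsModularFunction [MeasurableSpace S] (μ : Measure S) (Δ : SmoothFun E S) : Prop :=
  ∀ φ : TestFun E S, ∫ y, φ.1.1 y⁻¹ ∂μ = ∫ y, φ.1.1 y * Δ.1 y ∂μ

/-- The test function `R_{x⁻¹}^⋆ (φ^∨)`, that is `y ↦ φ (x y⁻¹)`. -/
def TestFun.flipTranslate (x : S) (φ : TestFun E S) : TestFun E S :=
  ⟨⟨fun y => φ.1.1 (x * y⁻¹),
    (φ.1.2 : ContMDiff 𝓘(ℝ, E) 𝓘(ℝ, ℂ) ∞ φ.1.1).comp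
      (contMDiff_const.mul (contMDiff_inv 𝓘(ℝ, E) ∞))⟩, by
    have : IsTopologicalGroup S := topologicalGroup_of_lieGroup 𝓘(ℝ, E) ∞
    exact HasCompactSupport.comp_homeomorph φ.2
      ((Homeomorph.inv S).trans (Homeomorph.mulLeft x))⟩

/-- `τ` is the inverse retract operator of `u`: a formal series of differential operators on
`C^∞(S)` with `τ φ (x) = ⟨u, Δ R_{x⁻¹}^⋆ (φ^∨)⟩` for every test function `φ`. -/
def IsInverseRetractOp [MeasurableSpace S] (μ : Measure S) (u : FormalDist E S)
    (τ : FormalOp E S) : Prop :=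
  (∀ k, IsDiffOp (PowerSeries.coeff k τ)) ∧
  ∃ Δ : SmoothFun E S, IsModularFunction μ Δ ∧
    ∀ (k : ℕ) (φ : TestFun E S) (x : S),
      (PowerSeries.coeff k τ φ.1).1 x = (u k).toLin ((φ.flipTranslate x).smoothMul Δ)

/-- `T` is the direct retract operator `T_u` of `u`: the inverse of the inverse retract operator. -/
def IsDirectRetractOp [MeasurableSpace S] (μ : Measure S) (u : FormalDist E S)
    (T : FormalOp E S) : Prop :=
  ∃ τ : FormalOp E S, IsInverseRetractOp μ u τ ∧ T * τ = 1 ∧ τ * T = 1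

/-- `ρ` is a symplectic action of the Lie algebra `𝔤` on `(S, ω)` that restricts to `𝔰` as the
regular one, `Y ↦ Y^⋆`. -/
structure IsSymplecticAction (om : SymplecticForm E S) (ι : GroupLieAlgebra 𝓘(ℝ, E) S →ₗ⁅ℝ⁆ 𝔤)
    (ρ : 𝔤 → SmoothVF E S) : Prop where
  map_add : ∀ X Y x, (ρ (X + Y)).val x = (ρ X).val x + (ρ Y).val x
  map_smul : ∀ (c : ℝ) X x, (ρ (c • X)).val x = c • (ρ X).val x
  map_lie : ∀ X Y x,
    (ρ ⁅X, Y⁆).val x = VectorField.mlieBracket 𝓘(ℝ, E) (ρ X).val (ρ Y).val x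
  symplectic : ∀ X, om.IsSymplecticVF (ρ X)
  rel : ∀ Y x, (ρ (ι Y)).val x = fundVF Y x

end Groups

end Retract

end

open Retract

set_option linter.unusedSectionVars false

/-! The retract `u` and its operator `τ` carry the same data. A distribution supported at the unit
is a finite-order functional there, and such functionals are exactly φ ↦ (w φ)(1) with `w` in the
algebra generated by the left-invariant vector fields (`exists_leftInvAlg_of_support`,
`exists_leftInvAlg_of_functional`). After a twist by inversion and the modular function, `u` becomes
a formal series `τ` of left-invariant differential operators with ⟨u_k, φ⟩ = (τ_kᵗ φ)(1). Since τ =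
id + O(ν), it has an inverse `T` of the same kind, and T(⋆) is a star-product.

For (i) the point is that D_X τ = τ X_D^⋆ for every X: then T D_X T⁻¹ = X_D^⋆, and conjugating a
derivation of ⋆ by `T` gives a derivation of T(⋆). Let `defect` be D_X τ − τ X_D^⋆. It vanishes on
𝔰, because 𝔰 acts by right-invariant fields, which commute with left-invariant operators; it is also
compatible with brackets by 𝔰. Its transpose is examined at the unit. For Z in 𝔨 the term D_Z τ
contributes ⟨u, D_Zᵗ φ⟩ = 0. The term τ Z_D^⋆ contributes the value at the unit of Z_D^⋆ (τᵗ φ), up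
to sign, which is 0 by definition of 𝔨; this needs the transpose of Z_D^⋆ to be −Z_D^⋆
(`IsDerivation.isTr_neg`). As 𝔤 = 𝔨 + 𝔰, all transposed defects vanish at the unit. In a
left-invariant frame their coefficients satisfy a linear first-order system with constant
coefficients along the right-invariant fields, so they vanish on the connected group
(`eq_zero_of_bracket_rightInvOp`).

The fields X_D^⋆ are divergence free because they are derivations of the Poisson bracket, as are the
right-invariant fields: writing X_D^⋆ = ∑ a_i R_i, the matrix A = (R_k a_l) satisfies AΠ = −ΠAᵗ with
Π the invertible Poisson matrix, so its trace ∑ R_i a_i is zero. The R_i themselves are skew for a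
left Haar measure.

For (ii), an equivalence `T` commuting with left translations has coefficients in the left-invariant
algebra. With τ = T⁻¹, put D_X = τ ρ(X) T and ⟨u_k, φ⟩ = (τ_kᵗ φ)(1). The defect of `D` is then
zero, and the transposition identity of part (i), read backwards, says that `u` is a weak solution.
-/

namespace Retract
-- Smooth dependence of integrals on a parameter.
section ParametricIntegrals

variable {E₁ : Type*} [NormedAddCommGroup E₁] [NormedSpace ℝ E₁]
  {Z : Type*} [TopologicalSpace Z] [ChartedSpace E₁ Z] [IsManifold 𝓘(ℝ, E₁) ∞ Z]
  {E₂ : Type*} [NormedAddCommGroup E₂] [NormedSpace ℝ E₂]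

/-- The partial derivative is the tangent map of `F` evaluated on the field (0, v) of the product,
which is smooth since the zero section and the constant field are. -/
theorem contMDiff_fderiv_snd {F : Z × E₂ → ℂ}
    (hF : ContMDiff (𝓘(ℝ, E₁).prod 𝓘(ℝ, E₂)) 𝓘(ℝ, ℂ) ∞ F) (v : E₂) :
    ContMDiff (𝓘(ℝ, E₁).prod 𝓘(ℝ, E₂)) 𝓘(ℝ, ℂ) ∞
      (fun q : Z × E₂ => fderiv ℝ (fun p => F (q.1, p)) q.2 v) := by
  let F₁ : Z × E₂ → TangentBundle 𝓘(ℝ, E₁) Z × TangentBundle 𝓘(ℝ, E₂) E₂ :=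
    fun q => (⟨q.1, 0⟩, ⟨q.2, v⟩)
  have S₁ : ContMDiff (𝓘(ℝ, E₁).prod 𝓘(ℝ, E₂)) ((𝓘(ℝ, E₁)).tangent.prod (𝓘(ℝ, E₂)).tangent) ∞ F₁ := by
    apply ContMDiff.prodMk
    · exact (Bundle.contMDiff_zeroSection ℝ (TangentSpace 𝓘(ℝ, E₁) : Z → Type _)).comp contMDiff_fst
    · have : ContMDiff 𝓘(ℝ, E₂) (𝓘(ℝ, E₂)).tangent ∞
          (fun p : E₂ => (⟨p, v⟩ : TangentBundle 𝓘(ℝ, E₂) E₂)) := by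
        exact contMDiff_vectorSpace_iff_contDiff.2 contDiff_const
      exact this.comp contMDiff_snd
  have S₂ : ContMDiff ((𝓘(ℝ, E₁)).tangent.prod (𝓘(ℝ, E₂)).tangent)
      (𝓘(ℝ, E₁).prod 𝓘(ℝ, E₂)).tangent ∞
      (equivTangentBundleProd 𝓘(ℝ, E₁) Z 𝓘(ℝ, E₂) E₂).symm := contMDiff_equivTangentBundleProd_symm
  have S₃ := hF.contMDiff_tangentMap (m := ∞) (by simp)
  have S₄ := (contMDiff_snd_tangentBundle_modelSpace (n := ∞) ℂ 𝓘(ℝ, ℂ)).comp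
    ((S₃.comp S₂).comp S₁)
  convert S₄ using 1
  ext q
  have h0 := hF.mdifferentiable (by simp) q
  have h1 : HasMFDerivAt 𝓘(ℝ, E₂) (𝓘(ℝ, E₁).prod 𝓘(ℝ, E₂)) (fun p : E₂ => (q.1, p)) q.2
      (ContinuousLinearMap.inr ℝ E₁ E₂) := (hasMFDerivAt_const q.1 q.2).prodMk (hasMFDerivAt_id q.2)
  have h2 := (h0.hasMFDerivAt (x := q)).comp q.2 h1
  have h3 := h2.mfderiv
  rw [mfderiv_eq_fderiv] at h3
  exact DFunLike.congr_fun h3 v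

variable [FiniteDimensional ℝ E₂]

theorem continuous_fderiv_snd {F : Z × E₂ → ℂ}
    (hF : ContMDiff (𝓘(ℝ, E₁).prod 𝓘(ℝ, E₂)) 𝓘(ℝ, ℂ) ∞ F) :
    Continuous (fun q : Z × E₂ => fderiv ℝ (fun p => F (q.1, p)) q.2) :=
  continuous_clm_apply.2 fun v => (contMDiff_fderiv_snd hF v).continuous

variable [SecondCountableTopology Z] [MeasurableSpace Z] [BorelSpace Z] [T2Space Z]
  {μ : Measure Z} [IsFiniteMeasureOnCompacts μ]

theorem contDiff_snd_of_contMDiff {F : Z × E₂ → ℂ}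
    (hF : ContMDiff (𝓘(ℝ, E₁).prod 𝓘(ℝ, E₂)) 𝓘(ℝ, ℂ) ∞ F) (z : Z) :
    ContDiff ℝ ∞ (fun p => F (z, p)) :=
  (hF.comp (contMDiff_const.prodMk contMDiff_id)).contDiff

/-- Dominated differentiation: the partial derivative is continuous, hence bounded on `K` times the
unit ball around `p₀`. -/
theorem hasFDerivAt_setIntegral_of_contMDiff {F : Z × E₂ → ℂ}
    (hF : ContMDiff (𝓘(ℝ, E₁).prod 𝓘(ℝ, E₂)) 𝓘(ℝ, ℂ) ∞ F) {K : Set Z} (hK : IsCompact K)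
    (p₀ : E₂) :
    HasFDerivAt (fun p => ∫ z in K, F (z, p) ∂μ)
      (∫ z in K, fderiv ℝ (fun p => F (z, p)) p₀ ∂μ) p₀ := by
  have hc := continuous_fderiv_snd hF
  have : IsFiniteMeasure (μ.restrict K) := ⟨by simpa using hK.measure_lt_top⟩
  obtain ⟨C, hC⟩ := (hK.prod (isCompact_closedBall p₀ 1)).exists_bound_of_continuousOn
    hc.continuousOn
  refine hasFDerivAt_integral_of_dominated_of_fderiv_le (s := Metric.closedBall p₀ 1)
    (F' := fun p z => fderiv ℝ (fun p => F (z, p)) p) (bound := fun _ => C)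
    (Metric.closedBall_mem_nhds p₀ one_pos) (.of_forall fun p => ?_) ?_ ?_ ?_ ?_ ?_
  · exact (hF.continuous.comp (.prodMk_left p)).aestronglyMeasurable
  · exact (hF.continuous.comp (.prodMk_left p₀)).continuousOn.integrableOn_compact hK
  · exact (hc.comp (.prodMk_left p₀)).aestronglyMeasurable
  · filter_upwards [ae_restrict_mem hK.measurableSet] with z hz p hp
    exact hC (z, p) ⟨hz, hp⟩
  · exact integrable_const _
  · exact .of_forall fun z p _ =>
      ((contDiff_snd_of_contMDiff hF z).differentiable (by simp) p).hasFDerivAt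

theorem contDiff_setIntegral_of_contMDiff {F : Z × E₂ → ℂ}
    (hF : ContMDiff (𝓘(ℝ, E₁).prod 𝓘(ℝ, E₂)) 𝓘(ℝ, ℂ) ∞ F) {K : Set Z} (hK : IsCompact K) :
    ContDiff ℝ ∞ (fun p => ∫ z in K, F (z, p) ∂μ) := by
  rw [contDiff_infty]
  intro n
  induction n generalizing F with
  | zero =>
    exact contDiff_zero.2 (continuous_iff_continuousAt.2 fun p =>
      (hasFDerivAt_setIntegral_of_contMDiff hF hK p).continuousAt)
  | succ n ih =>
    have hd := hasFDerivAt_setIntegral_of_contMDiff (μ := μ) hF hK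
    rw [Nat.cast_add, Nat.cast_one, contDiff_succ_iff_fderiv_apply]
    refine ⟨fun p => (hd p).differentiableAt, by simp, fun v => ?_⟩
    convert ih (contMDiff_fderiv_snd hF v) using 2 with p
    rw [(hd p).fderiv, ContinuousLinearMap.integral_apply]
    exact ((continuous_fderiv_snd hF).comp (.prodMk_left p)).continuousOn.integrableOn_compact hK

end ParametricIntegrals
end Retract

namespace Retract
-- Left- and right-invariant vector fields as derivations of C^∞(S).
noncomputable section InvariantFields

theorem deriv_deriv_comm {G : ℝ × ℝ → ℂ} (hG : ContDiff ℝ ∞ G) :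
    deriv (fun t => deriv (fun s => G (s, t)) 0) 0 =
      deriv (fun s => deriv (fun t => G (s, t)) 0) 0 := by
  have hd : Differentiable ℝ G := hG.differentiable (by simp)
  have hd' : Differentiable ℝ (fderiv ℝ G) := (hG.fderiv_right (m := 1) (by norm_cast)).differentiable (by simp)
  have h1 : ∀ s t : ℝ, deriv (fun s => G (s, t)) s = fderiv ℝ G (s, t) (1, 0) := fun s t =>
    ((hd (s, t)).hasFDerivAt.comp_hasDerivAt s
      ((hasDerivAt_id s).prodMk (hasDerivAt_const s t))).deriv
  have h2 : ∀ s t : ℝ, deriv (fun t => G (s, t)) t = fderiv ℝ G (s, t) (0, 1) := fun s t =>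
    ((hd (s, t)).hasFDerivAt.comp_hasDerivAt t
      ((hasDerivAt_const t s).prodMk (hasDerivAt_id t))).deriv
  simp_rw [h1, h2]
  have h3 : HasDerivAt (fun t : ℝ => fderiv ℝ G (0, t) (1, 0))
      (fderiv ℝ (fderiv ℝ G) (0, 0) (0, 1) (1, 0)) 0 := by
    have := HasFDerivAt.comp_hasDerivAt (f := fun t : ℝ => ((0 : ℝ), t)) (0 : ℝ)
      (hd' (0, 0)).hasFDerivAt ((hasDerivAt_const (0 : ℝ) (0 : ℝ)).prodMk (hasDerivAt_id (0 : ℝ)))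
    exact this.clm_apply (hasDerivAt_const _ _) |>.congr_deriv (by simp)
  have h4 : HasDerivAt (fun s : ℝ => fderiv ℝ G (s, 0) (0, 1))
      (fderiv ℝ (fderiv ℝ G) (0, 0) (1, 0) (0, 1)) 0 := by
    have := HasFDerivAt.comp_hasDerivAt (f := fun t : ℝ => (t, (0 : ℝ))) (0 : ℝ)
      (hd' (0, 0)).hasFDerivAt ((hasDerivAt_id (0 : ℝ)).prodMk (hasDerivAt_const (0 : ℝ) (0 : ℝ)))
    exact this.clm_apply (hasDerivAt_const _ _) |>.congr_deriv (by simp)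
  rw [h3.deriv, h4.deriv]
  exact (hG.contDiffAt.isSymmSndFDerivAt (by simp; norm_cast)) _ _

variable {E : Type*} [NormedAddCommGroup E] [NormedSpace ℝ E] [FiniteDimensional ℝ E]
  {S : Type*} [TopologicalSpace S] [ChartedSpace E S]

section Charts
variable [IsManifold 𝓘(ℝ, E) ∞ S]

theorem dfun_eq_fderiv {h : S → ℂ} {x : S} (hh : MDifferentiableAt 𝓘(ℝ, E) 𝓘(ℝ, ℂ) h x) :
    dfun h x = fderiv ℝ (h ∘ (extChartAt 𝓘(ℝ, E) x).symm) (extChartAt 𝓘(ℝ, E) x x) := by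
  unfold dfun
  refine (if_pos hh).trans ?_
  simp only [writtenInExtChartAt, extChartAt_model_space_eq_id, modelWithCornersSelf_coe,
    Set.range_id, fderivWithin_univ]
  rfl

theorem exists_curve (x : S) (v : TangentSpace 𝓘(ℝ, E) x) :
    ∃ γ : ℝ → S, ContMDiff 𝓘(ℝ, ℝ) 𝓘(ℝ, E) ∞ γ ∧ γ 0 = x ∧
      (∃ C, IsCompact C ∧ ∀ t, γ t ∈ C) ∧
      ∀ h : S → ℂ, MDifferentiableAt 𝓘(ℝ, E) 𝓘(ℝ, ℂ) h x →
        deriv (fun t => h (γ t)) 0 = dfun h x v := by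
  let w : E := v
  set c := extChartAt 𝓘(ℝ, E) x with hc
  have hopen : IsOpen c.target := isOpen_extChartAt_target x
  have hline : Continuous (fun s : ℝ => c x + s • w) := by fun_prop
  have hmem : {s : ℝ | c x + s • w ∈ c.target} ∈ 𝓝 (0 : ℝ) := by
    apply hline.continuousAt.preimage_mem_nhds
    rw [zero_smul, add_zero]
    exact extChartAt_target_mem_nhds (I := 𝓘(ℝ, E)) x
  obtain ⟨ε, hε, hball⟩ := Metric.nhds_basis_closedBall.mem_iff.1 hmem
  -- The parameter ε sin(t/ε) has derivative 1 at 0 and stays in [−ε, ε], so the curve is defined on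
  -- all of ℝ and never leaves a compact part of the chart.
  have hin : ∀ t : ℝ, ε * Real.sin (t / ε) ∈ Metric.closedBall (0 : ℝ) ε := fun t => by
    rw [mem_closedBall_zero_iff, Real.norm_eq_abs, abs_mul, abs_of_pos hε]
    nlinarith [Real.abs_sin_le_one (t / ε)]
  have hcsm : ContMDiffOn 𝓘(ℝ, E) 𝓘(ℝ, E) ∞ c.symm c.target := contMDiffOn_extChartAt_symm x
  have hl : ContDiff ℝ ∞ (fun t : ℝ => c x + (ε * Real.sin (t / ε)) • w) := by fun_prop
  refine ⟨fun t => c.symm (c x + (ε * Real.sin (t / ε)) • w), ?_, ?_, ?_, ?_⟩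
  · exact hcsm.comp_contMDiff hl.contMDiff fun t => hball (hin t)
  · simp [hc]
  · refine ⟨(fun s : ℝ => c.symm (c x + s • w)) '' Metric.closedBall 0 ε,
      (isCompact_closedBall _ _).image_of_continuousOn ?_, fun t => ⟨_, hin t, rfl⟩⟩
    exact hcsm.continuousOn.comp hline.continuousOn fun s hs => hball hs
  · intro h hh
    rw [dfun_eq_fderiv hh]
    have hd : DifferentiableAt ℝ (h ∘ c.symm) (c x) := by
      have := (mdifferentiableAt_iff _ _).1 hh |>.2
      simp only [writtenInExtChartAt, extChartAt_model_space_eq_id, modelWithCornersSelf_coe,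
        Set.range_id, differentiableWithinAt_univ] at this
      exact this
    have h1 : HasDerivAt (fun t : ℝ => c x + (ε * Real.sin (t / ε)) • w) w 0 := by
      have := (((hasDerivAt_id (0 : ℝ)).div_const ε).sin.const_mul ε).smul_const w |>.const_add (c x)
      refine this.congr_deriv ?_
      simp [hε.ne']
    have h2 := HasFDerivAt.comp_hasDerivAt (x := (0 : ℝ)) (l := h ∘ c.symm)
      (f := fun t : ℝ => c x + (ε * Real.sin (t / ε)) • w) (l' := fderiv ℝ (h ∘ c.symm) (c x))
      (by simpa using hd.hasFDerivAt) h1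
    exact h2.deriv

theorem SmoothFun.mdifferentiableAt (f : SmoothFun E S) (x : S) :
    MDifferentiableAt 𝓘(ℝ, E) 𝓘(ℝ, ℂ) f.1 x :=
  (f.2 : ContMDiff 𝓘(ℝ, E) 𝓘(ℝ, ℂ) ∞ f.1).mdifferentiable (by simp) x

theorem dfun_mul {f g : S → ℂ} {x : S} (hf : MDifferentiableAt 𝓘(ℝ, E) 𝓘(ℝ, ℂ) f x)
    (hg : MDifferentiableAt 𝓘(ℝ, E) 𝓘(ℝ, ℂ) g x) (v : TangentSpace 𝓘(ℝ, E) x) :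
    dfun (f * g) x v = f x * dfun g x v + dfun f x v * g x := by
  have h := (hf.hasMFDerivAt.mul hg.hasMFDerivAt).mfderiv
  unfold dfun
  rw [h]
  change f x * _ + g x * _ = _
  rw [mul_comm (g x)]
  rfl

theorem dfun_add {f g : S → ℂ} {x : S} (hf : MDifferentiableAt 𝓘(ℝ, E) 𝓘(ℝ, ℂ) f x)
    (hg : MDifferentiableAt 𝓘(ℝ, E) 𝓘(ℝ, ℂ) g x) (v : TangentSpace 𝓘(ℝ, E) x) :
    dfun (f + g) x v = dfun f x v + dfun g x v := by
  unfold dfun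
  rw [mfderiv_add hf hg]
  rfl

theorem dfun_smul {f : S → ℂ} {x : S} (hf : MDifferentiableAt 𝓘(ℝ, E) 𝓘(ℝ, ℂ) f x)
    (c : ℂ) (v : TangentSpace 𝓘(ℝ, E) x) :
    dfun (c • f) x v = c * dfun f x v := by
  have hL := (ContinuousLinearMap.mul ℝ ℂ c).hasMFDerivAt (x := f x)
  have h := (hL.comp x hf.hasMFDerivAt).mfderiv
  unfold dfun
  have h' : (c • f) = (ContinuousLinearMap.mul ℝ ℂ c) ∘ f := rfl
  rw [h', h]
  rfl

end Charts

section Group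

variable [Group S] [LieGroup 𝓘(ℝ, E) ∞ S]

theorem contMDiff_comp_mul {f : S → ℂ} (hf : ContMDiff 𝓘(ℝ, E) 𝓘(ℝ, ℂ) ∞ f) :
    ContMDiff (𝓘(ℝ, E).prod 𝓘(ℝ, E)) 𝓘(ℝ, ℂ) ∞ (fun p : S × S => f (p.1 * p.2)) :=
  hf.comp (contMDiff_mul 𝓘(ℝ, E) ∞)

theorem contMDiff_dfun_snd {F : S × S → ℂ}
    (hF : ContMDiff (𝓘(ℝ, E).prod 𝓘(ℝ, E)) 𝓘(ℝ, ℂ) ∞ F) (v : GroupLieAlgebra 𝓘(ℝ, E) S) :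
    ContMDiff 𝓘(ℝ, E) 𝓘(ℝ, ℂ) ∞ (fun x => dfun (fun y => F (x, y)) 1 v) := by
  obtain ⟨γ, hγ, -, -, hd⟩ := exists_curve (1 : S) v
  have h1 : ContMDiff (𝓘(ℝ, E).prod 𝓘(ℝ, ℝ)) 𝓘(ℝ, ℂ) ∞ (fun p : S × ℝ => F (p.1, γ p.2)) :=
    hF.comp (contMDiff_fst.prodMk (hγ.comp contMDiff_snd))
  have h2 := (contMDiff_fderiv_snd h1 (1 : ℝ)).comp
    (contMDiff_id.prodMk (contMDiff_const (c := (0 : ℝ))))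
  refine h2.congr fun x => ?_
  have h3 : ContMDiff 𝓘(ℝ, E) 𝓘(ℝ, ℂ) ∞ (fun y => F (x, y)) :=
    hF.comp (contMDiff_const.prodMk contMDiff_id)
  rw [← hd _ (h3.mdifferentiable (by simp) 1)]
  rfl

/-- The derivation of `C^∞(S)` given by the left-invariant vector field with value `v` at `1`. -/
def leftInvOp (v : GroupLieAlgebra 𝓘(ℝ, E) S) : SmoothOp E S where
  toFun f := ⟨fun x => dfun (leftPull x f).1 1 v, contMDiff_dfun_snd (contMDiff_comp_mul f.2) v⟩
  map_add' f g := by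
    ext x
    exact dfun_add ((leftPull x f).mdifferentiableAt 1) ((leftPull x g).mdifferentiableAt 1) v
  map_smul' c f := by
    ext x
    exact dfun_smul ((leftPull x f).mdifferentiableAt 1) c v

/-- `f ↦ f (· g)`. -/
def rightPull (g : S) : SmoothOp E S where
  toFun f := ⟨fun x => f.1 (x * g),
    (f.2 : ContMDiff 𝓘(ℝ, E) 𝓘(ℝ, ℂ) ∞ f.1).comp contMDiff_mul_right⟩
  map_add' _ _ := rfl
  map_smul' _ _ := rfl

/-- The derivation of `C^∞(S)` given by the right-invariant vector field with value `v` at `1`. -/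
def rightInvOp (v : GroupLieAlgebra 𝓘(ℝ, E) S) : SmoothOp E S where
  toFun f := ⟨fun x => dfun (rightPull x f).1 1 v, contMDiff_dfun_snd
    (F := fun p : S × S => f.1 (p.2 * p.1)) ((contMDiff_comp_mul f.2).comp
      (contMDiff_snd.prodMk contMDiff_fst)) v⟩
  map_add' f g := by
    ext x
    exact dfun_add ((rightPull x f).mdifferentiableAt 1) ((rightPull x g).mdifferentiableAt 1) v
  map_smul' c f := by
    ext x
    exact dfun_smul ((rightPull x f).mdifferentiableAt 1) c v

/-- `f ↦ f (·⁻¹)`. -/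
def invPull : SmoothOp E S where
  toFun f := ⟨fun x => f.1 x⁻¹,
    (f.2 : ContMDiff 𝓘(ℝ, E) 𝓘(ℝ, ℂ) ∞ f.1).comp (contMDiff_inv 𝓘(ℝ, E) ∞)⟩
  map_add' _ _ := rfl
  map_smul' _ _ := rfl

theorem leftInvOp_apply (v : GroupLieAlgebra 𝓘(ℝ, E) S) (f : SmoothFun E S) (x : S) :
    (leftInvOp v f).1 x = dfun (leftPull x f).1 1 v := rfl

theorem rightInvOp_apply (v : GroupLieAlgebra 𝓘(ℝ, E) S) (f : SmoothFun E S) (x : S) :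
    (rightInvOp v f).1 x = dfun (rightPull x f).1 1 v := rfl

theorem leftPull_mul (g : S) (f h : SmoothFun E S) :
    leftPull g (f * h) = leftPull g f * leftPull g h := rfl

theorem rightPull_one (f : SmoothFun E S) : rightPull 1 f = f := by
  ext x; simp [rightPull]

theorem leftPull_one (f : SmoothFun E S) : leftPull 1 f = f := by
  ext x; simp [leftPull]

theorem leftPull_leftPull (g h : S) (f : SmoothFun E S) :
    leftPull g (leftPull h f) = leftPull (h * g) f := by
  ext x; simp [leftPull, mul_assoc]

theorem leftInvOp_mul (v : GroupLieAlgebra 𝓘(ℝ, E) S) (f g : SmoothFun E S) :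
    leftInvOp v (f * g) = f * leftInvOp v g + leftInvOp v f * g := by
  ext x
  have := dfun_mul ((leftPull x f).mdifferentiableAt 1) ((leftPull x g).mdifferentiableAt 1) v
  refine this.trans ?_
  simp [leftPull, leftInvOp]

theorem rightInvOp_mul (v : GroupLieAlgebra 𝓘(ℝ, E) S) (f g : SmoothFun E S) :
    rightInvOp v (f * g) = f * rightInvOp v g + rightInvOp v f * g := by
  ext x
  have := dfun_mul ((rightPull x f).mdifferentiableAt 1) ((rightPull x g).mdifferentiableAt 1) v
  refine this.trans ?_
  simp [rightPull, rightInvOp]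

theorem rightInvOp_add (v w : GroupLieAlgebra 𝓘(ℝ, E) S) :
    (rightInvOp (v + w) : SmoothOp E S) = rightInvOp v + rightInvOp w := by
  ext f x; exact map_add _ v w

theorem rightInvOp_smul (c : ℝ) (v : GroupLieAlgebra 𝓘(ℝ, E) S) :
    (rightInvOp (c • v) : SmoothOp E S) = (c : ℂ) • rightInvOp v := by
  ext f x; exact (map_smul (dfun (rightPull x f).1 1) c v).trans (Complex.real_smul)

theorem leftInvOp_apply_one (v : GroupLieAlgebra 𝓘(ℝ, E) S) (f : SmoothFun E S) :
    (leftInvOp v f).1 1 = (rightInvOp v f).1 1 := by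
  rw [leftInvOp_apply, rightInvOp_apply, rightPull_one, leftPull_one]

theorem leftPull_leftInvOp (g : S) (v : GroupLieAlgebra 𝓘(ℝ, E) S) (f : SmoothFun E S) :
    leftPull g (leftInvOp v f) = leftInvOp v (leftPull g f) := by
  ext x
  change dfun (leftPull (g * x) f).1 1 v = dfun (leftPull x (leftPull g f)).1 1 v
  rw [leftPull_leftPull]

/-- Both compositions are mixed partial derivatives at the origin of f(δ(s) x γ(t)). -/
theorem commute_leftInvOp_rightInvOp (v w : GroupLieAlgebra 𝓘(ℝ, E) S) :
    Commute (leftInvOp v : SmoothOp E S) (rightInvOp w) := by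
  obtain ⟨γ, hγ, hγ0, -, hd⟩ := exists_curve (1 : S) v
  obtain ⟨δ, hδ, hδ0, -, hd'⟩ := exists_curve (1 : S) w
  ext f x
  have hG : ContDiff ℝ ∞ (fun p : ℝ × ℝ => f.1 (δ p.1 * x * γ p.2)) := by
    rw [← contMDiff_iff_contDiff]
    have h₁ : ContMDiff 𝓘(ℝ, ℝ × ℝ) 𝓘(ℝ, ℝ) ∞ (Prod.fst : ℝ × ℝ → ℝ) := contDiff_fst.contMDiff
    have h₂ : ContMDiff 𝓘(ℝ, ℝ × ℝ) 𝓘(ℝ, ℝ) ∞ (Prod.snd : ℝ × ℝ → ℝ) := contDiff_snd.contMDiff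
    have hf : ContMDiff 𝓘(ℝ, E) 𝓘(ℝ, ℂ) ∞ f.1 := f.2
    exact hf.comp (((hδ.comp h₁).mul contMDiff_const).mul (hγ.comp h₂))
  have h := deriv_deriv_comm hG
  have e1 : ∀ t, deriv (fun s => f.1 (δ s * x * γ t)) 0 = (rightInvOp w f).1 (x * γ t) := by
    intro t
    rw [rightInvOp_apply, ← hd' _ (SmoothFun.mdifferentiableAt _ 1)]
    simp [rightPull, mul_assoc]
  have e2 : ∀ s, deriv (fun t => f.1 (δ s * x * γ t)) 0 = (leftInvOp v f).1 (δ s * x) := by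
    intro s
    rw [leftInvOp_apply, ← hd _ (SmoothFun.mdifferentiableAt _ 1)]
    rfl
  simp only [e1, e2] at h
  have e3 := hd _ (SmoothFun.mdifferentiableAt (leftPull x (rightInvOp w f)) 1)
  have e4 := hd' _ (SmoothFun.mdifferentiableAt (rightPull x (leftInvOp v f)) 1)
  exact e3.symm.trans (h.trans e4)

/-- The function f(γ(s) γ(t)⁻¹) is constant on the diagonal s = t, so its two partial derivatives at
the origin cancel. -/
theorem dfun_invPull (v : GroupLieAlgebra 𝓘(ℝ, E) S) (f : SmoothFun E S) :
    dfun (invPull f).1 1 v = - dfun f.1 1 v := by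
  obtain ⟨γ, hγ, hγ0, -, hd⟩ := exists_curve (1 : S) v
  have hf : ContMDiff 𝓘(ℝ, E) 𝓘(ℝ, ℂ) ∞ f.1 := f.2
  have hG : ContDiff ℝ ∞ (fun p : ℝ × ℝ => f.1 (γ p.1 * (γ p.2)⁻¹)) := by
    rw [← contMDiff_iff_contDiff]
    have h₁ : ContMDiff 𝓘(ℝ, ℝ × ℝ) 𝓘(ℝ, ℝ) ∞ (Prod.fst : ℝ × ℝ → ℝ) := contDiff_fst.contMDiff
    have h₂ : ContMDiff 𝓘(ℝ, ℝ × ℝ) 𝓘(ℝ, ℝ) ∞ (Prod.snd : ℝ × ℝ → ℝ) := contDiff_snd.contMDiff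
    exact hf.comp ((hγ.comp h₁).mul (hγ.comp h₂).inv)
  have hdG := (hG.differentiable (by simp) (0, 0)).hasFDerivAt
  have k1 := (HasFDerivAt.comp_hasDerivAt (f := fun t : ℝ => (t, (0 : ℝ))) (0 : ℝ)
      hdG ((hasDerivAt_id (0 : ℝ)).prodMk (hasDerivAt_const (0 : ℝ) (0 : ℝ)))).deriv
  have k2 := (HasFDerivAt.comp_hasDerivAt (f := fun t : ℝ => ((0 : ℝ), t)) (0 : ℝ)
      hdG ((hasDerivAt_const (0 : ℝ) (0 : ℝ)).prodMk (hasDerivAt_id (0 : ℝ)))).deriv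
  have k3 := (HasFDerivAt.comp_hasDerivAt (f := fun t : ℝ => (t, t)) (0 : ℝ)
      hdG ((hasDerivAt_id (0 : ℝ)).prodMk (hasDerivAt_id (0 : ℝ)))).deriv
  simp only [Function.comp_def, hγ0, inv_one, mul_one, one_mul, mul_inv_cancel, deriv_const] at k1 k2 k3
  rw [hd f.1 (f.mdifferentiableAt 1)] at k1
  replace k2 := (hd (invPull f).1 ((invPull f).mdifferentiableAt 1)).symm.trans k2
  rw [k1, k2, eq_neg_iff_add_eq_zero, ← map_add, k3]
  simp

theorem invPull_invPull (f : SmoothFun E S) : invPull (invPull f) = f := by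
  ext x; simp [invPull]

theorem invPull_leftInvOp (v : GroupLieAlgebra 𝓘(ℝ, E) S) (f : SmoothFun E S) :
    invPull (leftInvOp v f) = - rightInvOp v (invPull f) := by
  ext x
  change dfun (leftPull x⁻¹ f).1 1 v = - dfun (rightPull x (invPull f)).1 1 v
  rw [← dfun_invPull]
  congr 2
  ext y
  simp [leftPull, rightPull, invPull]

theorem dfun_fundVF (v : GroupLieAlgebra 𝓘(ℝ, E) S) (x : S) (f : SmoothFun E S) :
    dfun f.1 x (fundVF v x) = - (rightInvOp v f).1 x := by
  rw [rightInvOp_apply, ← map_neg]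
  have h1 : MDifferentiableAt 𝓘(ℝ, E) 𝓘(ℝ, E) (fun y : S => y * x) 1 :=
    (contMDiff_mul_right (I := 𝓘(ℝ, E)) (n := ∞) (a := x)).mdifferentiable (by simp) 1
  have h2 : MDifferentiableAt 𝓘(ℝ, E) 𝓘(ℝ, ℂ) f.1 ((fun y : S => y * x) 1) := f.mdifferentiableAt _
  have h3 := mfderiv_comp (1 : S) h2 h1
  have h4 := DFunLike.congr_fun h3 (-v)
  refine Eq.trans ?_ h4.symm
  change (mfderiv 𝓘(ℝ, E) 𝓘(ℝ, ℂ) f.1 x) (fundVF v x) =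
    (mfderiv 𝓘(ℝ, E) 𝓘(ℝ, ℂ) f.1 (1 * x)) (fundVF v x)
  rw [one_mul]

end Group

end InvariantFields
end Retract

namespace Retract
-- Hadamard's lemma and global functions serving as coordinates at the unit.
noncomputable section Coordinates

variable {E : Type*} [NormedAddCommGroup E] [NormedSpace ℝ E] [FiniteDimensional ℝ E]

/-- Hadamard's lemma: integrate the derivative of `F` along the segment from `a` to `p`; each `h i`
is the average of a partial derivative. -/
theorem exists_eq_sum_coord_mul {ι : Type*} [Fintype ι] (b : Module.Basis ι ℝ E) {F : E → ℂ}
    (hF : ContDiff ℝ ∞ F) {a : E} (ha : F a = 0) :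
    ∃ h : ι → E → ℂ, (∀ i, ContDiff ℝ ∞ (h i)) ∧
      ∀ p, F p = ∑ i, ((b.repr (p - a) i : ℝ) : ℂ) * h i p := by
  have hF' : ContDiff ℝ ∞ (fderiv ℝ F) := hF.fderiv_right (by simp)
  refine ⟨fun i p => ∫ t in Set.Icc (0 : ℝ) 1, fderiv ℝ F (a + t • (p - a)) (b i),
    fun i => ?_, fun p => ?_⟩
  · have h : ContDiff ℝ ∞ (fun q : ℝ × E => fderiv ℝ F (a + q.1 • (q.2 - a)) (b i)) := by
      fun_prop
    have h' := h.contMDiff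
    rw [modelWithCornersSelf_prod, ← chartedSpaceSelf_prod] at h'
    exact contDiff_setIntegral_of_contMDiff h' isCompact_Icc
  · have hd : ∀ t ∈ Set.uIcc (0 : ℝ) 1, HasDerivAt (fun t : ℝ => F (a + t • (p - a)))
        (fderiv ℝ F (a + t • (p - a)) (p - a)) t := fun t _ => by
      have h1 : HasDerivAt (fun t : ℝ => a + t • (p - a)) (p - a) t := by
        simpa using ((hasDerivAt_id t).smul_const (p - a)).const_add a
      exact ((hF.differentiable (by simp)) _).hasFDerivAt.comp_hasDerivAt t h1
    have hcont : ∀ v, Continuous (fun t : ℝ => fderiv ℝ F (a + t • (p - a)) v) := fun v => by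
      fun_prop
    have h := intervalIntegral.integral_eq_sub_of_hasDerivAt hd
      ((hcont _).intervalIntegrable 0 1)
    simp only [one_smul, add_sub_cancel, zero_smul, add_zero, ha, sub_zero] at h
    rw [← h, intervalIntegral.integral_of_le zero_le_one, ← integral_Icc_eq_integral_Ioc]
    simp_rw [← integral_const_mul]
    rw [← integral_finsetSum]
    · congr 1
      ext t
      generalize fderiv ℝ F (a + t • (p - a)) = L
      conv_lhs => rw [← b.sum_repr (p - a)]
      rw [map_sum]
      simp [Complex.real_smul]
    · intro i _
      exact ((continuous_const.mul (hcont (b i))).continuousOn).integrableOn_compact isCompact_Icc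

variable {S : Type*} [TopologicalSpace S] [ChartedSpace E S]

/-- A radial contraction by a bump function. Composing with the inverse chart extends chart
expressions to smooth functions on all of `E`. -/
theorem exists_retraction_chart [IsManifold 𝓘(ℝ, E) ∞ S] (x : S) :
    ∃ r : E → E, ContDiff ℝ ∞ r ∧ (∀ p, r p ∈ (extChartAt 𝓘(ℝ, E) x).target) ∧
      ∀ᶠ p in 𝓝 (extChartAt 𝓘(ℝ, E) x x), r p = p := by
  set a := extChartAt 𝓘(ℝ, E) x x
  obtain ⟨ε, hε, hball⟩ := Metric.nhds_basis_closedBall.mem_iff.1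
    (extChartAt_target_mem_nhds (I := 𝓘(ℝ, E)) x)
  let θ : ContDiffBump a := ⟨ε / 2, ε, by positivity, by linarith⟩
  refine ⟨fun p => a + θ p • (p - a), ?_, fun p => hball ?_, ?_⟩
  · have : ContDiff ℝ ∞ θ := θ.contDiff
    fun_prop
  · rw [Metric.mem_closedBall, dist_eq_norm, add_sub_cancel_left, norm_smul, Real.norm_eq_abs,
      abs_of_nonneg θ.nonneg]
    by_cases hp : dist p a ≤ ε
    · rw [dist_eq_norm] at hp
      nlinarith [norm_nonneg (p - a), θ.le_one (x := p), θ.nonneg (x := p)]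
    · rw [θ.zero_of_le_dist (le_of_not_ge hp)]
      simpa using hε.le
  · filter_upwards [θ.eventuallyEq_one] with p hp
    simp [hp]

variable [Group S] [LieGroup 𝓘(ℝ, E) ∞ S] [T2Space S]

/-- With a bump function χ supported where the chart is usable, Hadamard's lemma writes χ² f as a
sum of products of cut-off coordinates and cut-off quotients. The remainder is z f with z = 1 − χ²,
and z vanishes at the unit. Hence the `x i` and `z` generate the ideal of the unit, and the `x i`
generate it modulo its square. -/
theorem exists_coordinates {ι : Type*} [Fintype ι] [DecidableEq ι]
    (b : Module.Basis ι ℝ (GroupLieAlgebra 𝓘(ℝ, E) S)) :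
    ∃ (x : ι → SmoothFun E S) (z : SmoothFun E S),
      (∀ i, (x i).1 1 = 0 ∧ ∀ y, ((x i).1 y).im = 0) ∧
      (∀ i j, (leftInvOp (b j) (x i)).1 1 = if i = j then 1 else 0) ∧
      z.1 1 = 0 ∧ (∀ y, (z.1 y).im = 0) ∧
      ∀ f : SmoothFun E S, f.1 1 = 0 → ∃ h : ι → SmoothFun E S, f = ∑ i, x i * h i + z * f := by
  let b' : Module.Basis ι ℝ E := b
  obtain ⟨r, hr, hrt, hra⟩ := exists_retraction_chart (E := E) (1 : S)
  set c := extChartAt 𝓘(ℝ, E) (1 : S) with hc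
  have hV : ∀ᶠ y in 𝓝 (1 : S), y ∈ c.source ∧ r (c y) = c y :=
    Filter.Eventually.and (extChartAt_source_mem_nhds (I := 𝓘(ℝ, E)) (1 : S))
      ((continuousAt_extChartAt (I := 𝓘(ℝ, E)) (1 : S)).eventually hra)
  obtain ⟨χ, hχ, -⟩ := (SmoothBumpFunction.nhds_basis_support (I := 𝓘(ℝ, E)) hV).mem_iff.1 hV
  have hcs : ContMDiffOn 𝓘(ℝ, E) 𝓘(ℝ, E) ∞ c (chartAt E (1 : S)).source :=
    contMDiffOn_extChartAt
  have hsm : ∀ g : E → ℂ, ContDiff ℝ ∞ g →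
      ContMDiff 𝓘(ℝ, E) 𝓘(ℝ, ℂ) ∞ (fun y => χ y • g (c y)) := fun g hg =>
    χ.contMDiff_smul (hg.contMDiff.comp_contMDiffOn hcs)
  have hcoord : ∀ i, ContDiff ℝ ∞ (fun p : E => ((b'.repr (p - c 1) i : ℝ) : ℂ)) := fun i => by
    have h1 : ContDiff ℝ ∞ (fun p : E => (b'.coord i).toContinuousLinearMap (p - c 1)) := by
      fun_prop
    exact Complex.ofRealCLM.contDiff.comp h1
  have hχ1 : ContMDiff 𝓘(ℝ, E) 𝓘(ℝ, ℂ) ∞ (fun y => (χ y : ℂ)) :=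
    Complex.ofRealCLM.contDiff.contMDiff.comp χ.contMDiff
  let z : SmoothFun E S := ⟨fun y => 1 - (χ y : ℂ) * χ y, by
    exact ((1 : SmoothFun E S) - ⟨_, hχ1⟩ * ⟨_, hχ1⟩ : SmoothFun E S).2⟩
  refine ⟨fun i => ⟨_, hsm _ (hcoord i)⟩, z, fun i => ⟨?_, fun y => ?_⟩, fun i j => ?_, ?_, ?_, ?_⟩
  · simp
  · simp
  · rw [leftInvOp_apply, leftPull_one, dfun_eq_fderiv (SmoothFun.mdifferentiableAt _ 1)]
    have hev : (fun y => χ y • ((b'.repr (c y - c 1) i : ℝ) : ℂ)) ∘ c.symm =ᶠ[𝓝 (c 1)]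
        fun p => (Complex.ofRealCLM.comp (b'.coord i).toContinuousLinearMap) (p - c 1) := by
      have h1 : ∀ᶠ p in 𝓝 (c 1), χ (c.symm p) = 1 := by
        have h2 := continuousAt_extChartAt_symm (I := 𝓘(ℝ, E)) (1 : S)
        have h3 : c.symm (c 1) = 1 := extChartAt_to_inv (I := 𝓘(ℝ, E)) (1 : S)
        exact h2.eventually (by rw [← hc, h3]; exact χ.eventuallyEq_one)
      filter_upwards [h1, extChartAt_target_mem_nhds (I := 𝓘(ℝ, E)) (1 : S)] with p hp hpt
      simp only [Function.comp_apply, hp, one_smul]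
      rw [c.right_inv hpt]
      rfl
    refine (congrArg (fun L : E →L[ℝ] ℂ => L (b' j)) hev.fderiv_eq).trans ?_
    have h4 := ((Complex.ofRealCLM.comp (b'.coord i).toContinuousLinearMap).hasFDerivAt.comp (c 1)
      ((hasFDerivAt_id (c 1)).sub_const (c 1))).fderiv
    refine (congrArg (fun L : E →L[ℝ] ℂ => L (b' j)) h4).trans ?_
    rcases eq_or_ne i j with rfl | hij
    · simp
    · simp [hij]
  · simp [z]
  · simp [z]
  · intro f hf
    have hF : ContDiff ℝ ∞ (fun p => f.1 (c.symm (r p))) := by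
      have h1 : ContMDiffOn 𝓘(ℝ, E) 𝓘(ℝ, E) ∞ c.symm c.target := contMDiffOn_extChartAt_symm 1
      exact ((f.2 : ContMDiff 𝓘(ℝ, E) 𝓘(ℝ, ℂ) ∞ f.1).comp
        (h1.comp_contMDiff hr.contMDiff hrt)).contDiff
    have hra1 : r (c 1) = c 1 := hra.self_of_nhds
    have hc1 : c.symm (c 1) = 1 := extChartAt_to_inv (I := 𝓘(ℝ, E)) (1 : S)
    obtain ⟨h, hh, heq⟩ := exists_eq_sum_coord_mul b' hF (a := c 1) (by simp [hra1, hc1, hf])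
    refine ⟨fun i => ⟨_, hsm _ (hh i)⟩, ?_⟩
    ext y
    have hsum : (∑ i, (⟨_, hsm _ (hcoord i)⟩ : SmoothFun E S) * ⟨_, hsm _ (hh i)⟩).1 y =
        ∑ i, (χ y • ((b'.repr (c y - c 1) i : ℝ) : ℂ)) * (χ y • h i (c y)) := by
      rw [AddSubmonoidClass.coe_finsetSum, Finset.sum_apply]
      rfl
    change f.1 y = _ + (1 - (χ y : ℂ) * χ y) * f.1 y
    rw [hsum]
    by_cases hy : χ y = 0
    · simp [hy]
    · have hy' := hχ (subset_tsupport _ hy)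
      have e := heq (c y)
      rw [hy'.2, c.left_inv hy'.1] at e
      have : ∑ i, (χ y • ((b'.repr (c y - c 1) i : ℝ) : ℂ)) * (χ y • h i (c y)) =
          (χ y : ℂ) * χ y * f.1 y := by
        rw [e, Finset.mul_sum]
        refine Finset.sum_congr rfl fun i _ => ?_
        simp only [Complex.real_smul]
        ring
      rw [this]
      ring

end Coordinates
end Retract

namespace Retract
-- Algebraic differential operators, jets at the unit and the left-invariant algebra.
noncomputable section DifferentialOperators

variable {E : Type*} [NormedAddCommGroup E] [NormedSpace ℝ E]
  {S : Type*} [TopologicalSpace S] [ChartedSpace E S]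

instance : Ring (SmoothOp E S) := Module.End.instRing

local notation "M" => LinearMap.mulLeft ℂ

theorem IsDiffOpOfOrder.zero (n : ℕ) : IsDiffOpOfOrder n (0 : SmoothOp E S) := by
  induction n with
  | zero => intro f; simp
  | succ n ih => intro f; simpa using ih

theorem IsDiffOpOfOrder.add {n : ℕ} {P Q : SmoothOp E S} (hP : IsDiffOpOfOrder n P)
    (hQ : IsDiffOpOfOrder n Q) : IsDiffOpOfOrder n (P + Q) := by
  induction n generalizing P Q with
  | zero =>
    intro f
    have := congrArg₂ (· + ·) (hP f) (hQ f)
    simp only [add_zero] at this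
    rw [← this]; noncomm_ring
  | succ n ih =>
    intro f
    have := ih (hP f) (hQ f)
    convert this using 1
    noncomm_ring

theorem IsDiffOpOfOrder.smul {n : ℕ} {P : SmoothOp E S} (hP : IsDiffOpOfOrder n P) (c : ℂ) :
    IsDiffOpOfOrder n (c • P) := by
  induction n generalizing P with
  | zero => intro f; rw [smul_mul_assoc, mul_smul_comm, ← smul_sub, hP f, smul_zero]
  | succ n ih => intro f; rw [smul_mul_assoc, mul_smul_comm, ← smul_sub]; exact ih (hP f)

theorem IsDiffOpOfOrder.succ {n : ℕ} {P : SmoothOp E S} (hP : IsDiffOpOfOrder n P) :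
    IsDiffOpOfOrder (n + 1) P := by
  induction n generalizing P with
  | zero => intro f; rw [hP f]; exact .zero 0
  | succ n ih => intro f; exact ih (hP f)

theorem IsDiffOpOfOrder.mono {n m : ℕ} (h : n ≤ m) {P : SmoothOp E S}
    (hP : IsDiffOpOfOrder n P) : IsDiffOpOfOrder m P := by
  induction h with
  | refl => exact hP
  | step _ ih => exact ih.succ

theorem IsDiffOpOfOrder.mulLeft (n : ℕ) (f : SmoothFun E S) :
    IsDiffOpOfOrder n (M f : SmoothOp E S) := by
  refine IsDiffOpOfOrder.mono (Nat.zero_le n) fun g => ?_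
  ext1 h
  simp [mul_left_comm]

theorem IsDiffOpOfOrder.one (n : ℕ) : IsDiffOpOfOrder n (1 : SmoothOp E S) := by
  have := IsDiffOpOfOrder.mulLeft n (1 : SmoothFun E S)
  rwa [LinearMap.mulLeft_one] at this

theorem IsDiffOpOfOrder.mul {a b : ℕ} {P Q : SmoothOp E S} (hP : IsDiffOpOfOrder a P)
    (hQ : IsDiffOpOfOrder b Q) : IsDiffOpOfOrder (a + b) (P * Q) := by
  induction hn : a + b generalizing a b P Q with
  | zero =>
    obtain ⟨rfl, rfl⟩ : a = 0 ∧ b = 0 := by omega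
    intro f
    have : P * Q * M f - M f * (P * Q) =
        P * (Q * M f - M f * Q) + (P * M f - M f * P) * Q := by noncomm_ring
    rw [this, hP f, hQ f]; simp
  | succ n ih =>
    intro f
    have : P * Q * M f - M f * (P * Q) =
        P * (Q * M f - M f * Q) + (P * M f - M f * P) * Q := by noncomm_ring
    rw [this]
    apply IsDiffOpOfOrder.add
    · cases b with
      | zero => rw [hQ f, mul_zero]; exact .zero _
      | succ b => exact ih hP (hQ f) (by omega)
    · cases a with
      | zero => rw [hP f, zero_mul]; exact .zero _
      | succ a => exact ih (hP f) hQ (by omega)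

theorem IsDiffOpOfOrder.sum {ι : Type*} {s : Finset ι} {n : ℕ} {P : ι → SmoothOp E S}
    (h : ∀ i ∈ s, IsDiffOpOfOrder n (P i)) : IsDiffOpOfOrder n (∑ i ∈ s, P i) :=
  Finset.sum_induction _ _ (fun _ _ => .add) (.zero n) h

theorem isDiffOpOfOrder_one_of_leibniz {D : SmoothOp E S}
    (hD : ∀ f g, D (f * g) = f * D g + D f * g) : IsDiffOpOfOrder 1 D := by
  intro f
  have : D * M f - M f * D = M (D f) := by
    ext1 g
    simp [hD]
  rw [this]
  exact .mulLeft 0 _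

variable (E S) in
/-- The algebra of differential operators on `C^∞(S)`. -/
def diffOpSubalgebra : Subalgebra ℂ (SmoothOp E S) where
  carrier := {P | IsDiffOp P}
  mul_mem' := fun ⟨_, h⟩ ⟨_, h'⟩ => ⟨_, h.mul h'⟩
  add_mem' := fun ⟨n, h⟩ ⟨m, h'⟩ =>
    ⟨max n m, (h.mono (le_max_left n m)).add (h'.mono (le_max_right n m))⟩
  algebraMap_mem' := fun c => ⟨0, by
    rw [Algebra.algebraMap_eq_smul_one]; exact (IsDiffOpOfOrder.one 0).smul c⟩

variable (E) in
/-- Evaluation at a point. -/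
def evalAt (x : S) : SmoothFun E S →ₐ[ℂ] ℂ :=
  (Pi.evalAlgHom ℂ (fun _ : S => ℂ) x).comp (smoothSubalgebra E S).val

theorem evalAt_apply (x : S) (f : SmoothFun E S) : evalAt E x f = f.1 x := rfl

variable (E) in
/-- The ideal of the functions vanishing at a point. -/
def vanishIdeal (x : S) : Ideal (SmoothFun E S) := RingHom.ker (evalAt E x)

theorem mem_vanishIdeal {x : S} {f : SmoothFun E S} : f ∈ vanishIdeal E x ↔ f.1 x = 0 := Iff.rfl

theorem smul_mem_ideal {I : Ideal (SmoothFun E S)} {f : SmoothFun E S} (hf : f ∈ I) (c : ℂ) :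
    c • f ∈ I := by
  rw [Algebra.smul_def]; exact I.mul_mem_left _ hf

/-- Commuting `P` past one factor of the product lowers the order by one and leaves a term with a
factor vanishing at `x`. -/
theorem IsDiffOpOfOrder.apply_eq_zero {n : ℕ} {P : SmoothOp E S} (hP : IsDiffOpOfOrder n P)
    {x : S} {f : SmoothFun E S} (hf : f ∈ vanishIdeal E x ^ (n + 1)) : (P f).1 x = 0 := by
  induction n generalizing P f with
  | zero =>
    rw [zero_add, pow_one] at hf
    have h := LinearMap.congr_fun (hP f) 1
    have h2 : P f = f * P 1 := by simpa [sub_eq_zero] using h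
    rw [h2]
    change f.1 x * (P 1).1 x = 0
    rw [mem_vanishIdeal.1 hf, zero_mul]
  | succ n ih =>
    rw [pow_succ'] at hf
    induction hf using Submodule.mul_induction_on' with
    | mem_mul_mem a ha b hb =>
      have h2 : P (a * b) = (P * M a - M a * P) b + a * P b := by simp
      rw [h2]
      change ((P * M a - M a * P) b).1 x + a.1 x * (P b).1 x = 0
      rw [ih (hP a) hb, mem_vanishIdeal.1 ha, zero_mul, add_zero]
    | add a _ b _ iha ihb =>
      rw [map_add]
      change (P a).1 x + (P b).1 x = 0
      rw [iha, ihb, add_zero]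

section Group

variable [FiniteDimensional ℝ E] [Group S] [LieGroup 𝓘(ℝ, E) ∞ S]

variable (E S) in
/-- The algebra of differential operators generated by the left-invariant vector fields. -/
def leftInvAlg : Subalgebra ℂ (SmoothOp E S) := Algebra.adjoin ℂ (Set.range leftInvOp)

theorem leftInvOp_mem (v : GroupLieAlgebra 𝓘(ℝ, E) S) :
    leftInvOp v ∈ leftInvAlg E S := Algebra.subset_adjoin ⟨v, rfl⟩

theorem leftInvAlg_le_diffOp : leftInvAlg E S ≤ diffOpSubalgebra E S := by
  refine Algebra.adjoin_le ?_
  rintro _ ⟨v, rfl⟩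
  exact ⟨1, isDiffOpOfOrder_one_of_leibniz (leftInvOp_mul v)⟩

theorem commute_of_mem_leftInvAlg {Q : SmoothOp E S} (hQ : ∀ v, Commute (leftInvOp v) Q)
    {P : SmoothOp E S} (hP : P ∈ leftInvAlg E S) : Commute P Q := by
  have : leftInvAlg E S ≤ Subalgebra.centralizer ℂ {Q} := by
    refine Algebra.adjoin_le ?_
    rintro _ ⟨v, rfl⟩
    rw [SetLike.mem_coe, Subalgebra.mem_centralizer_iff]
    rintro _ rfl
    exact (hQ v).eq.symm
  exact ((Subalgebra.mem_centralizer_iff ℂ).1 (this hP) Q rfl).symm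

theorem leftPull_apply_of_mem {P : SmoothOp E S} (hP : P ∈ leftInvAlg E S) (g : S)
    (f : SmoothFun E S) : leftPull g (P f) = P (leftPull g f) :=
  (LinearMap.congr_fun (commute_of_mem_leftInvAlg (Q := leftPull g) (fun v => by
    ext1 f; exact (leftPull_leftInvOp g v f).symm) hP).eq f).symm

theorem apply_eq_leftPull_apply_one {P : SmoothOp E S} (hP : P ∈ leftInvAlg E S)
    (f : SmoothFun E S) (x : S) : (P f).1 x = (P (leftPull x f)).1 1 := by
  rw [← leftPull_apply_of_mem hP]
  simp [leftPull]

theorem commute_rightInvOp_of_mem {P : SmoothOp E S} (hP : P ∈ leftInvAlg E S)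
    (v : GroupLieAlgebra 𝓘(ℝ, E) S) : Commute P (rightInvOp v) :=
  commute_of_mem_leftInvAlg (fun w => commute_leftInvOp_rightInvOp w v) hP

variable [T2Space S]

/-- Euler's argument: D = ∑ x_i L_i acts on 𝔪^n / 𝔪^(n+1) as multiplication by n, 𝔪 being the ideal
of the unit. The hypotheses put D f in 𝔪^(n+2), and D f − (n+1) f lies there too, so dividing by n +
1 finishes. -/
theorem mem_pow_succ_of_leftInvOp_mem {ι : Type*} [Fintype ι] [DecidableEq ι]
    (b : Module.Basis ι ℝ (GroupLieAlgebra 𝓘(ℝ, E) S)) {n : ℕ} {f : SmoothFun E S}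
    (hf : f ∈ vanishIdeal E (1 : S) ^ (n + 1))
    (h : ∀ i, leftInvOp (b i) f ∈ vanishIdeal E (1 : S) ^ (n + 1)) :
    f ∈ vanishIdeal E (1 : S) ^ (n + 2) := by
  set m := vanishIdeal E (1 : S)
  obtain ⟨x, z, hx, hLx, hz, -, hdiv⟩ := exists_coordinates b
  let D : SmoothOp E S := ∑ i, LinearMap.mulLeft ℂ (x i) * leftInvOp (b i)
  have hDapp : ∀ f, D f = ∑ i, x i * leftInvOp (b i) f := fun f => by
    simp [D, LinearMap.sum_apply]
  have hD : ∀ f g, D (f * g) = f * D g + D f * g := fun f g => by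
    simp only [hDapp, leftInvOp_mul, Finset.mul_sum, Finset.sum_mul, ← Finset.sum_add_distrib]
    refine Finset.sum_congr rfl fun i _ => ?_
    ring
  have h1 : ∀ f ∈ m, D f - f ∈ m ^ 2 := by
    intro f hf
    obtain ⟨g, hg⟩ := hdiv f hf
    have hval : ∀ j, (leftInvOp (b j) f).1 1 = (g j).1 1 := by
      intro j
      have e := congrArg (fun k => evalAt E (1 : S) (leftInvOp (b j) k)) hg
      simp only [map_add, map_sum, leftInvOp_mul, map_mul, evalAt_apply, hLx, (hx _).1, hz,
        mem_vanishIdeal.1 hf] at e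
      simpa using e
    have e : D f - f = ∑ i, x i * (leftInvOp (b i) f - g i) - z * f := by
      rw [hDapp]
      conv_lhs => rw [sub_eq_add_neg]; arg 2; rw [hg]
      simp only [mul_sub, Finset.sum_sub_distrib]
      ring
    rw [e, pow_two]
    refine Ideal.sub_mem _ (Ideal.sum_mem _ fun i _ => Ideal.mul_mem_mul (hx i).1 ?_)
      (Ideal.mul_mem_mul hz hf)
    change (leftInvOp (b i) f).1 1 - (g i).1 1 = 0
    rw [hval, sub_self]
  have h2 : ∀ (n : ℕ), ∀ f ∈ m ^ n, D f - (n : ℂ) • f ∈ m ^ (n + 1) := by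
    intro n
    induction n with
    | zero =>
      intro f _
      rw [hDapp, Nat.cast_zero, zero_smul, sub_zero, zero_add, pow_one]
      exact Ideal.sum_mem _ fun i _ => Ideal.mul_mem_right _ _ (hx i).1
    | succ n ih =>
      intro f hf
      rw [pow_succ'] at hf
      induction hf using Submodule.mul_induction_on' with
      | mem_mul_mem a ha c hc =>
        have e : D (a * c) - ((n + 1 : ℕ) : ℂ) • (a * c) =
            a * (D c - (n : ℂ) • c) + (D a - a) * c := by
          rw [hD, Nat.cast_succ, add_smul, one_smul, mul_sub, mul_smul_comm, sub_mul]
          ring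
        rw [e]
        refine Ideal.add_mem _ ?_ ?_
        · rw [pow_succ']; exact Ideal.mul_mem_mul ha (ih c hc)
        · have := Ideal.mul_mem_mul (h1 a ha) hc
          rwa [← pow_add, show 2 + n = n + 1 + 1 by omega] at this
      | add a _ c _ iha ihc =>
        rw [map_add, smul_add, add_sub_add_comm]
        exact Ideal.add_mem _ iha ihc
  have h3 : ((n + 1 : ℕ) : ℂ) • f ∈ m ^ (n + 2) := by
    have e1 := h2 (n + 1) f hf
    have e2 : D f ∈ m ^ (n + 2) := by
      rw [hDapp, pow_succ']
      exact Ideal.sum_mem _ fun i _ => Ideal.mul_mem_mul (hx i).1 (h i)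
    simpa using Ideal.sub_mem _ e2 e1
  have h4 := smul_mem_ideal h3 ((n + 1 : ℕ) : ℂ)⁻¹
  rwa [smul_smul, inv_mul_cancel₀ (by exact_mod_cast Nat.succ_ne_zero n), one_smul] at h4

/-- The operators are the words of length at most `n` in a basis of left-invariant fields. They need
not be linearly independent, so no Poincaré–Birkhoff–Witt ordering enters. -/
theorem exists_finset_detecting (n : ℕ) :
    ∃ F : Finset (SmoothOp E S), (∀ w ∈ F, w ∈ leftInvAlg E S) ∧
      ∀ f : SmoothFun E S, (∀ w ∈ F, (w f).1 1 = 0) → f ∈ vanishIdeal E (1 : S) ^ (n + 1) := by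
  classical
  have : FiniteDimensional ℝ (GroupLieAlgebra 𝓘(ℝ, E) S) := inferInstanceAs (FiniteDimensional ℝ E)
  let b := Module.finBasis ℝ (GroupLieAlgebra 𝓘(ℝ, E) S)
  induction n with
  | zero =>
    refine ⟨{1}, by simp [one_mem], fun f hf => ?_⟩
    rw [zero_add, pow_one]
    exact hf 1 (by simp)
  | succ n ih =>
    obtain ⟨F, hF, hF'⟩ := ih
    refine ⟨F ∪ (F ×ˢ Finset.univ).image fun q => q.1 * leftInvOp (b q.2), ?_, fun f hf => ?_⟩
    · intro w hw
      rcases Finset.mem_union.1 hw with hw | hw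
      · exact hF w hw
      · obtain ⟨q, hq, rfl⟩ := Finset.mem_image.1 hw
        exact mul_mem (hF _ (Finset.mem_product.1 hq).1) (leftInvOp_mem _)
    · refine mem_pow_succ_of_leftInvOp_mem b
        (hF' f fun w hw => hf w (Finset.mem_union_left _ hw)) fun i => hF' _ fun w hw => ?_
      exact hf _ (Finset.mem_union_right _
        (Finset.mem_image.2 ⟨(w, i), Finset.mem_product.2 ⟨hw, Finset.mem_univ _⟩, rfl⟩))

variable (E S) in
/-- A family of left-invariant operators that is at the unit a basis of the jets of order `≤ n`,
together with functions representing the dual basis. -/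
structure JetFamily (n : ℕ) where
  /-- the size of the family -/
  card : ℕ
  /-- the operators -/
  op : Fin card → SmoothOp E S
  /-- the dual functions -/
  fn : Fin card → SmoothFun E S
  op_mem : ∀ i, op i ∈ leftInvAlg E S
  dual : ∀ i j, (op i (fn j)).1 1 = if i = j then 1 else 0
  approx : ∀ f, f - ∑ i, (op i f).1 1 • fn i ∈ vanishIdeal E (1 : S) ^ (n + 1)

/-- The detecting operators define a linear map Φ into a finite-dimensional space. A basis of the
range of Φ lifts to the functions `fn`; its coordinate functionals, extended to the whole space, are
combinations of the detecting operators and give `op`. -/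
theorem nonempty_jetFamily (n : ℕ) : Nonempty (JetFamily E S n) := by
  classical
  obtain ⟨F, hF, hF'⟩ := exists_finset_detecting (E := E) (S := S) n
  let Φ : SmoothFun E S →ₗ[ℂ] (F → ℂ) :=
    LinearMap.pi fun w => (evalAt E (1 : S)).toLinearMap ∘ₗ w.1
  have hΦ : ∀ f w, Φ f w = (w.1 f).1 1 := fun f w => rfl
  let b := Module.finBasis ℂ (LinearMap.range Φ)
  choose p hp using fun i => (b i).2
  have hext : ∀ i, ∃ e : (F → ℂ) →ₗ[ℂ] ℂ, e ∘ₗ (LinearMap.range Φ).subtype = b.coord i :=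
    fun i => LinearMap.exists_extend _
  choose e he using hext
  let op : Fin (Module.finrank ℂ (LinearMap.range Φ)) → SmoothOp E S :=
    fun i => ∑ w : F, e i (Pi.single w 1) • w.1
  have hop : ∀ i f, (op i f).1 1 = b.coord i ⟨Φ f, f, rfl⟩ := by
    intro i f
    have h1 : evalAt E (1 : S) (op i f) = ∑ w : F, e i (Pi.single w 1) * Φ f w := by
      simp only [op, LinearMap.sum_apply, LinearMap.smul_apply, map_sum, map_smul, smul_eq_mul]
      rfl
    refine h1.trans ?_
    rw [← he, LinearMap.comp_apply, Submodule.subtype_apply, LinearMap.pi_apply_eq_sum_univ (e i)]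
    refine Finset.sum_congr rfl fun w _ => ?_
    rw [smul_eq_mul, mul_comm]
    congr 3
    ext j
    simp [Pi.single_apply, eq_comm]
  refine ⟨⟨_, op, p, fun i => ?_, fun i j => ?_, fun f => hF' _ fun w hw => ?_⟩⟩
  · exact sum_mem fun w _ => Subalgebra.smul_mem _ (hF w w.2) _
  · rw [hop]
    have : (⟨Φ (p j), p j, rfl⟩ : LinearMap.range Φ) = b j := Subtype.ext (hp j)
    rw [this]
    simp [Finsupp.single_apply, eq_comm]
  · have h1 : Φ (f - ∑ i, (op i f).1 1 • p i) = 0 := by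
      rw [map_sub, map_sum, sub_eq_zero]
      have := congrArg (Submodule.subtype _) (b.sum_repr ⟨Φ f, f, rfl⟩)
      rw [map_sum] at this
      refine this.symm.trans (Finset.sum_congr rfl fun i _ => ?_)
      rw [map_smul, map_smul, hop, hp]
      rfl
    exact congrFun h1 ⟨w, hw⟩

/-- A functional killing 𝔪^(n+1) depends only on the jet of order `n`, which a jet family computes.
This is the passage from functionals at the unit to left-invariant operators. -/
theorem exists_leftInvAlg_of_functional {n : ℕ} (l : SmoothFun E S →ₗ[ℂ] ℂ)
    (hl : ∀ f ∈ vanishIdeal E (1 : S) ^ (n + 1), l f = 0) :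
    ∃ w ∈ leftInvAlg E S, ∀ f, l f = (w f).1 1 := by
  obtain ⟨B⟩ := nonempty_jetFamily (E := E) (S := S) n
  refine ⟨∑ i, l (B.fn i) • B.op i,
    sum_mem fun i _ => Subalgebra.smul_mem _ (B.op_mem i) _, fun f => ?_⟩
  have h := hl _ (B.approx f)
  rw [map_sub, sub_eq_zero, map_sum] at h
  change l f = evalAt E (1 : S) _
  rw [h, LinearMap.sum_apply, map_sum]
  refine Finset.sum_congr rfl fun i _ => ?_
  rw [map_smul, LinearMap.smul_apply, map_smul, smul_eq_mul, smul_eq_mul, mul_comm]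
  rfl

/-- The functional f ↦ (T f)(1) comes from an element of the algebra, and an operator commuting with
left translations is determined by its values at the unit. -/
theorem mem_leftInvAlg_of_leftPull {T : SmoothOp E S} (hT : IsDiffOp T)
    (h : ∀ g f, leftPull g (T f) = T (leftPull g f)) : T ∈ leftInvAlg E S := by
  obtain ⟨n, hn⟩ := hT
  obtain ⟨w, hw, hw'⟩ := exists_leftInvAlg_of_functional (n := n)
    ((evalAt E (1 : S)).toLinearMap ∘ₗ T) fun f hf => hn.apply_eq_zero hf
  have : T = w := by
    ext f x
    rw [apply_eq_leftPull_apply_one hw, ← hw']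
    change _ = (T (leftPull x f)).1 1
    rw [← h]
    simp [leftPull]
  rwa [this]

end Group
end DifferentialOperators
end Retract

namespace Retract
-- Differential operators in a left-invariant frame with smooth coefficients.
noncomputable section StructureTheorem

variable {E : Type*} [NormedAddCommGroup E] [NormedSpace ℝ E] [FiniteDimensional ℝ E]
  {S : Type*} [TopologicalSpace S] [ChartedSpace E S] [Group S] [LieGroup 𝓘(ℝ, E) ∞ S] [T2Space S]

local notation "M" => LinearMap.mulLeft ℂ

theorem IsDiffOpOfOrder.conj {n : ℕ} {P : SmoothOp E S} (hP : IsDiffOpOfOrder n P) (g : S) :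
    IsDiffOpOfOrder n (leftPull g * P * leftPull g⁻¹) := by
  have key : ∀ (P : SmoothOp E S) (f : SmoothFun E S),
      leftPull g * P * leftPull g⁻¹ * M f - M f * (leftPull g * P * leftPull g⁻¹) =
        leftPull g * (P * M (leftPull g⁻¹ f) - M (leftPull g⁻¹ f) * P) * leftPull g⁻¹ := by
    intro P f
    ext1 h
    have e : f = leftPull g (leftPull g⁻¹ f) := by
      rw [leftPull_leftPull]; simp [leftPull_one]
    change leftPull g (P (leftPull g⁻¹ (f * h))) - f * leftPull g (P (leftPull g⁻¹ h)) =
      leftPull g (P (leftPull g⁻¹ f * leftPull g⁻¹ h) - leftPull g⁻¹ f * P (leftPull g⁻¹ h))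
    rw [map_sub, leftPull_mul, leftPull_mul, ← e]
  induction n generalizing P with
  | zero =>
    intro f
    refine (key P f).trans ?_
    rw [hP, mul_zero, zero_mul]
  | succ n ih =>
    intro f
    have := ih (hP (leftPull g⁻¹ f))
    rw [← key] at this
    exact this

/-- Left translation by `x` moves the point to the unit without changing the order; there the
remainder of the jet expansion is killed. -/
theorem JetFamily.apply_eq_sum {n : ℕ} (B : JetFamily E S n) {P : SmoothOp E S}
    (hP : IsDiffOpOfOrder n P) (f : SmoothFun E S) (x : S) :
    (P f).1 x = ∑ i, (P (leftPull x⁻¹ (B.fn i))).1 x * (B.op i f).1 x := by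
  have h := (hP.conj x).apply_eq_zero (B.approx (leftPull x f))
  have h' : ∀ f, ((leftPull x * P * leftPull x⁻¹ : SmoothOp E S) f).1 1 = (P (leftPull x⁻¹ f)).1 x := fun f => by
    change (P (leftPull x⁻¹ f)).1 (x * 1) = _
    rw [mul_one]
  rw [h', map_sub, map_sub, leftPull_leftPull, mul_inv_cancel, leftPull_one] at h
  have h2 := sub_eq_zero.1 ((map_sub (evalAt E x) _ _).symm.trans h)
  refine h2.trans ?_
  rw [map_sum, map_sum, map_sum]
  refine Finset.sum_congr rfl fun i _ => ?_
  rw [map_smul, map_smul, map_smul, smul_eq_mul, mul_comm, ← apply_eq_leftPull_apply_one (B.op_mem i)]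
  rfl

theorem JetFamily.op_leftPull_fn {n : ℕ} (B : JetFamily E S n) (i j : Fin B.card) (x : S) :
    (B.op i (leftPull x⁻¹ (B.fn j))).1 x = if i = j then 1 else 0 := by
  rw [apply_eq_leftPull_apply_one (B.op_mem i), leftPull_leftPull, inv_mul_cancel, leftPull_one,
    B.dual]

theorem contMDiff_of_mul_eq {c : S → ℂ}
    (h : ∀ x, ∃ d k : SmoothFun E S, d.1 x ≠ 0 ∧ ∀ y, c y * d.1 y = k.1 y) :
    ContMDiff 𝓘(ℝ, E) 𝓘(ℝ, ℂ) ∞ c := by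
  intro x
  obtain ⟨d, k, hd, hk⟩ := h x
  have hds : ContMDiff 𝓘(ℝ, E) 𝓘(ℝ, ℂ) ∞ d.1 := d.2
  have hks : ContMDiff 𝓘(ℝ, E) 𝓘(ℝ, ℂ) ∞ k.1 := k.2
  have hinv : ContMDiffAt 𝓘(ℝ, E) 𝓘(ℝ, ℂ) ∞ (fun y => (d.1 y)⁻¹) x :=
    (contDiffAt_inv ℝ hd).contMDiffAt.comp x hds.contMDiffAt
  have hmul : ContDiff ℝ ∞ (fun p : ℂ × ℂ => p.1 * p.2) := contDiff_fst.mul contDiff_snd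
  have h1 : ContMDiffAt 𝓘(ℝ, E) 𝓘(ℝ, ℂ) ∞ (fun y => k.1 y * (d.1 y)⁻¹) x :=
    hmul.contMDiff.contMDiffAt.comp x (hks.contMDiffAt.prodMk_space hinv)
  refine h1.congr_of_eventuallyEq ?_
  filter_upwards [hds.continuous.continuousAt.eventually_ne hd] with y hy
  rw [← hk, mul_inv_cancel_right₀ hy]

/-- The functions x ↦ (P (leftPull x⁻¹ fn_i))(x) move with x, so smoothness is not immediate.
Cramer's rule settles it: with the test functions frozen at x₀, the coefficients solve a linear
system with smooth entries whose matrix is the identity at x₀. -/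
theorem JetFamily.contMDiff_coeff {n : ℕ} (B : JetFamily E S n) {P : SmoothOp E S}
    (hP : IsDiffOpOfOrder n P) (i : Fin B.card) :
    ContMDiff 𝓘(ℝ, E) 𝓘(ℝ, ℂ) ∞ (fun x => (P (leftPull x⁻¹ (B.fn i))).1 x) := by
  refine contMDiff_of_mul_eq fun x₀ => ?_
  let q : Fin B.card → SmoothFun E S := fun j => leftPull x₀⁻¹ (B.fn j)
  let A : Matrix (Fin B.card) (Fin B.card) (SmoothFun E S) := fun i j => B.op i (q j)
  have hA : ∀ y, A.map (evalAt E y) = fun i j => (B.op i (q j)).1 y := fun y => rfl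
  refine ⟨A.det, ∑ j, P (q j) * A.adjugate j i, ?_, fun y => ?_⟩
  · have : A.map (evalAt E x₀) = 1 := by
      ext i j
      rw [Matrix.one_apply]
      exact B.op_leftPull_fn i j x₀
    have h1 := (evalAt E x₀).toRingHom.map_det A
    have h2 : A.det.1 x₀ = 1 := by
      refine h1.trans ?_
      rw [AlgHom.toRingHom_eq_coe, RingHom.mapMatrix_apply]
      refine (congrArg Matrix.det this).trans Matrix.det_one
    rw [h2]; exact one_ne_zero
  · have h1 : ∀ j, (P (q j)).1 y = ∑ k, (P (leftPull y⁻¹ (B.fn k))).1 y * (A k j).1 y :=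
      fun j => B.apply_eq_sum hP (q j) y
    have h2 : ∀ k, ∑ j, A k j * A.adjugate j i = if k = i then A.det else 0 := by
      intro k
      have := congrFun (congrFun A.mul_adjugate k) i
      rw [Matrix.mul_apply] at this
      rw [this, Matrix.smul_apply, Matrix.one_apply]
      simp
    have h3 : (∑ j, P (q j) * A.adjugate j i).1 y = ∑ j, (P (q j)).1 y * (A.adjugate j i).1 y := by
      change evalAt E y _ = _
      rw [map_sum]; simp only [map_mul]; rfl
    have h4 : ∀ k, ∑ j, (A k j).1 y * (A.adjugate j i).1 y = if k = i then A.det.1 y else 0 := by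
      intro k
      have := congrArg (evalAt E y) (h2 k)
      rw [map_sum] at this
      simp only [map_mul] at this
      refine this.trans ?_
      split_ifs
      · rfl
      · exact map_zero _
    rw [h3]
    simp_rw [h1, Finset.sum_mul, mul_assoc]
    rw [Finset.sum_comm]
    simp_rw [← Finset.mul_sum, h4]
    simp

/-- The coefficients of a differential operator with respect to a jet family. -/
def JetFamily.coeff {n : ℕ} (B : JetFamily E S n) {P : SmoothOp E S}
    (hP : IsDiffOpOfOrder n P) (i : Fin B.card) : SmoothFun E S :=
  ⟨_, B.contMDiff_coeff hP i⟩

theorem JetFamily.coeff_apply {n : ℕ} (B : JetFamily E S n) {P : SmoothOp E S}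
    (hP : IsDiffOpOfOrder n P) (i : Fin B.card) (x : S) :
    (B.coeff hP i).1 x = (P (leftPull x⁻¹ (B.fn i))).1 x := rfl

theorem JetFamily.eq_sum {n : ℕ} (B : JetFamily E S n) {P : SmoothOp E S}
    (hP : IsDiffOpOfOrder n P) : P = ∑ i, M (B.coeff hP i) * B.op i := by
  ext f x
  rw [B.apply_eq_sum hP]
  change _ = evalAt E x _
  rw [LinearMap.sum_apply, map_sum]
  rfl

theorem JetFamily.coeff_sum {n : ℕ} (B : JetFamily E S n) (c : Fin B.card → SmoothFun E S)
    (i : Fin B.card) (x : S) :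
    (((∑ j, M (c j) * B.op j : SmoothOp E S)) (leftPull x⁻¹ (B.fn i))).1 x = (c i).1 x := by
  change evalAt E x _ = _
  rw [LinearMap.sum_apply, map_sum]
  have : ∀ j, evalAt E x ((M (c j) * B.op j) (leftPull x⁻¹ (B.fn i))) =
      if j = i then (c j).1 x else 0 := fun j => by
    change (c j).1 x * (B.op j (leftPull x⁻¹ (B.fn i))).1 x = _
    rw [B.op_leftPull_fn]
    simp
  simp_rw [this]
  simp

end StructureTheorem
end Retract

namespace Retract
-- Taylor expansion, locality, and vanishing of distributions away from their support.
noncomputable section PointDistributions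

theorem exists_eq_pow_mul_of_deriv {n : ℕ} {q r : ℝ → ℂ} {s₀ : ℝ} (hq : ContDiff ℝ ∞ q)
    (h0 : q s₀ = 0) (hr : ContDiff ℝ ∞ r) (h : ∀ s, deriv q s = ((s - s₀ : ℝ) : ℂ) ^ n * r s) :
    ∃ r' : ℝ → ℂ, ContDiff ℝ ∞ r' ∧ ∀ s, q s = ((s - s₀ : ℝ) : ℂ) ^ (n + 1) * r' s := by
  refine ⟨fun s => ∫ t in Set.Icc (0 : ℝ) 1, (t : ℂ) ^ n * r (s₀ + t * (s - s₀)), ?_, fun s => ?_⟩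
  · have ho : ContDiff ℝ ∞ (fun t : ℝ => (t : ℂ)) := Complex.ofRealCLM.contDiff
    have h : ContDiff ℝ ∞ (fun q : ℝ × ℝ => (q.1 : ℂ) ^ n * r (s₀ + q.1 * (q.2 - s₀))) := by
      have := ho.comp (contDiff_fst (𝕜 := ℝ) (E := ℝ) (F := ℝ) (n := ∞))
      refine (this.pow n).mul (hr.comp ?_)
      fun_prop
    have h' := h.contMDiff
    rw [modelWithCornersSelf_prod, ← chartedSpaceSelf_prod] at h'
    exact contDiff_setIntegral_of_contMDiff h' isCompact_Icc
  · have hd : ∀ t ∈ Set.uIcc (0 : ℝ) 1, HasDerivAt (fun t : ℝ => q (s₀ + t * (s - s₀)))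
        (((s - s₀ : ℝ) : ℂ) ^ (n + 1) * ((t : ℂ) ^ n * r (s₀ + t * (s - s₀)))) t := fun t _ => by
      have h1 : HasDerivAt (fun t : ℝ => s₀ + t * (s - s₀)) (s - s₀) t := by
        simpa using ((hasDerivAt_id t).mul_const (s - s₀)).const_add s₀
      have h2 := ((hq.differentiable (by simp)) (s₀ + t * (s - s₀))).hasDerivAt.scomp t h1
      refine h2.congr_deriv ?_
      rw [h, Complex.real_smul, add_sub_cancel_left, Complex.ofReal_mul, mul_pow]
      ring
    have hcont : Continuous (fun t : ℝ => (t : ℂ) ^ n * r (s₀ + t * (s - s₀))) := by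
      have := hr.continuous
      fun_prop
    have h := intervalIntegral.integral_eq_sub_of_hasDerivAt hd
      ((continuous_const.mul hcont).intervalIntegrable 0 1)
    simp only [one_mul, add_sub_cancel, zero_mul, add_zero, h0, sub_zero] at h
    rw [← h, intervalIntegral.integral_const_mul, intervalIntegral.integral_of_le zero_le_one,
      ← integral_Icc_eq_integral_Ioc]

/-- Smoothness of the remainder `r` matters: after composition with a real function `x`, the
remainder term must lie in a power of the ideal of a point, which requires a smooth cofactor. -/
theorem exists_taylor_remainder (n : ℕ) {g : ℝ → ℂ} (hg : ContDiff ℝ ∞ g) (s₀ : ℝ) :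
    ∃ r : ℝ → ℂ, ContDiff ℝ ∞ r ∧ ∀ s, g s = ∑ j ∈ Finset.range (n + 1),
      iteratedDeriv j g s₀ / (j.factorial : ℂ) * ((s - s₀ : ℝ) : ℂ) ^ j +
        ((s - s₀ : ℝ) : ℂ) ^ (n + 1) * r s := by
  have ho : ∀ s : ℝ, HasDerivAt (fun s : ℝ => ((s - s₀ : ℝ) : ℂ)) 1 s := fun s => by
    simpa using ((hasDerivAt_id s).sub_const s₀).ofReal_comp
  have hoc : ContDiff ℝ ∞ (fun s : ℝ => ((s - s₀ : ℝ) : ℂ)) :=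
    Complex.ofRealCLM.contDiff.comp (contDiff_id.sub contDiff_const)
  induction n generalizing g with
  | zero =>
    obtain ⟨r, hr, h⟩ := exists_eq_pow_mul_of_deriv (n := 0) (q := fun s => g s - g s₀)
      (hg.sub contDiff_const) (sub_self _) (r := deriv g)
      ((contDiff_infty_iff_deriv.1 hg).2) (s₀ := s₀) (fun s => by simp)
    refine ⟨r, hr, fun s => ?_⟩
    have := h s
    simp only [zero_add, pow_one] at this
    simp only [zero_add, Finset.range_one, Finset.sum_singleton, iteratedDeriv_zero,
      Nat.factorial_zero, Nat.cast_one, div_one, pow_zero, mul_one, pow_one]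
    rw [← this]
    ring
  | succ n ih =>
    have hg' : ContDiff ℝ ∞ (deriv g) := (contDiff_infty_iff_deriv.1 hg).2
    obtain ⟨r₁, hr₁, h₁⟩ := ih hg'
    have hpoly : ContDiff ℝ ∞ (fun s => ∑ j ∈ Finset.range (n + 2),
        iteratedDeriv j g s₀ / (j.factorial : ℂ) * ((s - s₀ : ℝ) : ℂ) ^ j) :=
      ContDiff.sum fun j _ => contDiff_const.mul (hoc.pow j)
    obtain ⟨r, hr, h⟩ := exists_eq_pow_mul_of_deriv (n := n + 1)
      (q := fun s => g s - ∑ j ∈ Finset.range (n + 2),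
        iteratedDeriv j g s₀ / (j.factorial : ℂ) * ((s - s₀ : ℝ) : ℂ) ^ j)
      (s₀ := s₀) (hg.sub hpoly) (by simp [Finset.sum_range_succ']) hr₁ (fun s => by
        have hd : HasDerivAt (fun s => ∑ j ∈ Finset.range (n + 2),
            iteratedDeriv j g s₀ / (j.factorial : ℂ) * ((s - s₀ : ℝ) : ℂ) ^ j)
            (∑ j ∈ Finset.range (n + 2), iteratedDeriv j g s₀ / (j.factorial : ℂ) *
              ((j : ℂ) * ((s - s₀ : ℝ) : ℂ) ^ (j - 1) * 1)) s :=
          HasDerivAt.fun_sum fun j _ => ((ho s).pow j).const_mul _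
        have hgd := (hg.differentiable (by simp) s).hasDerivAt
        rw [(hgd.fun_sub hd).deriv, h₁ s, Finset.sum_range_succ' _ (n + 1)]
        have : ∀ j ∈ Finset.range (n + 1), iteratedDeriv (j + 1) g s₀ / ((j + 1).factorial : ℂ) *
              (((j + 1 : ℕ) : ℂ) * ((s - s₀ : ℝ) : ℂ) ^ (j + 1 - 1) * 1) =
            iteratedDeriv j (deriv g) s₀ / (j.factorial : ℂ) * ((s - s₀ : ℝ) : ℂ) ^ j := by
          intro j _
          have h1 : (j.factorial : ℂ) ≠ 0 := by exact_mod_cast j.factorial_ne_zero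
          have h2 : ((j + 1 : ℕ) : ℂ) ≠ 0 := by exact_mod_cast j.succ_ne_zero
          rw [iteratedDeriv_succ', Nat.factorial_succ, Nat.cast_mul, Nat.add_sub_cancel]
          field_simp
        rw [Finset.sum_congr rfl this]
        simp)
    exact ⟨r, hr, fun s => by rw [← h s]; ring⟩

variable {E : Type*} [NormedAddCommGroup E] [NormedSpace ℝ E]
  {S : Type*} [TopologicalSpace S] [ChartedSpace E S]

/-- `y ↦ g (re (x y))`. -/
def compReal (g : ℝ → ℂ) (hg : ContDiff ℝ ∞ g) (x : SmoothFun E S) : SmoothFun E S :=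
  ⟨fun y => g (x.1 y).re, (hg.comp Complex.reCLM.contDiff).contMDiff.comp
    (x.2 : ContMDiff 𝓘(ℝ, E) 𝓘(ℝ, ℂ) ∞ x.1)⟩

/-- `y ↦ P ((x - x(y))^j) (y)` -/
def shiftedPow (P : SmoothOp E S) (x : SmoothFun E S) (j : ℕ) (y : S) : ℂ :=
  (P ((x - algebraMap ℂ _ (x.1 y)) ^ j)).1 y

/-- The binomial formula separates the dependence on `y` through the constant x(y) from the
evaluation at `y`. -/
theorem continuous_shiftedPow (P : SmoothOp E S) (x : SmoothFun E S) (j : ℕ) :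
    Continuous (shiftedPow P x j) := by
  have h : shiftedPow P x j = fun y => ∑ i ∈ Finset.range (j + 1),
      (P (x ^ i)).1 y * (-(x.1 y)) ^ (j - i) * (j.choose i : ℂ) := by
    ext y
    unfold shiftedPow
    rw [sub_eq_add_neg, add_pow, map_sum]
    refine (map_sum (evalAt E y) _ _).trans (Finset.sum_congr rfl fun i _ => ?_)
    have : x ^ i * (-(algebraMap ℂ (SmoothFun E S)) (x.1 y)) ^ (j - i) *
        ((j.choose i : ℕ) : SmoothFun E S) =
        ((-(x.1 y)) ^ (j - i) * (j.choose i : ℂ)) • x ^ i := by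
      rw [Algebra.smul_def, map_mul, map_pow, map_neg, map_natCast]
      ring
    rw [this, map_smul, map_smul, smul_eq_mul, evalAt_apply]
    ring
  rw [h]
  have hx : Continuous x.1 := ContMDiff.continuous (x.2 : ContMDiff 𝓘(ℝ, E) 𝓘(ℝ, ℂ) ∞ x.1)
  refine continuous_finsetSum _ fun i _ => ?_
  have hP : Continuous (P (x ^ i)).1 :=
    ContMDiff.continuous ((P (x ^ i)).2 : ContMDiff 𝓘(ℝ, E) 𝓘(ℝ, ℂ) ∞ (P (x ^ i)).1)
  fun_prop

/-- A chain rule without local coordinates: the Taylor remainder of `g` at x(y) gives an element of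
the (n+1)-st power of the ideal of `y`, which `P` annihilates at `y`. -/
theorem IsDiffOpOfOrder.apply_compReal {n : ℕ} {P : SmoothOp E S} (hP : IsDiffOpOfOrder n P)
    {g : ℝ → ℂ} (hg : ContDiff ℝ ∞ g) {x : SmoothFun E S} (hx : ∀ y, (x.1 y).im = 0) (y : S) :
    (P (compReal g hg x)).1 y = ∑ j ∈ Finset.range (n + 1),
      iteratedDeriv j g (x.1 y).re / (j.factorial : ℂ) * shiftedPow P x j y := by
  obtain ⟨r, hr, h⟩ := exists_taylor_remainder n hg (x.1 y).re
  have hx' : ∀ y', x.1 y' = ((x.1 y').re : ℂ) := fun y' => Complex.ext rfl (by simp [hx y'])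
  set k := x - algebraMap ℂ (SmoothFun E S) (x.1 y) with hk
  have hky : ∀ y', k.1 y' = (((x.1 y').re - (x.1 y).re : ℝ) : ℂ) := fun y' => by
    rw [Complex.ofReal_sub, ← hx', ← hx']; rfl
  have e : compReal g hg x = ∑ j ∈ Finset.range (n + 1),
      (iteratedDeriv j g (x.1 y).re / (j.factorial : ℂ)) • k ^ j + k ^ (n + 1) * compReal r hr x := by
    ext y'
    have e1 := h (x.1 y').re
    rw [← hky] at e1
    refine e1.trans (Eq.trans ?_ (evalAt_apply y' _))
    rw [map_add, map_sum]
    simp only [map_smul, map_mul, map_pow]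
    rfl
  have hk0 : k ∈ vanishIdeal E y := by
    rw [mem_vanishIdeal, hky]; simp
  rw [e, map_add, map_sum]
  have e2 := hP.apply_eq_zero (Ideal.mul_mem_right (compReal r hr x) _ (Ideal.pow_mem_pow hk0 (n + 1)))
  refine (evalAt_apply y _).symm.trans ?_
  rw [map_add, map_sum, evalAt_apply y (P (_ * _)), e2, add_zero]
  simp only [map_smul]
  rfl

section Locality

variable [FiniteDimensional ℝ E] [IsManifold 𝓘(ℝ, E) ∞ S] [T2Space S]

/-- A smooth bump function, as a complex-valued test function. -/
def bumpTest {x : S} (χ : SmoothBumpFunction 𝓘(ℝ, E) x) : TestFun E S :=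
  ⟨⟨fun y => (χ y : ℂ), Complex.ofRealCLM.contDiff.contMDiff.comp χ.contMDiff⟩,
    χ.hasCompactSupport.comp_left (g := fun r : ℝ => (r : ℂ)) Complex.ofReal_zero⟩

theorem bumpTest_apply {x : S} (χ : SmoothBumpFunction 𝓘(ℝ, E) x) (y : S) :
    (bumpTest χ).1.1 y = (χ y : ℂ) := rfl

theorem exists_bump {x : S} {U : Set S} (hU : U ∈ 𝓝 x) :
    ∃ χ : SmoothBumpFunction 𝓘(ℝ, E) x, tsupport χ ⊆ U := by
  obtain ⟨χ, hχ, -⟩ := (SmoothBumpFunction.nhds_basis_support (I := 𝓘(ℝ, E)) hU).mem_iff.1 hU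
  exact ⟨χ, hχ⟩

/-- If χ is a bump function supported where `f` vanishes, then f = f (1 − χ)^n, and 1 − χ vanishes
at `x`. -/
theorem mem_pow_of_eventually_eq_zero {x : S} {f : SmoothFun E S} (hf : ∀ᶠ y in 𝓝 x, f.1 y = 0)
    (n : ℕ) : f ∈ vanishIdeal E x ^ n := by
  obtain ⟨χ, hχ⟩ := exists_bump (E := E) hf
  set k : SmoothFun E S := 1 - (bumpTest χ).1 with hk
  have h1 : k ∈ vanishIdeal E x := by
    rw [mem_vanishIdeal]
    change 1 - (χ x : ℂ) = 0
    simp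
  have h2 : f = f * k := by
    ext y
    change f.1 y = f.1 y * (1 - (χ y : ℂ))
    by_cases hy : χ y = 0
    · simp [hy]
    · have : f.1 y = 0 := hχ (subset_tsupport _ hy)
      simp [this]
  have h3 : f = f * k ^ n := by
    induction n with
    | zero => simp
    | succ n ih => rw [pow_succ, ← mul_assoc, ← ih, ← h2]
  rw [h3]
  exact Ideal.mul_mem_left _ _ (Ideal.pow_mem_pow h1 n)

theorem IsDiffOp.congr_of_eventuallyEq {P : SmoothOp E S} (hP : IsDiffOp P) {x : S}
    {f g : SmoothFun E S} (h : ∀ᶠ y in 𝓝 x, f.1 y = g.1 y) : (P f).1 x = (P g).1 x := by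
  obtain ⟨n, hn⟩ := hP
  have h1 : (f - g) ∈ vanishIdeal E x ^ (n + 1) :=
    mem_pow_of_eventually_eq_zero (h.mono fun y hy => sub_eq_zero.2 hy) _
  have h2 := hn.apply_eq_zero h1
  rw [map_sub] at h2
  exact sub_eq_zero.1 h2

theorem IsDiffOp.apply_eq_zero_of_notMem_tsupport {P : SmoothOp E S} (hP : IsDiffOp P) {x : S}
    {f : SmoothFun E S} (h : x ∉ tsupport f.1) : (P f).1 x = 0 := by
  have := hP.congr_of_eventuallyEq (f := f) (g := 0) (x := x)
    (by filter_upwards [(isClosed_tsupport f.1).isOpen_compl.mem_nhds h] with y hy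
        exact image_eq_zero_of_notMem_tsupport hy)
  rw [this, map_zero]; rfl

/-- A differential operator maps test functions to test functions. -/
def IsDiffOp.onTest {P : SmoothOp E S} (hP : IsDiffOp P) : TestFun E S →ₗ[ℂ] TestFun E S :=
  P.restrict fun _ hφ => HasCompactSupport.intro hφ fun _ hx => hP.apply_eq_zero_of_notMem_tsupport hx

/-- Operators with local values agreeing on test functions are equal. -/
theorem IsDiffOp.ext_test {P Q : SmoothOp E S} (hP : IsDiffOp P) (hQ : IsDiffOp Q)
    (h : ∀ φ : TestFun E S, P φ.1 = Q φ.1) : P = Q := by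
  ext f x
  obtain ⟨χ, -⟩ := exists_bump (E := E) (x := x) Filter.univ_mem
  have h1 : ∀ᶠ y in 𝓝 x, f.1 y = (TestFun.smoothMul f (bumpTest χ)).1.1 y := by
    filter_upwards [χ.eventuallyEq_one] with y hy
    change f.1 y = f.1 y * (χ y : ℂ)
    simp [hy]
  rw [hP.congr_of_eventuallyEq h1, hQ.congr_of_eventuallyEq h1, h]

/-- The support of φ is covered by finitely many sets on which bump functions equal 1, each bump
being supported where `u` vanishes. Multiplying φ by one more factor 1 − χ does not change the
pairing, and the full product with φ is zero. -/
theorem toLin_eq_zero_of_support {u : FormalDist E S} {p : S}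
    (hu : FormalDist.support u ⊆ {p}) (k : ℕ) {φ : TestFun E S} (hφ : ∀ᶠ y in 𝓝 p, φ.1.1 y = 0) :
    (u k).toLin φ = 0 := by
  classical
  have hp : p ∉ tsupport φ.1.1 := by rwa [notMem_tsupport_iff_eventuallyEq]
  have hloc : ∀ x ∈ tsupport φ.1.1, ∃ χ : SmoothBumpFunction 𝓘(ℝ, E) x,
      ∀ ψ : TestFun E S, tsupport ψ.1.1 ⊆ tsupport χ → (u k).toLin ψ = 0 := by
    intro x hx
    have hxp : x ∉ FormalDist.support u := fun hxs => hp (hu hxs ▸ hx)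
    simp only [FormalDist.support, Set.mem_ofPred_eq, not_forall, not_exists, not_and, not_not] at hxp
    obtain ⟨U, hU, hUu⟩ := hxp
    obtain ⟨χ, hχ⟩ := exists_bump (E := E) hU
    exact ⟨χ, fun ψ hψ => hUu k ψ (hψ.trans hχ)⟩
  choose! χ hχ using hloc
  obtain ⟨t, htK, ht⟩ := IsCompact.elim_nhds_subcover (s := tsupport φ.1.1) φ.2 (fun x => {y | χ x y = 1})
    (fun x _ => (χ x).eventuallyEq_one)
  have hind : ∀ t' ⊆ t, (u k).toLin φ =
      (u k).toLin (TestFun.smoothMul (∏ x ∈ t', (1 - (bumpTest (χ x)).1)) φ) := by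
    intro t'
    induction t' using Finset.induction_on with
    | empty =>
      intro _
      congr 1
      ext1
      simp [TestFun.smoothMul]
    | insert x t' hx ih =>
      intro htt
      rw [ih ((Finset.subset_insert _ _).trans htt), Finset.prod_insert hx]
      set g := ∏ x ∈ t', (1 - (bumpTest (χ x)).1)
      have h1 := hχ x (htK x (htt (Finset.mem_insert_self _ _)))
        (TestFun.smoothMul (g * φ.1) (bumpTest (χ x))) (by
          refine (tsupport_mul_subset_right).trans ?_
          refine closure_mono fun y hy => ?_
          simpa [bumpTest] using hy)
      rw [eq_comm, ← sub_eq_zero, ← map_sub, ← neg_eq_zero, ← map_neg, ← h1]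
      congr 1
      ext1
      simp only [TestFun.smoothMul]
      change -((1 - (bumpTest (χ x)).1) * g * φ.1 - g * φ.1) = _
      ring
  rw [hind t subset_rfl]
  convert map_zero (u k).toLin
  ext y
  change (∏ x ∈ t, (1 - (bumpTest (χ x)).1)).1 y * φ.1.1 y = 0
  by_cases hy : y ∈ tsupport φ.1.1
  · obtain ⟨x, hx, hxy⟩ := Set.mem_iUnion₂.1 (ht hy)
    have : (∏ x ∈ t, (1 - (bumpTest (χ x)).1)).1 y = 0 := by
      refine (map_prod (evalAt E y) _ _).trans (Finset.prod_eq_zero hx ?_)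
      change 1 - ((χ x y : ℝ) : ℂ) = 0
      rw [show χ x y = 1 from hxy]; simp
    rw [this, zero_mul]
  · rw [image_eq_zero_of_notMem_tsupport hy, mul_zero]

end Locality

end PointDistributions
end Retract

namespace Retract
-- Distributions supported at a point have finite order.
noncomputable section PointDistributions

theorem exists_bound_iteratedDeriv {g : ℝ → ℂ} (hg : ContDiff ℝ ∞ g) (hgc : HasCompactSupport g)
    (j : ℕ) : ∃ B, ∀ s, ‖iteratedDeriv j g s‖ ≤ B := by
  have hc : HasCompactSupport (iteratedDeriv j g) := by
    induction j with
    | zero => simpa using hgc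
    | succ j ih => rw [iteratedDeriv_succ]; exact ih.deriv
  exact (hg.continuous_iteratedDeriv j (by exact_mod_cast le_top)).bounded_above_of_compact_support hc

variable {E : Type*} [NormedAddCommGroup E] [NormedSpace ℝ E]
  {S : Type*} [TopologicalSpace S] [ChartedSpace E S]

theorem shiftedPow_smul (P : SmoothOp E S) (x : SmoothFun E S) (c : ℂ) (j : ℕ) (y : S) :
    shiftedPow P (c • x) j y = c ^ j * shiftedPow P x j y := by
  unfold shiftedPow
  have : (c • x - algebraMap ℂ (SmoothFun E S) ((c • x).1 y)) ^ j =
      c ^ j • (x - algebraMap ℂ _ (x.1 y)) ^ j := by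
    rw [← smul_pow, smul_sub]
    congr 2
  rw [this, map_smul]
  rfl

variable [FiniteDimensional ℝ E] [IsManifold 𝓘(ℝ, E) ∞ S] [T2Space S]

theorem exists_order_bound (F : Finset (SmoothOp E S)) (hF : ∀ P ∈ F, IsDiffOp P) :
    ∃ n, ∀ P ∈ F, IsDiffOpOfOrder n P := by
  choose! k hk using hF
  exact ⟨F.sup k, fun P hP => (hk P hP).mono (Finset.le_sup hP)⟩

/-- Only the germ at `p` matters, so x^(n+1) may be replaced by its cut-off at scale ε, namely
ε^(n+1) g(x/ε). With `n` a bound for the orders in the continuity estimate on the support of χ,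
every seminorm of the cut-off function is O(ε), so letting ε tend to 0 gives the result. -/
theorem exists_pow_annihilated {u : MDistribution E S} {p : S}
    (hloc : ∀ φ : TestFun E S, (∀ᶠ y in 𝓝 p, φ.1.1 y = 0) → u.toLin φ = 0) (χ : TestFun E S) :
    ∃ n : ℕ, ∀ x h : SmoothFun E S, x.1 p = 0 → (∀ y, (x.1 y).im = 0) →
      u.toLin (TestFun.smoothMul (h * x ^ (n + 1)) χ) = 0 := by
  obtain ⟨F, C, hF, hC⟩ := u.continuous (tsupport χ.1.1) χ.2
  obtain ⟨n, hn⟩ := exists_order_bound F hF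
  refine ⟨n, fun x h hxp hx => ?_⟩
  let θ : ContDiffBump (0 : ℝ) := ⟨1, 2, one_pos, one_lt_two⟩
  -- Since θ = 1 on [−1, 1], ε^(n+1) g(x/ε) agrees with x^(n+1) wherever |x| ≤ ε.
  let g : ℝ → ℂ := fun s => (s : ℂ) ^ (n + 1) * (θ s : ℂ)
  have ho : ContDiff ℝ ∞ (fun t : ℝ => (t : ℂ)) := Complex.ofRealCLM.contDiff
  have hg : ContDiff ℝ ∞ g := (ho.pow _).mul (ho.comp θ.contDiff)
  have hgc : HasCompactSupport g := HasCompactSupport.mul_left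
    (θ.hasCompactSupport.comp_left (g := fun r : ℝ => (r : ℂ)) Complex.ofReal_zero)
  choose B hB using exists_bound_iteratedDeriv hg hgc
  let Q : SmoothOp E S → SmoothOp E S := fun P => P * LinearMap.mulLeft ℂ (χ.1 * h)
  have hQ : ∀ P ∈ F, IsDiffOpOfOrder n (Q P) := fun P hP =>
    (hn P hP).mul (IsDiffOpOfOrder.mulLeft 0 _)
  have hD : ∀ P j, ∃ D, ∀ y ∈ tsupport χ.1.1, ‖shiftedPow (Q P) x j y‖ ≤ D := fun P j =>
    IsCompact.exists_bound_of_continuousOn χ.2 (continuous_shiftedPow (Q P) x j).continuousOn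
  choose D hD using hD
  set A := ∑ P ∈ F, ∑ j ∈ Finset.range (n + 1), |B j| / j.factorial * |D P j| with hA
  have hA0 : 0 ≤ A := by positivity
  have key : ∀ ε : ℝ, 0 < ε → ε ≤ 1 →
      ‖u.toLin (TestFun.smoothMul (h * x ^ (n + 1)) χ)‖ ≤ |C| * A * ε := by
    intro ε hε hε1
    have hεx : ∀ y, (((ε : ℂ)⁻¹ • x).1 y) = (ε⁻¹ * (x.1 y).re : ℝ) := fun y => by
      have hx' : x.1 y = ((x.1 y).re : ℂ) := Complex.ext rfl (by simp [hx y])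
      change (ε : ℂ)⁻¹ * x.1 y = _
      rw [hx']; push_cast; rfl
    have hεim : ∀ y, (((ε : ℂ)⁻¹ • x).1 y).im = 0 := fun y => by
      rw [hεx, Complex.ofReal_im]
    set k := compReal g hg ((ε : ℂ)⁻¹ • x) with hk
    set φ := TestFun.smoothMul (h * ((ε : ℂ) ^ (n + 1) • k)) χ with hφ
    have e1 : u.toLin (TestFun.smoothMul (h * x ^ (n + 1)) χ) = u.toLin φ := by
      rw [← sub_eq_zero, ← map_sub]
      apply hloc
      have hcont : Continuous x.1 := ContMDiff.continuous (x.2 : ContMDiff 𝓘(ℝ, E) 𝓘(ℝ, ℂ) ∞ x.1)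
      have hnear : ∀ᶠ y in 𝓝 p, ‖x.1 y‖ < ε := by
        have := hcont.norm.continuousAt (x := p)
        refine this.eventually (gt_mem_nhds ?_)
        simpa only [hxp, norm_zero] using hε
      filter_upwards [hnear] with y hy
      have hx' : x.1 y = ((x.1 y).re : ℂ) := Complex.ext rfl (by simp [hx y])
      have hθ : θ (ε⁻¹ * (x.1 y).re) = 1 := by
        apply θ.one_of_mem_closedBall
        rw [mem_closedBall_zero_iff, norm_mul, norm_inv, Real.norm_of_nonneg hε.le]
        have : ‖(x.1 y).re‖ ≤ ε := (Complex.abs_re_le_norm _).trans hy.le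
        rw [inv_mul_le_iff₀ hε]
        exact this.trans_eq (mul_one ε).symm
      have hky : k.1 y = ((ε : ℂ)⁻¹ * x.1 y) ^ (n + 1) := by
        change g (((ε : ℂ)⁻¹ • x).1 y).re = _
        rw [hεx, Complex.ofReal_re]
        simp only [g, hθ]
        rw [hx']; simp
      change h.1 y * x.1 y ^ (n + 1) * χ.1.1 y - h.1 y * ((ε : ℂ) ^ (n + 1) * k.1 y) * χ.1.1 y = 0
      rw [hky, mul_pow, inv_pow, mul_inv_cancel_left₀ (pow_ne_zero _ (by exact_mod_cast hε.ne'))]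
      ring
    have hφeq : φ.1 = (ε : ℂ) ^ (n + 1) • (χ.1 * h * k) := by
      change h * ((ε : ℂ) ^ (n + 1) • k) * χ.1 = _
      rw [mul_smul_comm, smul_mul_assoc]
      congr 1
      ring
    have hsupp : tsupport φ.1.1 ⊆ tsupport χ.1.1 := tsupport_mul_subset_right
    have e2 : ∀ P ∈ F, ∀ y, ‖(P φ.1).1 y‖ ≤ A * ε := by
      intro P hP y
      by_cases hy : y ∈ tsupport χ.1.1
      swap
      · rw [(hF P hP).apply_eq_zero_of_notMem_tsupport fun h => hy (hsupp h), norm_zero]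
        positivity
      have e3 : (P φ.1).1 y = (ε : ℂ) ^ (n + 1) * (Q P k).1 y := by
        rw [hφeq, map_smul]; rfl
      -- The j-th derivative of g costs ε^(−j) and j ≤ n, so at least one factor ε of ε^(n+1)
      -- survives.
      have hterm : ∀ j ∈ Finset.range (n + 1),
          ‖(ε : ℂ) ^ (n + 1) * (iteratedDeriv j g (((ε : ℂ)⁻¹ • x).1 y).re / (j.factorial : ℂ) *
            shiftedPow (Q P) ((ε : ℂ)⁻¹ • x) j y)‖ ≤ |B j| / j.factorial * |D P j| * ε := by
        intro j hj
        have hj' : j ≤ n := Nat.lt_succ_iff.1 (Finset.mem_range.1 hj)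
        rw [shiftedPow_smul]
        have e4 : (ε : ℂ) ^ (n + 1) * (iteratedDeriv j g (((ε : ℂ)⁻¹ • x).1 y).re /
            (j.factorial : ℂ) * ((ε : ℂ)⁻¹ ^ j * shiftedPow (Q P) x j y)) =
            iteratedDeriv j g (((ε : ℂ)⁻¹ • x).1 y).re / (j.factorial : ℂ) *
              shiftedPow (Q P) x j y * (ε : ℂ) ^ (n + 1 - j) := by
          rw [pow_sub₀ _ (by exact_mod_cast hε.ne') (by omega : j ≤ n + 1), inv_pow]
          ring
        rw [e4, norm_mul, norm_mul, norm_div, norm_pow, Complex.norm_real, Complex.norm_natCast,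
          Real.norm_of_nonneg hε.le]
        have h1 : ε ^ (n + 1 - j) ≤ ε := pow_le_of_le_one hε.le hε1 (by omega)
        have h2 := (hB j (((ε : ℂ)⁻¹ • x).1 y).re).trans (le_abs_self _)
        have h3 := (hD P j y hy).trans (le_abs_self _)
        gcongr
      rw [e3, (hQ P hP).apply_compReal hg hεim, Finset.mul_sum]
      refine (norm_sum_le _ _).trans ((Finset.sum_le_sum hterm).trans ?_)
      rw [← Finset.sum_mul]
      refine mul_le_mul_of_nonneg_right ?_ hε.le
      exact Finset.single_le_sum (f := fun P => ∑ j ∈ Finset.range (n + 1),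
        |B j| / j.factorial * |D P j|) (fun P _ => by positivity) hP
    rw [e1]
    calc ‖u.toLin φ‖ ≤ C * (A * ε) := hC φ _ hsupp e2 (by positivity)
      _ ≤ |C| * (A * ε) := by gcongr; exact le_abs_self C
      _ = |C| * A * ε := by ring
  have hlim : Filter.Tendsto (fun ε : ℝ => |C| * A * ε) (𝓝[>] 0) (𝓝 0) := by
    have : Filter.Tendsto (fun ε : ℝ => |C| * A * ε) (𝓝 0) (𝓝 (|C| * A * 0)) :=
      (continuous_const.mul continuous_id).tendsto 0
    rw [mul_zero] at this
    exact this.mono_left nhdsWithin_le_nhds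
  have hle := ge_of_tendsto hlim (b := ‖u.toLin (TestFun.smoothMul (h * x ^ (n + 1)) χ)‖) (by
    filter_upwards [Ioc_mem_nhdsGT one_pos] with ε hε using key ε hε.1 hε.2)
  exact norm_le_zero_iff.1 hle

end PointDistributions

/-! ### Distributions at the unit as left-invariant differential operators. -/

noncomputable section GroupDistributions

variable {E : Type*} [NormedAddCommGroup E] [NormedSpace ℝ E] [FiniteDimensional ℝ E]
  {S : Type*} [TopologicalSpace S] [ChartedSpace E S] [Group S] [LieGroup 𝓘(ℝ, E) ∞ S] [T2Space S]

/-- Multiplying by a bump function extends the distribution to all smooth functions. The extension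
kills a power of the ideal of the unit, hence is given by an operator of the left-invariant algebra.
-/
theorem exists_leftInvAlg_of_support {u : FormalDist E S} (hu : FormalDist.support u ⊆ {1})
    (k : ℕ) : ∃ w ∈ leftInvAlg E S, ∀ φ : TestFun E S, (u k).toLin φ = (w φ.1).1 1 := by
  classical
  obtain ⟨χ₀, -⟩ := exists_bump (E := E) (x := (1 : S)) Filter.univ_mem
  set χ := bumpTest χ₀ with hχ
  have hloc := fun φ : TestFun E S => toLin_eq_zero_of_support hu k (φ := φ)
  obtain ⟨n, hn⟩ := exists_pow_annihilated (u := u k) hloc χ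
  have hfd : FiniteDimensional ℝ (GroupLieAlgebra 𝓘(ℝ, E) S) := inferInstanceAs (FiniteDimensional ℝ E)
  obtain ⟨x, z, hx, -, hz, hzim, hdiv⟩ :=
    exists_coordinates (Module.finBasis ℝ (GroupLieAlgebra 𝓘(ℝ, E) S))
  let G : Option (Fin (Module.finrank ℝ (GroupLieAlgebra 𝓘(ℝ, E) S))) → SmoothFun E S :=
    fun o => o.elim z x
  have hG0 : ∀ o, (G o).1 1 = 0 := fun o => by cases o; exacts [hz, (hx _).1]
  have hGim : ∀ o y, ((G o).1 y).im = 0 := fun o => by cases o; exacts [hzim, (hx _).2]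
  have hspan : vanishIdeal E (1 : S) = Ideal.span (Set.range G) := by
    refine le_antisymm (fun f hf => ?_) (Ideal.span_le.2 ?_)
    · obtain ⟨h, hh⟩ := hdiv f hf
      rw [hh]
      refine Ideal.add_mem _ (Ideal.sum_mem _ fun i _ => Ideal.mul_mem_right _ _ ?_)
        (Ideal.mul_mem_right _ _ ?_)
      · exact Ideal.subset_span ⟨some i, rfl⟩
      · exact Ideal.subset_span ⟨none, rfl⟩
    · rintro _ ⟨o, rfl⟩
      exact hG0 o
  have hfg : (vanishIdeal E (1 : S)).FG := by
    rw [hspan]; exact Submodule.fg_span (Set.finite_range G)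
  -- `exists_pow_annihilated` handles only powers of single real functions. The ideal of the unit is
  -- generated by finitely many such functions, so one of its powers lies in the ideal `J` generated
  -- by their powers.
  let J := Ideal.span (Set.range fun o => G o ^ (n + 1))
  have hrad : vanishIdeal E (1 : S) ≤ J.radical := by
    rw [hspan, Ideal.span_le]
    rintro _ ⟨o, rfl⟩
    exact ⟨n + 1, Ideal.subset_span ⟨o, rfl⟩⟩
  obtain ⟨N, hN⟩ := Ideal.exists_pow_le_of_le_radical_of_fg hrad hfg
  let l : SmoothFun E S →ₗ[ℂ] ℂ := (u k).toLin ∘ₗ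
    { toFun := fun f => TestFun.smoothMul f χ
      map_add' := fun f g => by ext1; exact add_mul _ _ _
      map_smul' := fun c f => by ext1; exact smul_mul_assoc _ _ _ }
  have hl : ∀ f ∈ vanishIdeal E (1 : S) ^ (N + 1), l f = 0 := by
    intro f hf
    have hfJ : f ∈ J := hN (Ideal.pow_le_pow_right (Nat.le_succ N) hf)
    obtain ⟨c, rfl⟩ := Ideal.mem_span_range_iff_exists_fun.1 hfJ
    rw [map_sum]
    exact Finset.sum_eq_zero fun o _ => hn (G o) (c o) (hG0 o) (hGim o)
  obtain ⟨w, hw, hlw⟩ := exists_leftInvAlg_of_functional l hl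
  refine ⟨w, hw, fun φ => ?_⟩
  rw [← hlw, ← sub_eq_zero]
  change (u k).toLin φ - (u k).toLin (TestFun.smoothMul φ.1 χ) = 0
  rw [← map_sub]
  apply hloc
  filter_upwards [χ₀.eventuallyEq_one] with y hy
  change φ.1.1 y - φ.1.1 y * (χ₀ y : ℂ) = 0
  simp [hy]

end GroupDistributions
end Retract

namespace Retract
-- Haar measure: skewness of right-invariant fields and the smooth modular function.
noncomputable section HaarIntegration
open scoped Pointwise

/-- Uniqueness of Haar measure compares μ with the right-invariant measure `μ.inv`. Multiplying `f`
beforehand by y ↦ ∫ g(z y) dz cancels the inverse weight in that comparison, and shows that this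
weight is proportional to the modular function. -/
theorem integral_mul_integral_mul {S : Type*} [TopologicalSpace S] [Group S] [IsTopologicalGroup S]
    [LocallyCompactSpace S] [MeasurableSpace S] [BorelSpace S] (μ : Measure S) [μ.IsHaarMeasure]
    {f g : S → ℝ}
    (hf : Continuous f) (hfc : HasCompactSupport f) (hg : Continuous g)
    (hgc : HasCompactSupport g) (hg0 : 0 ≤ g) {x₀ : S} (hgx : g x₀ ≠ 0) :
    ∫ y, f y * (∫ z, g (z * y) ∂μ) ∂μ = (∫ y, f y⁻¹ ∂μ) * ∫ y, g y ∂μ := by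
  have hν : ∀ h : S → ℝ, ∫ z, h z ∂μ.inv = ∫ z, h z⁻¹ ∂μ := fun h =>
    (MeasurableEquiv.inv S).measurableEmbedding.integral_map h
  have : IsFiniteMeasureOnCompacts μ.inv :=
    ⟨fun K hK => by rw [Measure.inv_apply]; exact hK.inv.measure_lt_top⟩
  have : μ.inv.IsOpenPosMeasure :=
    (Homeomorph.inv S).continuous.isOpenPosMeasure_map (Homeomorph.inv S).surjective
  have hD : ∀ y, ∫ z, g (z⁻¹ * y) ∂μ.inv = ∫ z, g (z * y) ∂μ := fun y => by
    rw [hν]; simp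
  have hDc : Continuous fun y => ∫ z, g (z * y) ∂μ := by
    simp_rw [← hD]
    exact continuous_integral_apply_inv_mul hg hgc
  have hDpos : ∀ y, 0 < ∫ z, g (z * y) ∂μ := fun y => by
    have C : Continuous fun z => g (z * y) := by fun_prop
    refine (integral_pos_iff_support_of_nonneg (f := fun z => g (z * y)) (fun z => hg0 (z * y)) ?_).2 ?_
    · exact C.integrable_of_hasCompactSupport (hgc.comp_homeomorph (Homeomorph.mulRight y))
    · exact C.isOpen_support.measure_pos μ ⟨x₀ * y⁻¹, by simpa using hgx⟩
  have := Measure.integral_isMulLeftInvariant_isMulRightInvariant_combo (μ := μ) (ν := μ.inv)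
    (hf.mul hDc) hfc.mul_right hg hgc hg0 hgx
  refine this.trans ?_
  rw [hν]
  congr 1
  refine integral_congr_ae (.of_forall fun y => ?_)
  simp only [hD]
  rw [Pi.mul_apply, mul_assoc, mul_inv_cancel₀ (hDpos _).ne', mul_one]

variable {E : Type*} [NormedAddCommGroup E] [NormedSpace ℝ E] [FiniteDimensional ℝ E]
  {S : Type*} [TopologicalSpace S] [ChartedSpace E S] [Group S] [LieGroup 𝓘(ℝ, E) ∞ S]
  [T2Space S] [SecondCountableTopology S] [MeasurableSpace S] [BorelSpace S]

theorem TestFun.continuous (φ : TestFun E S) : Continuous φ.1.1 :=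
  (φ.1.2 : ContMDiff 𝓘(ℝ, E) 𝓘(ℝ, ℂ) ∞ φ.1.1).continuous

theorem SmoothFun.continuous (f : SmoothFun E S) : Continuous f.1 :=
  (f.2 : ContMDiff 𝓘(ℝ, E) 𝓘(ℝ, ℂ) ∞ f.1).continuous

theorem TestFun.integrable (μ : Measure S) [IsFiniteMeasureOnCompacts μ] (φ : TestFun E S) :
    Integrable φ.1.1 μ :=
  φ.continuous.integrable_of_hasCompactSupport φ.2

theorem SmoothFun.eq_zero_of_integral (μ : Measure S) [μ.IsHaarMeasure] (f : SmoothFun E S)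
    (h : ∀ χ : TestFun E S, ∫ y, f.1 y * χ.1.1 y ∂μ = 0) : f = 0 := by
  have hlc : LocallyCompactSpace S := Manifold.locallyCompact_of_finiteDimensional 𝓘(ℝ, E)
  have h0 : ∀ᵐ x ∂μ, f.1 x = 0 := by
    refine ae_eq_zero_of_integral_contMDiff_smul_eq_zero 𝓘(ℝ, E)
      f.continuous.locallyIntegrable fun g hg hgc => ?_
    have := h ⟨⟨fun y => (g y : ℂ), Complex.ofRealCLM.contDiff.contMDiff.comp hg⟩,
      hgc.comp_left (g := fun r : ℝ => (r : ℂ)) Complex.ofReal_zero⟩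
    rw [← this]
    refine integral_congr_ae (.of_forall fun y => ?_)
    change g y • f.1 y = f.1 y * (g y : ℂ)
    rw [Complex.real_smul, mul_comm]
  have h1 : f.1 =ᵐ[μ] (0 : S → ℂ) := h0
  rw [Continuous.ae_eq_iff_eq μ f.continuous continuous_zero] at h1
  exact Subtype.ext h1

/-- Right-invariant fields generate left translations: ∫ φ(γ(t) y) dy does not depend on t, and its
derivative at 0 is the integral in question. -/
theorem integral_rightInvOp (μ : Measure S) [μ.IsHaarMeasure] (v : GroupLieAlgebra 𝓘(ℝ, E) S)
    (φ : TestFun E S) : ∫ y, (rightInvOp v φ.1).1 y ∂μ = 0 := by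
  have : IsTopologicalGroup S := topologicalGroup_of_lieGroup 𝓘(ℝ, E) ∞
  have hlc : LocallyCompactSpace S := Manifold.locallyCompact_of_finiteDimensional 𝓘(ℝ, E)
  obtain ⟨γ, hγ, hγ0, ⟨C, hC, hγC⟩, hd⟩ := exists_curve (E := E) (1 : S) v
  -- `K` contains the supports of all translates φ(γ(t) ·) at once, so the integration may be
  -- restricted to a fixed compact set.
  set K : Set S := C⁻¹ * tsupport φ.1.1 with hKdef
  have hK : IsCompact K := hC.inv.mul φ.2
  have hout : ∀ y ∉ K, ∀ t, φ.1.1 (γ t * y) = 0 := fun y hy t => by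
    by_contra hne
    exact hy ⟨(γ t)⁻¹, Set.inv_mem_inv.2 (hγC t), γ t * y, subset_tsupport _ hne, by simp⟩
  have hder : ∀ y, (rightInvOp v φ.1).1 y = deriv (fun t => φ.1.1 (γ t * y)) 0 := fun y => by
    rw [rightInvOp_apply, ← hd _ (SmoothFun.mdifferentiableAt _ _)]
    rfl
  have hF : ContMDiff (𝓘(ℝ, E).prod 𝓘(ℝ, ℝ)) 𝓘(ℝ, ℂ) ∞
      (fun q : S × ℝ => φ.1.1 (γ q.2 * q.1)) :=
    (φ.1.2 : ContMDiff 𝓘(ℝ, E) 𝓘(ℝ, ℂ) ∞ φ.1.1).comp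
      ((hγ.comp contMDiff_snd).mul contMDiff_fst)
  have h1 := hasFDerivAt_setIntegral_of_contMDiff (μ := μ) hF hK 0
  have h2 : (fun t : ℝ => ∫ z in K, φ.1.1 (γ t * z) ∂μ) = fun _ => ∫ z, φ.1.1 z ∂μ := by
    ext t
    rw [setIntegral_eq_integral_of_forall_compl_eq_zero fun y hy => hout y hy t]
    exact integral_mul_left_eq_self φ.1.1 (γ t)
  have h3 := h1.hasDerivAt.deriv
  rw [h2, deriv_const] at h3
  rw [← setIntegral_eq_integral_of_forall_compl_eq_zero (s := K) fun y hy => ?_, h3,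
    ContinuousLinearMap.integral_apply]
  · exact integral_congr_ae (.of_forall fun y => by simpa using hder y)
  · exact ((continuous_fderiv_snd hF).comp (.prodMk_left 0)).continuousOn.integrableOn_compact hK
  · rw [hder]
    simp [hout y hy]

/-- For `y` in a compact neighbourhood `N` of y₀ the integrand is supported in the fixed compact set
(supp g) N⁻¹, so the parametric integral theorem applies in a chart. -/
theorem contMDiff_integral_mul (μ : Measure S) [μ.IsHaarMeasure] (g : TestFun E S) :
    ContMDiff 𝓘(ℝ, E) 𝓘(ℝ, ℂ) ∞ (fun y => ∫ z, g.1.1 (z * y) ∂μ) := by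
  have : IsTopologicalGroup S := topologicalGroup_of_lieGroup 𝓘(ℝ, E) ∞
  have hlc : LocallyCompactSpace S := Manifold.locallyCompact_of_finiteDimensional 𝓘(ℝ, E)
  intro y₀
  obtain ⟨N, hN, hNy⟩ := exists_compact_mem_nhds y₀
  set K : Set S := tsupport g.1.1 * N⁻¹
  have hK : IsCompact K := IsCompact.mul g.2 hN.inv
  obtain ⟨r, hr, hrt, hre⟩ := exists_retraction_chart (E := E) y₀
  set c := extChartAt 𝓘(ℝ, E) y₀ with hc
  have hcr : ContMDiff 𝓘(ℝ, E) 𝓘(ℝ, E) ∞ (fun p => c.symm (r p)) :=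
    (contMDiffOn_extChartAt_symm y₀).comp_contMDiff hr.contMDiff hrt
  have hF : ContMDiff (𝓘(ℝ, E).prod 𝓘(ℝ, E)) 𝓘(ℝ, ℂ) ∞
      (fun q : S × E => g.1.1 (q.1 * c.symm (r q.2))) :=
    (g.1.2 : ContMDiff 𝓘(ℝ, E) 𝓘(ℝ, ℂ) ∞ g.1.1).comp
      (contMDiff_fst.mul (hcr.comp contMDiff_snd))
  have h1 := contDiff_setIntegral_of_contMDiff (μ := μ) hF hK
  have h2 : ContMDiffAt 𝓘(ℝ, E) 𝓘(ℝ, ℂ) ∞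
      (fun y => ∫ z in K, g.1.1 (z * c.symm (r (c y))) ∂μ) y₀ :=
    h1.contMDiff.contMDiffAt.comp y₀ (contMDiffAt_extChartAt (n := ∞))
  refine h2.congr_of_eventuallyEq ?_
  have h3 : ∀ᶠ y in 𝓝 y₀, r (c y) = c y :=
    (continuousAt_extChartAt (I := 𝓘(ℝ, E)) y₀).eventually hre
  filter_upwards [hNy, h3, extChartAt_source_mem_nhds (I := 𝓘(ℝ, E)) y₀] with y hy hry hys
  rw [hry, c.left_inv hys]
  refine (setIntegral_eq_integral_of_forall_compl_eq_zero fun z hz => ?_).symm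
  by_contra hne
  exact hz ⟨z * y, subset_tsupport _ hne, y⁻¹, Set.inv_mem_inv.2 hy, by simp⟩

/-- The witness is Δ(y) = ∫ g(z y) dz / ∫ g for a bump function `g`; this form makes both its
smoothness and Δ(1) = 1 visible. -/
theorem exists_isModularFunction (μ : Measure S) [μ.IsHaarMeasure] :
    ∃ Δ : SmoothFun E S, IsModularFunction μ Δ ∧ Δ.1 1 = 1 := by
  have : IsTopologicalGroup S := topologicalGroup_of_lieGroup 𝓘(ℝ, E) ∞
  have hlc : LocallyCompactSpace S := Manifold.locallyCompact_of_finiteDimensional 𝓘(ℝ, E)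
  obtain ⟨g, -⟩ := exists_bump (E := E) (x := (1 : S)) Filter.univ_mem
  have hgx : g 1 ≠ 0 := by simp
  have hgc : HasCompactSupport g := g.hasCompactSupport
  have hg0 : (0 : S → ℝ) ≤ g := fun y => g.nonneg
  have hgcont : Continuous g := g.continuous
  set c : ℝ := ∫ y, g y ∂μ
  have hc : 0 < c := by
    refine (integral_pos_iff_support_of_nonneg hg0
      (hgcont.integrable_of_hasCompactSupport hgc)).2 ?_
    exact hgcont.isOpen_support.measure_pos μ ⟨1, hgx⟩
  have hcC : (c : ℂ) ≠ 0 := by exact_mod_cast hc.ne'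
  have hDr : ∀ y, ∫ z, (bumpTest g).1.1 (z * y) ∂μ = ((∫ z, g (z * y) ∂μ : ℝ) : ℂ) :=
    fun y => integral_ofReal
  let D : SmoothFun E S := ⟨_, contMDiff_integral_mul μ (bumpTest g)⟩
  refine ⟨(c : ℂ)⁻¹ • D, fun φ => ?_, ?_⟩
  · have hi : ∀ y, ((c : ℂ)⁻¹ • D).1 y = (c : ℂ)⁻¹ * ((∫ z, g (z * y) ∂μ : ℝ) : ℂ) :=
      fun y => congrArg ((c : ℂ)⁻¹ * ·) (hDr y)
    -- The comparison of measures is for real functions, so it is applied to the real and imaginary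
    -- parts of φ.
    have key : ∀ L : ℂ →L[ℝ] ℝ, L (∫ y, φ.1.1 y⁻¹ ∂μ) =
        L (∫ y, φ.1.1 y * ((c : ℂ)⁻¹ • D).1 y ∂μ) := fun L => by
      have h1 := integral_mul_integral_mul μ (f := fun y => L (φ.1.1 y))
        (L.continuous.comp φ.continuous)
        (HasCompactSupport.comp_left (g := L) φ.2 (map_zero L)) hgcont hgc hg0 hgx
      rw [← L.integral_comp_comm, ← L.integral_comp_comm, eq_comm]
      · have h2 : ∀ y, L (φ.1.1 y * ((c : ℂ)⁻¹ • D).1 y) =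
            c⁻¹ * (L (φ.1.1 y) * ∫ z, g (z * y) ∂μ) := fun y => by
          rw [hi, ← Complex.ofReal_inv, ← Complex.ofReal_mul, mul_comm (φ.1.1 y),
            ← Complex.real_smul, map_smul, smul_eq_mul]
          ring
        simp_rw [h2]
        rw [integral_const_mul, h1]
        change c⁻¹ * (_ * c) = _
        field_simp
      · exact TestFun.integrable μ
          ⟨φ.1 * ((c : ℂ)⁻¹ • D), HasCompactSupport.mul_right (f := φ.1.1) φ.2⟩
      · exact (φ.continuous.comp continuous_inv).integrable_of_hasCompactSupport
          (HasCompactSupport.comp_homeomorph φ.2 (Homeomorph.inv S))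
    exact Complex.ext (key Complex.reCLM) (key Complex.imCLM)
  · change (c : ℂ)⁻¹ * ∫ z, (bumpTest g).1.1 (z * 1) ∂μ = 1
    rw [hDr]
    simp only [mul_one]
    exact inv_mul_cancel₀ hcC

theorem IsModularFunction.unique {μ : Measure S} [μ.IsHaarMeasure] {Δ Δ' : SmoothFun E S}
    (h : IsModularFunction μ Δ) (h' : IsModularFunction μ Δ') : Δ = Δ' := by
  rw [← sub_eq_zero]
  refine SmoothFun.eq_zero_of_integral μ _ fun χ => ?_
  have h1 : ∀ y, (Δ - Δ').1 y * χ.1.1 y = (χ.1 * Δ).1 y - (χ.1 * Δ').1 y := fun y => by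
    change (Δ.1 y - Δ'.1 y) * χ.1.1 y = χ.1.1 y * Δ.1 y - χ.1.1 y * Δ'.1 y
    ring
  simp_rw [h1]
  rw [integral_sub]
  · exact sub_eq_zero.2 ((h χ).symm.trans (h' χ))
  · exact TestFun.integrable μ ⟨χ.1 * Δ, HasCompactSupport.mul_right (f := χ.1.1) χ.2⟩
  · exact TestFun.integrable μ ⟨χ.1 * Δ', HasCompactSupport.mul_right (f := χ.1.1) χ.2⟩

end HaarIntegration
end Retract

namespace Retract
-- Formal transposes of differential operators.
noncomputable section Transposes

variable {E : Type*} [NormedAddCommGroup E] [NormedSpace ℝ E] [FiniteDimensional ℝ E]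
  {S : Type*} [TopologicalSpace S] [ChartedSpace E S] [Group S] [LieGroup 𝓘(ℝ, E) ∞ S]
  [T2Space S]

local notation "M" => LinearMap.mulLeft ℂ

theorem invPull_mulLeft (f : SmoothFun E S) :
    (invPull * M f : SmoothOp E S) = M (invPull f) * invPull := rfl

theorem invPull_mul_invPull : (invPull * invPull : SmoothOp E S) = 1 :=
  LinearMap.ext invPull_invPull

theorem IsDiffOpOfOrder.conj_invPull {n : ℕ} {P : SmoothOp E S} (hP : IsDiffOpOfOrder n P) :
    IsDiffOpOfOrder n (invPull * P * invPull) := by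
  induction n generalizing P with
  | zero =>
    intro f
    have h := hP (invPull f)
    have h1 : invPull * P * invPull * M f - M f * (invPull * P * invPull) =
        invPull * (P * M (invPull f) - M (invPull f) * P) * invPull := by
      have h2 : (M f * invPull : SmoothOp E S) = invPull * M (invPull f) := by
        rw [invPull_mulLeft, invPull_invPull]
      rw [mul_sub, sub_mul, mul_assoc _ invPull, invPull_mulLeft, ← mul_assoc (M f), ← mul_assoc (M f),
        h2]
      simp only [mul_assoc]
    rw [h1, h]
    simp
  | succ n ih =>
    intro f
    have h := ih (hP (invPull f))
    have h1 : invPull * P * invPull * M f - M f * (invPull * P * invPull) =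
        invPull * (P * M (invPull f) - M (invPull f) * P) * invPull := by
      have h2 : (M f * invPull : SmoothOp E S) = invPull * M (invPull f) := by
        rw [invPull_mulLeft, invPull_invPull]
      rw [mul_sub, sub_mul, mul_assoc _ invPull, invPull_mulLeft, ← mul_assoc (M f), ← mul_assoc (M f),
        h2]
      simp only [mul_assoc]
    rwa [h1]

/-- The operator `f ↦ Δ f^∨`, where `f^∨(y) = f(y⁻¹)`. -/
def modInv (Δ : SmoothFun E S) : SmoothOp E S := M Δ * invPull

theorem modInv_apply (Δ f : SmoothFun E S) (y : S) : (modInv Δ f).1 y = Δ.1 y * f.1 y⁻¹ := rfl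

theorem modInv_apply_one {Δ : SmoothFun E S} (h : Δ.1 1 = 1) (f : SmoothFun E S) :
    (modInv Δ f).1 1 = f.1 1 := by
  rw [modInv_apply, h, one_mul, inv_one]

theorem IsDiffOpOfOrder.conj_modInv {n : ℕ} {P : SmoothOp E S} (hP : IsDiffOpOfOrder n P)
    (Δ : SmoothFun E S) : IsDiffOpOfOrder n (modInv Δ * P * modInv Δ) := by
  have : modInv Δ * P * modInv Δ = M Δ * (invPull * P * invPull) * M (invPull Δ) := by
    have h : (invPull * M (invPull Δ) : SmoothOp E S) = M Δ * invPull := by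
      rw [invPull_mulLeft, invPull_invPull]
    unfold modInv
    simp only [mul_assoc, h]
  rw [this]
  simpa using ((IsDiffOpOfOrder.mulLeft 0 Δ).mul hP.conj_invPull).mul
    (IsDiffOpOfOrder.mulLeft 0 (invPull Δ))

/-- The test function `y ↦ φ(y⁻¹)`. -/
def TestFun.inv (φ : TestFun E S) : TestFun E S :=
  ⟨invPull φ.1, by
    have : IsTopologicalGroup S := topologicalGroup_of_lieGroup 𝓘(ℝ, E) ∞
    exact HasCompactSupport.comp_homeomorph φ.2 (Homeomorph.inv S)⟩

/-- The test function `φ f`. -/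
def TestFun.mulSmooth (φ : TestFun E S) (f : SmoothFun E S) : TestFun E S :=
  ⟨φ.1 * f, HasCompactSupport.mul_right (f := φ.1.1) φ.2⟩

/-- The test function `Δ φ^∨`. -/
def TestFun.modInv (Δ : SmoothFun E S) (φ : TestFun E S) : TestFun E S :=
  φ.inv.smoothMul Δ

variable [SecondCountableTopology S] [MeasurableSpace S] [BorelSpace S]

/-- `Q` is the formal transpose of `P`. -/
def IsTr (μ : Measure S) (P Q : SmoothOp E S) : Prop :=
  ∀ φ χ : TestFun E S, ∫ y, (Q φ.1).1 y * χ.1.1 y ∂μ = ∫ y, φ.1.1 y * (P χ.1).1 y ∂μ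

section
variable {μ : Measure S} {P Q P' Q' : SmoothOp E S}

theorem IsTr.symm (h : IsTr μ P Q) : IsTr μ Q P := fun φ χ => by
  simpa only [mul_comm] using (h χ φ).symm

theorem IsTr.mulLeft (f : SmoothFun E S) : IsTr μ (M f) (M f) := fun φ χ => by
  refine integral_congr_ae (.of_forall fun y => ?_)
  change f.1 y * φ.1.1 y * χ.1.1 y = φ.1.1 y * (f.1 y * χ.1.1 y)
  ring

theorem IsTr.smul (h : IsTr μ P Q) (c : ℂ) : IsTr μ (c • P) (c • Q) := fun φ χ => by
  have h1 : ∀ y, ((c • Q) φ.1).1 y * χ.1.1 y = c * ((Q φ.1).1 y * χ.1.1 y) :=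
    fun y => mul_assoc c _ _
  have h2 : ∀ y, φ.1.1 y * ((c • P) χ.1).1 y = c * (φ.1.1 y * (P χ.1).1 y) :=
    fun y => mul_left_comm _ c _
  simp_rw [h1, h2, integral_const_mul, h φ χ]

theorem IsTr.mul (h : IsTr μ P Q) (h' : IsTr μ P' Q') (hP' : IsDiffOp P') (hQ : IsDiffOp Q) :
    IsTr μ (P * P') (Q' * Q) := fun φ χ =>
  (h' (hQ.onTest φ) χ).trans (h φ (hP'.onTest χ))

variable [μ.IsHaarMeasure]

theorem IsTr.add (h : IsTr μ P Q) (h' : IsTr μ P' Q') : IsTr μ (P + P') (Q + Q') := fun φ χ => by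
  have h1 : ∀ y, ((Q + Q') φ.1).1 y * χ.1.1 y = (Q φ.1).1 y * χ.1.1 y + (Q' φ.1).1 y * χ.1.1 y :=
    fun y => add_mul _ _ _
  have h2 : ∀ y, φ.1.1 y * ((P + P') χ.1).1 y = φ.1.1 y * (P χ.1).1 y + φ.1.1 y * (P' χ.1).1 y :=
    fun y => mul_add _ _ _
  simp_rw [h1, h2]
  rw [integral_add, integral_add, h φ χ, h' φ χ]
  · exact TestFun.integrable μ (φ.mulSmooth (P χ.1))
  · exact TestFun.integrable μ (φ.mulSmooth (P' χ.1))
  · exact TestFun.integrable μ (χ.smoothMul (Q φ.1))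
  · exact TestFun.integrable μ (χ.smoothMul (Q' φ.1))

theorem IsTr.sum {ι : Type*} {s : Finset ι} {P Q : ι → SmoothOp E S}
    (h : ∀ i ∈ s, IsTr μ (P i) (Q i)) : IsTr μ (∑ i ∈ s, P i) (∑ i ∈ s, Q i) := by
  classical
  induction s using Finset.induction_on with
  | empty => intro φ χ; simp
  | insert i s hi ih =>
    rw [Finset.sum_insert hi, Finset.sum_insert hi]
    exact (h i (by simp)).add (ih fun j hj => h j (by simp [hj]))

theorem IsTr.unique (h : IsTr μ P Q) (h' : IsTr μ P Q') (φ : TestFun E S) : Q φ.1 = Q' φ.1 := by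
  rw [← sub_eq_zero]
  refine SmoothFun.eq_zero_of_integral μ _ fun χ => ?_
  have h1 : ∀ y, (Q φ.1 - Q' φ.1).1 y * χ.1.1 y =
      (Q φ.1).1 y * χ.1.1 y - (Q' φ.1).1 y * χ.1.1 y := fun y => sub_mul _ _ _
  simp_rw [h1]
  rw [integral_sub, h φ χ, h' φ χ, sub_self]
  · exact TestFun.integrable μ (χ.smoothMul (Q φ.1))
  · exact TestFun.integrable μ (χ.smoothMul (Q' φ.1))

theorem IsTr.eq_zero (h : IsTr μ P 0) (hP : IsDiffOp P) : P = 0 := by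
  refine hP.ext_test ⟨0, .zero 0⟩ fun χ => ?_
  refine h.symm.unique (Q' := 0) (fun φ χ => ?_) χ
  simp

theorem IsTr.rightInvOp (v : GroupLieAlgebra 𝓘(ℝ, E) S) :
    IsTr μ (rightInvOp v : SmoothOp E S) (-rightInvOp v) := fun φ χ => by
  have h := integral_rightInvOp μ v (φ.mulSmooth χ.1)
  have hD : IsDiffOp (Retract.rightInvOp v : SmoothOp E S) :=
    ⟨1, isDiffOpOfOrder_one_of_leibniz (rightInvOp_mul v)⟩
  have h1 : ∀ y, (Retract.rightInvOp v (φ.mulSmooth χ.1).1).1 y =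
      φ.1.1 y * (Retract.rightInvOp v χ.1).1 y + (Retract.rightInvOp v φ.1).1 y * χ.1.1 y := fun y =>
    congrArg (fun f : SmoothFun E S => f.1 y) (rightInvOp_mul v φ.1 χ.1)
  simp_rw [h1] at h
  rw [integral_add] at h
  · have h2 : ∀ y, ((-Retract.rightInvOp v : SmoothOp E S) φ.1).1 y * χ.1.1 y =
        -((Retract.rightInvOp v φ.1).1 y * χ.1.1 y) := fun y => neg_mul _ _
    simp_rw [h2]
    rw [integral_neg]
    exact (eq_neg_of_add_eq_zero_left h).symm
  · exact TestFun.integrable μ (φ.mulSmooth (Retract.rightInvOp v χ.1))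
  · exact TestFun.integrable μ (χ.smoothMul (Retract.rightInvOp v φ.1))

end

section
variable {μ : Measure S} [μ.IsHaarMeasure] {Δ : SmoothFun E S}

/-- This is the defining property of Δ, read as: the transpose of `invPull` is `modInv Δ`. -/
theorem IsModularFunction.integral_modInv (hΔ : IsModularFunction μ Δ) (φ χ : TestFun E S) :
    ∫ y, (modInv Δ φ.1).1 y * χ.1.1 y ∂μ = ∫ y, φ.1.1 y * (invPull χ.1).1 y ∂μ := by
  have h := hΔ (φ.inv.mulSmooth χ.1)
  have h1 : ∀ y, (φ.inv.mulSmooth χ.1).1.1 y⁻¹ = φ.1.1 y * (invPull χ.1).1 y := fun y => by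
    change φ.1.1 y⁻¹⁻¹ * χ.1.1 y⁻¹ = _
    rw [inv_inv]; rfl
  simp_rw [h1] at h
  rw [h]
  refine integral_congr_ae (.of_forall fun y => ?_)
  change Δ.1 y * φ.1.1 y⁻¹ * χ.1.1 y = φ.1.1 y⁻¹ * χ.1.1 y * Δ.1 y
  ring

/-- Two successive inversions restore the integral, so ∫ ψ = ∫ Δ(y⁻¹) Δ(y) ψ(y) dy for every test
function ψ. -/
theorem IsModularFunction.mul_inv (hΔ : IsModularFunction μ Δ) (y : S) : Δ.1 y * Δ.1 y⁻¹ = 1 := by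
  have key : Δ * invPull Δ - 1 = 0 := by
    refine SmoothFun.eq_zero_of_integral μ _ fun ψ => ?_
    have h1 := hΔ ψ.inv
    have h2 := hΔ (ψ.smoothMul (invPull Δ))
    have e1 : ∀ y, ψ.inv.1.1 y⁻¹ = ψ.1.1 y := fun y => congrArg ψ.1.1 (inv_inv y)
    have e2 : ∀ y, (ψ.smoothMul (invPull Δ)).1.1 y⁻¹ = ψ.inv.1.1 y * Δ.1 y := fun y => by
      change Δ.1 y⁻¹⁻¹ * ψ.1.1 y⁻¹ = ψ.1.1 y⁻¹ * Δ.1 y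
      rw [inv_inv, mul_comm]
    simp_rw [e1] at h1
    simp_rw [e2] at h2
    rw [← h1] at h2
    have e3 : ∀ y, (Δ * invPull Δ - 1).1 y * ψ.1.1 y =
        (ψ.smoothMul (invPull Δ)).1.1 y * Δ.1 y - ψ.1.1 y := fun y => by
      change (Δ.1 y * Δ.1 y⁻¹ - 1) * ψ.1.1 y = Δ.1 y⁻¹ * ψ.1.1 y * Δ.1 y - ψ.1.1 y
      ring
    simp_rw [e3]
    rw [integral_sub, ← h2, sub_self]
    · exact TestFun.integrable μ ((ψ.smoothMul (invPull Δ)).mulSmooth Δ)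
    · exact TestFun.integrable μ ψ
  have h := congrArg (fun f : SmoothFun E S => f.1 y) key
  exact sub_eq_zero.1 h

theorem IsModularFunction.modInv_mul_modInv (hΔ : IsModularFunction μ Δ) : modInv Δ * modInv Δ = 1 := by
  refine LinearMap.ext fun f => Subtype.ext (funext fun y => ?_)
  change Δ.1 y * (Δ.1 y⁻¹ * f.1 y⁻¹⁻¹) = f.1 y
  rw [inv_inv, ← mul_assoc, hΔ.mul_inv, one_mul]

theorem IsModularFunction.apply_one (hΔ : IsModularFunction μ Δ) : Δ.1 1 = 1 := by
  obtain ⟨Δ', h, h1⟩ := exists_isModularFunction (E := E) μ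
  rwa [hΔ.unique h]

theorem IsModularFunction.isTr_conj (hΔ : IsModularFunction μ Δ) {R R' : SmoothOp E S} (h : IsTr μ R' R)
    (hR : IsDiffOp R) (hR' : IsDiffOp R') :
    IsTr μ (invPull * R' * invPull) (modInv Δ * R * modInv Δ) := fun φ χ =>
  (hΔ.integral_modInv (hR.onTest (φ.modInv Δ)) χ).trans <|
    (h (φ.modInv Δ) χ.inv).trans (hΔ.integral_modInv φ (hR'.onTest χ.inv))

theorem IsModularFunction.isTr_leftInvOp (hΔ : IsModularFunction μ Δ) (v : GroupLieAlgebra 𝓘(ℝ, E) S) :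
    IsTr μ (leftInvOp v) (modInv Δ * rightInvOp v * modInv Δ) := by
  have hD : IsDiffOp (rightInvOp v : SmoothOp E S) :=
    ⟨1, isDiffOpOfOrder_one_of_leibniz (rightInvOp_mul v)⟩
  have hD' : IsDiffOp (-rightInvOp v : SmoothOp E S) := (diffOpSubalgebra E S).neg_mem hD
  have h := hΔ.isTr_conj (IsTr.rightInvOp v).symm hD hD'
  have e : invPull * (-rightInvOp v) * invPull = (leftInvOp v : SmoothOp E S) := by
    refine LinearMap.ext fun f => ?_
    change invPull (-(rightInvOp v (invPull f))) = _
    rw [← invPull_leftInvOp, invPull_invPull]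
  rwa [e] at h

/-- `r` is the word `w` reversed, with each left-invariant field replaced by the right-invariant one
of equal value at 1. Since the two kinds commute, the reversal preserves values at the unit; since
transposition also reverses products, conjugating `r` by `modInv Δ` gives the transpose of `w`. -/
theorem IsModularFunction.exists_reverse (hΔ : IsModularFunction μ Δ) {w : SmoothOp E S} (hw : w ∈ leftInvAlg E S) :
    ∃ r : SmoothOp E S, IsDiffOp r ∧ (∀ w' ∈ leftInvAlg E S, Commute w' r) ∧
      (∀ g, (r g).1 1 = (w g).1 1) ∧ IsTr μ w (modInv Δ * r * modInv Δ) := by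
  have hJ := hΔ.modInv_mul_modInv
  induction hw using Algebra.adjoin_induction with
  | mem w hw =>
    obtain ⟨v, rfl⟩ := hw
    exact ⟨rightInvOp v, ⟨1, isDiffOpOfOrder_one_of_leibniz (rightInvOp_mul v)⟩,
      fun w' hw' => commute_rightInvOp_of_mem hw' v, fun g => (leftInvOp_apply_one v g).symm,
      hΔ.isTr_leftInvOp v⟩
  | algebraMap c =>
    refine ⟨algebraMap ℂ _ c, (diffOpSubalgebra E S).algebraMap_mem c,
      fun w' _ => (Algebra.commutes c w').symm, fun g => rfl, ?_⟩
    rw [← Algebra.commutes, mul_assoc, hJ, mul_one, Algebra.algebraMap_eq_smul_one]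
    exact IsTr.smul (fun φ χ => rfl) c
  | add w₁ w₂ _ _ h₁ h₂ =>
    obtain ⟨r₁, d₁, c₁, e₁, t₁⟩ := h₁
    obtain ⟨r₂, d₂, c₂, e₂, t₂⟩ := h₂
    refine ⟨r₁ + r₂, (diffOpSubalgebra E S).add_mem d₁ d₂,
      fun w' hw' => (c₁ w' hw').add_right (c₂ w' hw'),
      fun g => congrArg₂ (· + ·) (e₁ g) (e₂ g), ?_⟩
    rw [mul_add, add_mul]
    exact t₁.add t₂
  | mul w₁ w₂ hw₁ hw₂ h₁ h₂ =>
    obtain ⟨r₁, d₁, c₁, e₁, t₁⟩ := h₁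
    obtain ⟨r₂, d₂, c₂, e₂, t₂⟩ := h₂
    refine ⟨r₂ * r₁, (diffOpSubalgebra E S).mul_mem d₂ d₁,
      fun w' hw' => (c₂ w' hw').mul_right (c₁ w' hw'), fun g => ?_, ?_⟩
    · change (r₂ (r₁ g)).1 1 = (w₁ (w₂ g)).1 1
      rw [e₂, ← e₁]
      exact congrArg (fun f : SmoothFun E S => f.1 1) (LinearMap.congr_fun (c₁ w₂ hw₂).eq g)
    · obtain ⟨n, hn⟩ := d₁
      have h := t₁.mul t₂ (leftInvAlg_le_diffOp hw₂) ⟨n, hn.conj_modInv Δ⟩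
      have e : modInv Δ * r₂ * modInv Δ * (modInv Δ * r₁ * modInv Δ) =
          modInv Δ * (r₂ * r₁) * modInv Δ := by
        calc _ = modInv Δ * r₂ * (modInv Δ * modInv Δ) * r₁ * modInv Δ := by simp only [mul_assoc]
          _ = _ := by rw [hJ, mul_one]; simp only [mul_assoc]
      rwa [e] at h

/-- This is the link between retract and operator: it turns the pairing (τ_k (Δ φ^∨))(1) into (τ_kᵗ
φ)(1). -/
theorem IsModularFunction.transpose_apply_one (hΔ : IsModularFunction μ Δ) {w Q : SmoothOp E S} (hw : w ∈ leftInvAlg E S)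
    (h : IsTr μ w Q) (φ : TestFun E S) : (Q φ.1).1 1 = (w (modInv Δ φ.1)).1 1 := by
  obtain ⟨r, -, -, e, t⟩ := hΔ.exists_reverse hw
  rw [h.unique t φ, ← e]
  exact modInv_apply_one hΔ.apply_one _

/-- The outer factor `modInv Δ` is invisible at the unit. Adding it gives a differential operator,
hence a finite-order functional there, which is all that is needed. -/
theorem IsModularFunction.exists_modInv_mem (hΔ : IsModularFunction μ Δ) {w : SmoothOp E S} (hw : w ∈ leftInvAlg E S) :
    ∃ w' ∈ leftInvAlg E S, ∀ f, (w (modInv Δ f)).1 1 = (w' f).1 1 := by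
  obtain ⟨n, hn⟩ := leftInvAlg_le_diffOp hw
  obtain ⟨w', hw', h⟩ := exists_leftInvAlg_of_functional
    ((evalAt E (1 : S)).toLinearMap ∘ₗ (modInv Δ * w * modInv Δ))
    fun f hf => (hn.conj_modInv Δ).apply_eq_zero hf
  refine ⟨w', hw', fun f => (modInv_apply_one hΔ.apply_one _).symm.trans (h f)⟩

end

/-- In a jet family `P` is a sum of functions times left-invariant operators; both kinds of factor
have transposes. -/
theorem exists_isTr (μ : Measure S) [μ.IsHaarMeasure] {P : SmoothOp E S} (hP : IsDiffOp P) :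
    ∃ Q, IsDiffOp Q ∧ IsTr μ P Q := by
  obtain ⟨Δ, hΔ, -⟩ := exists_isModularFunction (E := E) μ
  obtain ⟨n, hn⟩ := hP
  obtain ⟨B⟩ := nonempty_jetFamily (E := E) (S := S) n
  choose r hr hc he ht using fun i => hΔ.exists_reverse (B.op_mem i)
  have hd : ∀ i, IsDiffOp (modInv Δ * r i * modInv Δ) := fun i => by
    obtain ⟨k, hk⟩ := hr i
    exact ⟨k, hk.conj_modInv Δ⟩
  refine ⟨∑ i, modInv Δ * r i * modInv Δ * M (B.coeff hn i),
    (diffOpSubalgebra E S).sum_mem fun i _ =>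
      (diffOpSubalgebra E S).mul_mem (hd i) ⟨0, .mulLeft 0 _⟩, ?_⟩
  have key : IsTr μ (∑ i, M (B.coeff hn i) * B.op i)
      (∑ i, modInv Δ * r i * modInv Δ * M (B.coeff hn i)) :=
    IsTr.sum fun i _ => (IsTr.mulLeft _).mul (ht i) (leftInvAlg_le_diffOp (B.op_mem i))
      ⟨0, .mulLeft 0 _⟩
  rwa [← B.eq_sum hn] at key

end Transposes
end Retract

namespace Retract
-- Formal series in ν, transport of star-products and of derivations.
noncomputable section FormalSeries

open Finset.HasAntidiagonal (antidiagonal)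

variable {E : Type*} [NormedAddCommGroup E] [NormedSpace ℝ E]
  {S : Type*} [TopologicalSpace S] [ChartedSpace E S]

/-- Additive maps on `C^∞(S)[[ν]]` commuting with the multiplication by `ν`. -/
structure IsXLinear (Φ : FormalFun E S → FormalFun E S) : Prop where
  add : ∀ f g, Φ (f + g) = Φ f + Φ g
  X_mul : ∀ f, Φ (X * f) = X * Φ f

/-- No ν-adic continuity is required: writing f as a constant plus X times its shift reduces the
n-th coefficient to the (n−1)-st one of the shift. -/
theorem IsXLinear.ext {Φ Ψ : FormalFun E S → FormalFun E S} (hΦ : IsXLinear Φ) (hΨ : IsXLinear Ψ)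
    (h : ∀ u, Φ (C u) = Ψ (C u)) (f : FormalFun E S) : Φ f = Ψ f := by
  ext1 n
  induction n generalizing f with
  | zero =>
    rw [eq_X_mul_shift_add_const f, hΦ.add, hΨ.add, hΦ.X_mul, hΨ.X_mul, h, map_add, map_add,
      coeff_zero_X_mul, coeff_zero_X_mul]
  | succ n ih =>
    rw [eq_X_mul_shift_add_const f, hΦ.add, hΨ.add, hΦ.X_mul, hΨ.X_mul, h, map_add, map_add,
      coeff_succ_X_mul, coeff_succ_X_mul, ih]

theorem IsXLinear.comp {Φ Ψ : FormalFun E S → FormalFun E S} (hΦ : IsXLinear Φ)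
    (hΨ : IsXLinear Ψ) : IsXLinear (fun f => Φ (Ψ f)) :=
  ⟨fun f g => by rw [hΨ.add, hΦ.add], fun f => by rw [hΨ.X_mul, hΦ.X_mul]⟩

theorem isXLinear_id : IsXLinear (fun f : FormalFun E S => f) := ⟨fun _ _ => rfl, fun _ => rfl⟩

theorem FormalOp.coeff_app (T : FormalOp E S) (f : FormalFun E S) (n : ℕ) :
    coeff n (T.app f) = ∑ p ∈ antidiagonal n, coeff p.1 T (coeff p.2 f) := coeff_mk _ _

theorem FormalOp.isXLinear_app (T : FormalOp E S) : IsXLinear T.app where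
  add f g := by
    ext1 n
    simp only [FormalOp.coeff_app, map_add, Finset.sum_add_distrib]
  X_mul f := by
    ext1 n
    cases n with
    | zero => simp [FormalOp.coeff_app]
    | succ n =>
      rw [FormalOp.coeff_app, Finset.Nat.sum_antidiagonal_succ', coeff_succ_X_mul,
        coeff_zero_X_mul, map_zero, zero_add, FormalOp.coeff_app]
      simp only [coeff_succ_X_mul]

theorem FormalOp.coeff_app_C (T : FormalOp E S) (u : SmoothFun E S) (n : ℕ) :
    coeff n (T.app (C u)) = coeff n T u := by
  rw [FormalOp.coeff_app, Finset.sum_eq_single (n, 0)]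
  · simp
  · rintro ⟨a, b⟩ hab hne
    have hb : b ≠ 0 := by
      rintro rfl
      simp at hab
      exact hne (by simp [hab])
    simp [coeff_C, hb]
  · simp

theorem FormalOp.mul_app (T U : FormalOp E S) (f : FormalFun E S) :
    FormalOp.app (T * U) f = T.app (U.app f) := by
  refine (FormalOp.isXLinear_app (T * U)).ext (T.isXLinear_app.comp U.isXLinear_app) (fun u => ?_) f
  ext1 n
  rw [FormalOp.coeff_app_C, FormalOp.coeff_app, coeff_mul]
  simp only [FormalOp.coeff_app_C, LinearMap.sum_apply]
  rfl

theorem FormalOp.one_app (f : FormalFun E S) : FormalOp.app 1 f = f := by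
  refine (FormalOp.isXLinear_app 1).ext isXLinear_id (fun u => ?_) f
  ext1 n
  rw [FormalOp.coeff_app_C, coeff_one, coeff_C]
  split_ifs <;> rfl

section StarMul
variable (K : ℕ → SmoothFun E S →ₗ[ℂ] SmoothFun E S →ₗ[ℂ] SmoothFun E S)

theorem coeff_starMul (f g : FormalFun E S) (n : ℕ) :
    coeff n (starMul K f g) = ∑ p ∈ antidiagonal n, ∑ q ∈ antidiagonal p.2,
      K p.1 (coeff q.1 f) (coeff q.2 g) := coeff_mk _ _

theorem isXLinear_starMul_right (f : FormalFun E S) : IsXLinear (starMul K f) where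
  add g h := by
    ext1 n
    simp only [coeff_starMul, map_add, Finset.sum_add_distrib]
  X_mul g := by
    ext1 n
    cases n with
    | zero => simp [coeff_starMul]
    | succ n =>
      rw [coeff_succ_X_mul, coeff_starMul, Finset.Nat.sum_antidiagonal_succ', coeff_starMul]
      simp only [Finset.Nat.sum_antidiagonal_succ', coeff_succ_X_mul]
      simp

theorem isXLinear_starMul_left (g : FormalFun E S) : IsXLinear (fun f => starMul K f g) where
  add f h := by
    ext1 n
    simp only [coeff_starMul, map_add, Finset.sum_add_distrib, LinearMap.add_apply]
  X_mul f := by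
    ext1 n
    cases n with
    | zero => simp [coeff_starMul]
    | succ n =>
      rw [coeff_succ_X_mul, coeff_starMul, Finset.Nat.sum_antidiagonal_succ', coeff_starMul]
      simp only [Finset.Nat.sum_antidiagonal_succ, coeff_succ_X_mul]
      simp

theorem coeff_starMul_C (u v : SmoothFun E S) (n : ℕ) :
    coeff n (starMul K (C u) (C v)) = K n u v := by
  rw [coeff_starMul, Finset.sum_eq_single (n, 0)]
  · simp
  · rintro ⟨a, b⟩ hab hne
    have hb : b ≠ 0 := by
      rintro rfl
      simp at hab
      exact hne (by simp [hab])
    refine Finset.sum_eq_zero fun q hq => ?_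
    rcases q with ⟨c, d⟩
    rw [Finset.HasAntidiagonal.mem_antidiagonal] at hq
    rcases Nat.eq_zero_or_pos c with rfl | hc
    · have hd : d ≠ 0 := by simp at hq; omega
      simp [coeff_C, hd]
    · simp [coeff_C, hc.ne']
  · simp

theorem starMul_ext {Φ : FormalFun E S → FormalFun E S → FormalFun E S}
    (h₁ : ∀ g, IsXLinear (fun f => Φ f g)) (h₂ : ∀ f, IsXLinear (Φ f))
    (h : ∀ n u v, coeff n (Φ (C u) (C v)) = K n u v) (f g : FormalFun E S) :
    Φ f g = starMul K f g := by
  refine (h₂ f).ext (isXLinear_starMul_right K f) (fun v => ?_) g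
  refine (h₁ (C v)).ext (isXLinear_starMul_left K (C v)) (fun u => ?_) f
  ext1 n
  rw [h, coeff_starMul_C]

/-- The cochains of the product `T (τ f ⋆ τ g)`. -/
def conjCochain (T τ : FormalOp E S) (n : ℕ) :
    SmoothFun E S →ₗ[ℂ] SmoothFun E S →ₗ[ℂ] SmoothFun E S :=
  ∑ p ∈ antidiagonal n, ∑ q ∈ antidiagonal p.2, ∑ r ∈ antidiagonal q.2,
    ((K q.1).compl₁₂ (coeff r.1 τ) (coeff r.2 τ)).compr₂ (coeff p.1 T)

theorem conjCochain_apply (T τ : FormalOp E S) (n : ℕ) (u v : SmoothFun E S) :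
    conjCochain K T τ n u v = ∑ p ∈ antidiagonal n, ∑ q ∈ antidiagonal p.2,
      ∑ r ∈ antidiagonal q.2, coeff p.1 T (K q.1 (coeff r.1 τ u) (coeff r.2 τ v)) := by
  simp only [conjCochain, LinearMap.sum_apply, LinearMap.compr₂_apply, LinearMap.compl₁₂_apply]

theorem starMul_conjCochain (T τ : FormalOp E S) (f g : FormalFun E S) :
    starMul (conjCochain K T τ) f g = T.app (starMul K (τ.app f) (τ.app g)) := by
  refine (starMul_ext (conjCochain K T τ) (Φ := fun f g => T.app (starMul K (τ.app f) (τ.app g)))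
    (fun g => T.isXLinear_app.comp ((isXLinear_starMul_left K _).comp τ.isXLinear_app))
    (fun f => T.isXLinear_app.comp ((isXLinear_starMul_right K _).comp τ.isXLinear_app))
    (fun n u v => ?_) f g).symm
  rw [FormalOp.coeff_app]
  simp only [coeff_starMul, FormalOp.coeff_app_C, map_sum, conjCochain_apply]

end StarMul

theorem IsBiDiffOp.add {K L : SmoothFun E S →ₗ[ℂ] SmoothFun E S →ₗ[ℂ] SmoothFun E S}
    (hK : IsBiDiffOp K) (hL : IsBiDiffOp L) : IsBiDiffOp (K + L) := by
  obtain ⟨n, hn⟩ := hK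
  obtain ⟨m, hm⟩ := hL
  exact ⟨max n m, fun f => ⟨((hn f).1.mono (le_max_left _ _)).add ((hm f).1.mono (le_max_right _ _)),
    ((hn f).2.mono (le_max_left _ _)).add ((hm f).2.mono (le_max_right _ _))⟩⟩

theorem IsBiDiffOp.sum {ι : Type*} {s : Finset ι}
    {K : ι → SmoothFun E S →ₗ[ℂ] SmoothFun E S →ₗ[ℂ] SmoothFun E S}
    (h : ∀ i ∈ s, IsBiDiffOp (K i)) : IsBiDiffOp (∑ i ∈ s, K i) :=
  Finset.sum_induction _ _ (fun _ _ => IsBiDiffOp.add) ⟨0, fun _ => ⟨.zero 0, .zero 0⟩⟩ h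

theorem IsBiDiffOp.conj {K : SmoothFun E S →ₗ[ℂ] SmoothFun E S →ₗ[ℂ] SmoothFun E S}
    (hK : IsBiDiffOp K) {P Q R : SmoothOp E S} (hP : IsDiffOp P) (hQ : IsDiffOp Q)
    (hR : IsDiffOp R) : IsBiDiffOp ((K.compl₁₂ P Q).compr₂ R) := by
  obtain ⟨n, hn⟩ := hK
  obtain ⟨p, hp⟩ := hP
  obtain ⟨q, hq⟩ := hQ
  obtain ⟨r, hr⟩ := hR
  refine ⟨r + n + (p + q), fun f => ⟨?_, ?_⟩⟩
  · exact ((hr.mul (hn (P f)).1).mul hq).mono (by omega)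
  · exact ((hr.mul (hn (Q f)).2).mul hp).mono (by omega)

theorem isDiffOp_coeff_mul {T U : FormalOp E S} (hT : ∀ k, IsDiffOp (coeff k T))
    (hU : ∀ k, IsDiffOp (coeff k U)) (k : ℕ) : IsDiffOp (coeff k (T * U)) := by
  rw [coeff_mul]
  exact (diffOpSubalgebra E S).sum_mem fun p _ => (diffOpSubalgebra E S).mul_mem (hT _) (hU _)

/-- The recursion for the inverse of a series with constant term 1 never leaves the subalgebra `A`;
for `A = leftInvAlg` it yields a left-invariant inverse. -/
theorem exists_formal_inverse (A : Subalgebra ℂ (SmoothOp E S)) {T : FormalOp E S}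
    (hT : ∀ k, coeff k T ∈ A) (h0 : coeff 0 T = 1) :
    ∃ U : FormalOp E S, (∀ k, coeff k U ∈ A) ∧ coeff 0 U = 1 ∧ T * U = 1 ∧ U * T = 1 := by
  have hc : constantCoeff T = ((1 : (SmoothOp E S)ˣ) : SmoothOp E S) := by
    rw [← coeff_zero_eq_constantCoeff_apply, h0]; rfl
  refine ⟨invOfUnit T 1, fun k => ?_, ?_, mul_invOfUnit T 1 hc, invOfUnit_mul T 1 hc⟩
  · induction k using Nat.strong_induction_on with
    | _ k ih =>
      rw [coeff_invOfUnit]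
      split_ifs with hk
      · simp [A.one_mem]
      · refine A.mul_mem (A.neg_mem (by simp [A.one_mem])) (A.sum_mem fun p _ => ?_)
        split_ifs with hp
        · exact A.mul_mem (hT _) (ih _ hp)
        · exact A.zero_mem
  · rw [coeff_invOfUnit]
    simp

variable [FiniteDimensional ℝ E] [IsManifold 𝓘(ℝ, E) ∞ S] {om : SymplecticForm E S}

/-- The image `T(⋆)` of a star product under an invertible formal series of differential
operators. -/
def StarProduct.transport (star : StarProduct om) {T τ : FormalOp E S}
    (hT : ∀ k, IsDiffOp (coeff k T)) (hτ : ∀ k, IsDiffOp (coeff k τ)) (hT0 : coeff 0 T = 1)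
    (hτ0 : coeff 0 τ = 1) (h : τ * T = 1) : StarProduct om where
  cochain := conjCochain star.cochain T τ
  assoc f g k := by
    have h1 : ∀ f, τ.app (T.app f) = f := fun f => by
      rw [← FormalOp.mul_app, h, FormalOp.one_app]
    simp only [starMul_conjCochain, h1, star.assoc]
  cochain_zero u v := by
    simp [conjCochain_apply, hT0, hτ0, star.cochain_zero]
  cochain_one u v x := by
    rw [← star.cochain_one]
    have e : ∀ u v, conjCochain star.cochain T τ 1 u v = coeff 1 T (u * v) + star.cochain 1 u v +
        (coeff 1 τ u * v + u * coeff 1 τ v) := fun u v => by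
      have h1 : antidiagonal 1 = {((0 : ℕ), (1 : ℕ)), (1, 0)} := rfl
      simp [conjCochain_apply, h1, hT0, hτ0, star.cochain_zero]
      abel
    -- The first-order contributions of `T` and `τ` are symmetric in u and v, so they drop out of
    -- the skew-symmetrization.
    have e2 : conjCochain star.cochain T τ 1 u v - conjCochain star.cochain T τ 1 v u =
        star.cochain 1 u v - star.cochain 1 v u := by
      rw [e, e, mul_comm v u, mul_comm (coeff 1 τ v) u, mul_comm v (coeff 1 τ u)]
      abel
    exact congrArg (fun f : SmoothFun E S => f.1 x) e2
  bidiff k := by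
    exact IsBiDiffOp.sum fun p _ => IsBiDiffOp.sum fun q _ => IsBiDiffOp.sum fun r _ =>
      (star.bidiff _).conj (hτ _) (hτ _) (hT _)

theorem StarProduct.isTransport_transport (star : StarProduct om) {T τ : FormalOp E S}
    (hT : ∀ k, IsDiffOp (coeff k T)) (hτ : ∀ k, IsDiffOp (coeff k τ)) (hT0 : coeff 0 T = 1)
    (hτ0 : coeff 0 τ = 1) (h : τ * T = 1) :
    IsTransport T star (star.transport hT hτ hT0 hτ0 h) where
  diffOp := hT
  coeff_zero := hT0
  map_mul f g := by
    have h1 : ∀ f, τ.app (T.app f) = f := fun f => by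
      rw [← FormalOp.mul_app, h, FormalOp.one_app]
    refine (starMul_conjCochain star.cochain T τ _ _).trans ?_
    rw [h1, h1]
    rfl

theorem StarProduct.IsTransport.symm {star star' : StarProduct om} {T τ : FormalOp E S}
    (hT : IsTransport T star star') (hτ : ∀ k, IsDiffOp (coeff k τ)) (hτ0 : coeff 0 τ = 1)
    (h : τ * T = 1) (h' : T * τ = 1) : IsTransport τ star' star where
  diffOp := hτ
  coeff_zero := hτ0
  map_mul f g := by
    have h1 : ∀ f, T.app (τ.app f) = f := fun f => by
      rw [← FormalOp.mul_app, h', FormalOp.one_app]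
    have h2 := hT.map_mul (τ.app f) (τ.app g)
    rw [h1, h1] at h2
    rw [h2, ← FormalOp.mul_app, h, FormalOp.one_app]

theorem StarProduct.IsTransport.isDerivation_conj {star star' : StarProduct om}
    {T τ D : FormalOp E S} (hT : IsTransport T star star') (hτ : IsTransport τ star' star)
    (h' : T * τ = 1) (hD : star.IsDerivation D) : star'.IsDerivation (T * D * τ) where
  diffOp := isDiffOp_coeff_mul (isDiffOp_coeff_mul hT.diffOp hD.diffOp) hτ.diffOp
  leibniz f g := by
    have h1 : ∀ f, T.app (τ.app f) = f := fun f => by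
      rw [← FormalOp.mul_app, h', FormalOp.one_app]
    simp only [FormalOp.mul_app]
    rw [← hτ.map_mul, hD.leibniz, T.isXLinear_app.add, ← hT.map_mul, ← hT.map_mul, h1, h1]

end FormalSeries
end Retract

namespace Retract
-- The Poisson bracket and the expansion of derivations in invariant frames.
noncomputable section PoissonDerivations

open Finset.HasAntidiagonal (antidiagonal)

section
variable {E : Type*} [NormedAddCommGroup E] [NormedSpace ℝ E] [FiniteDimensional ℝ E]
  {S : Type*} [TopologicalSpace S] [ChartedSpace E S] [IsManifold 𝓘(ℝ, E) ∞ S]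
  {om : SymplecticForm E S}

theorem dfun_im_eq_zero (h : SmoothFun E S) (hh : ∀ x, (h.1 x).im = 0) (x : S)
    (v : TangentSpace 𝓘(ℝ, E) x) : (dfun h.1 x v).im = 0 := by
  have hL := Complex.imCLM.hasMFDerivAt (x := h.1 x)
  have h1 := (hL.comp x (h.mdifferentiableAt x).hasMFDerivAt).mfderiv
  have h2 : (Complex.imCLM ∘ h.1) = fun _ => 0 := funext hh
  rw [h2, mfderiv_const] at h1
  exact DFunLike.congr_fun h1.symm v

/-- The Poisson bracket, as the skew-symmetrization of the first cochain of a star product. -/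
def StarProduct.pb (star : StarProduct om) : SmoothFun E S →ₗ[ℂ] SmoothFun E S →ₗ[ℂ] SmoothFun E S :=
  star.cochain 1 - (star.cochain 1).flip

theorem StarProduct.pb_eq (star : StarProduct om) (u v : SmoothFun E S) :
    star.pb u v = star.cochain 1 u v - star.cochain 1 v u := rfl

theorem StarProduct.pb_apply (star : StarProduct om) (u v : SmoothFun E S) (x : S) :
    (star.pb u v).1 x = om.poisson u.1 v.1 x := star.cochain_one u v x

theorem StarProduct.pb_swap (star : StarProduct om) (u v : SmoothFun E S) :
    star.pb u v = - star.pb v u := by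
  rw [pb_eq, pb_eq, neg_sub]

theorem StarProduct.pb_mul_right (star : StarProduct om) (u v w : SmoothFun E S) :
    star.pb u (v * w) = v * star.pb u w + star.pb u v * w := by
  ext x
  change (star.pb u (v * w)).1 x = v.1 x * (star.pb u w).1 x + (star.pb u v).1 x * w.1 x
  simp only [star.pb_apply, SymplecticForm.poisson]
  have h : (v * w).1 = v.1 * w.1 := rfl
  rw [h, dfun_mul (v.mdifferentiableAt x) (w.mdifferentiableAt x),
    dfun_mul (v.mdifferentiableAt x) (w.mdifferentiableAt x)]
  ring

theorem StarProduct.pb_mul_left (star : StarProduct om) (u v w : SmoothFun E S) :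
    star.pb (u * v) w = u * star.pb v w + star.pb u w * v := by
  rw [pb_swap, pb_mul_right, pb_swap star w v, pb_swap star w u]
  ring

theorem StarProduct.IsDerivation.coeff_zero_mul {star : StarProduct om} {D : FormalOp E S}
    (hD : star.IsDerivation D) (u v : SmoothFun E S) :
    coeff 0 D (u * v) = u * coeff 0 D v + coeff 0 D u * v := by
  have h := congrArg (coeff 0) (hD.leibniz (C u) (C v))
  simpa [-coeff_zero_eq_constantCoeff, FormalOp.coeff_app,
    StarProduct.mul, coeff_starMul, star.cochain_zero, coeff_C, add_comm] using h

/-- Compare the coefficients of ν in the Leibniz rule and skew-symmetrize: the terms containing the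
first-order part of `D` are symmetric and cancel. -/
theorem StarProduct.IsDerivation.coeff_zero_pb {star : StarProduct om} {D : FormalOp E S}
    (hD : star.IsDerivation D) (u v : SmoothFun E S) :
    coeff 0 D (star.pb u v) = star.pb (coeff 0 D u) v + star.pb u (coeff 0 D v) := by
  have key : ∀ u v, coeff 1 D (u * v) + coeff 0 D (star.cochain 1 u v) =
      star.cochain 1 (coeff 0 D u) v + coeff 1 D u * v +
      (star.cochain 1 u (coeff 0 D v) + u * coeff 1 D v) := fun u v => by
    have h := congrArg (coeff 1) (hD.leibniz (C u) (C v))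
    have h1 : antidiagonal 1 = {((0 : ℕ), (1 : ℕ)), (1, 0)} := rfl
    simp [-coeff_zero_eq_constantCoeff, FormalOp.coeff_app,
      StarProduct.mul, coeff_starMul, star.cochain_zero, h1, coeff_C] at h
    rw [add_comm (coeff 1 D (u * v)), h]
    abel
  have h1 := key u v
  have h2 := key v u
  rw [mul_comm v u] at h2
  simp only [star.pb_eq, map_sub]
  rw [eq_sub_of_add_eq' h1, eq_sub_of_add_eq' h2, mul_comm v, mul_comm (coeff 1 D v)]
  abel

end

variable {E : Type*} [NormedAddCommGroup E] [NormedSpace ℝ E] [FiniteDimensional ℝ E]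
  {S : Type*} [TopologicalSpace S] [ChartedSpace E S] [Group S] [LieGroup 𝓘(ℝ, E) ∞ S]
  [T2Space S]

local notation "M" => LinearMap.mulLeft ℂ

variable (E S) in
/-- Smooth functions whose differentials at the unit are the dual of a basis of the Lie algebra. -/
structure UnitCoord where
  /-- the basis -/
  basis : Module.Basis (Fin (Module.finrank ℝ E)) ℝ (GroupLieAlgebra 𝓘(ℝ, E) S)
  /-- the coordinates -/
  fn : Fin (Module.finrank ℝ E) → SmoothFun E S
  fn_one : ∀ i, (fn i).1 1 = 0
  real : ∀ i y, ((fn i).1 y).im = 0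
  dual : ∀ i j, (leftInvOp (basis j) (fn i)).1 1 = if i = j then 1 else 0

theorem nonempty_unitCoord : Nonempty (UnitCoord E S) := by
  obtain ⟨x, z, h1, h2, -⟩ := exists_coordinates (E := E) (S := S) (Module.finBasis ℝ E)
  exact ⟨⟨Module.finBasis ℝ E, x, fun i => (h1 i).1, fun i => (h1 i).2, h2⟩⟩

namespace UnitCoord
variable (B : UnitCoord E S)

theorem dual_right (i j : Fin (Module.finrank ℝ E)) :
    (rightInvOp (B.basis j) (B.fn i)).1 1 = if i = j then 1 else 0 := by
  rw [← leftInvOp_apply_one, B.dual]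

/-- A point derivation kills constants and the square of the ideal, and f − f(1) − ∑ (L_i f)(1) x_i
lies in that square. -/
theorem derivation_eq_sum (l : SmoothFun E S →ₗ[ℂ] ℂ)
    (hl : ∀ f g, l (f * g) = f.1 1 * l g + l f * g.1 1) (f : SmoothFun E S) :
    l f = ∑ i, (leftInvOp (B.basis i) f).1 1 * l (B.fn i) := by
  have hl1 : l 1 = 0 := by
    have := hl 1 1
    rw [mul_one] at this
    change l 1 = 1 * l 1 + l 1 * 1 at this
    linear_combination -this
  have hc : ∀ c : ℂ, l (algebraMap ℂ _ c) = 0 := fun c => by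
    rw [Algebra.algebraMap_eq_smul_one, map_smul, hl1, smul_zero]
  have hm : ∀ f ∈ vanishIdeal E (1 : S) ^ 2, l f = 0 := fun f hf => by
    rw [pow_two] at hf
    refine Submodule.mul_induction_on hf (fun f hf g hg => ?_) fun f g hf hg => ?_
    · rw [hl, mem_vanishIdeal.1 hf, mem_vanishIdeal.1 hg, zero_mul, mul_zero, add_zero]
    · rw [map_add, hf, hg, add_zero]
  set h := f - algebraMap ℂ _ (f.1 1) - ∑ i, (leftInvOp (B.basis i) f).1 1 • B.fn i with hh
  have h1 : h ∈ vanishIdeal E (1 : S) ^ (0 + 1) := by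
    rw [zero_add, pow_one]
    refine Ideal.sub_mem _ ?_ (Ideal.sum_mem _ fun i _ => smul_mem_ideal (B.fn_one i) _)
    exact sub_self (f.1 1)
  have h2 : ∀ j, leftInvOp (B.basis j) h ∈ vanishIdeal E (1 : S) ^ (0 + 1) := fun j => by
    rw [zero_add, pow_one]
    have h3 : leftInvOp (B.basis j) (algebraMap ℂ (SmoothFun E S) (f.1 1)) = 0 := by
      rw [Algebra.algebraMap_eq_smul_one, map_smul]
      have := leftInvOp_mul (B.basis j) (1 : SmoothFun E S) 1
      rw [mul_one, one_mul, mul_one] at this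
      rw [left_eq_add.1 this, smul_zero]
    change evalAt E 1 _ = 0
    simp only [hh, map_sub, h3, map_sum, map_smul, map_zero, evalAt_apply, B.dual]
    simp
  have h3 := hm h (mem_pow_succ_of_leftInvOp_mem B.basis h1 h2)
  rw [hh, map_sub, map_sub, hc, map_sum, sub_zero, sub_eq_zero] at h3
  simpa only [map_smul, smul_eq_mul] using h3

/-- The coefficients are c_i(y) = (V (leftPull y⁻¹ x_i))(y). They are constant combinations of the
coefficients of `V` in a jet family of order 1, hence smooth. -/
theorem leibniz_eq_sum {V : SmoothOp E S} (hV : ∀ f g, V (f * g) = f * V g + V f * g) :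
    ∃ c : Fin (Module.finrank ℝ E) → SmoothFun E S, V = ∑ i, M (c i) * leftInvOp (B.basis i) := by
  obtain ⟨J⟩ := nonempty_jetFamily (E := E) (S := S) 1
  have hd := isDiffOpOfOrder_one_of_leibniz hV
  refine ⟨fun i => ∑ k, (J.op k (B.fn i)).1 1 • J.coeff hd k, LinearMap.ext fun f =>
    Subtype.ext (funext fun y => ?_)⟩
  have h1 := B.derivation_eq_sum ((evalAt E y).toLinearMap ∘ₗ V ∘ₗ leftPull y⁻¹) (fun f g => by
    change (V (leftPull y⁻¹ f * leftPull y⁻¹ g)).1 y = f.1 1 * (V (leftPull y⁻¹ g)).1 y +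
      (V (leftPull y⁻¹ f)).1 y * g.1 1
    rw [hV]
    change f.1 (y⁻¹ * y) * _ + _ * g.1 (y⁻¹ * y) = _
    rw [inv_mul_cancel]) (leftPull y f)
  have h2 : leftPull y⁻¹ (leftPull y f) = f := by
    rw [leftPull_leftPull, mul_inv_cancel, leftPull_one]
  have h3 : (V f).1 y = ∑ i, (leftInvOp (B.basis i) (leftPull y f)).1 1 *
      (V (leftPull y⁻¹ (B.fn i))).1 y := by
    change (V (leftPull y⁻¹ (leftPull y f))).1 y = _ at h1
    rwa [h2] at h1
  rw [h3]
  have h4 : ∀ i, (V (leftPull y⁻¹ (B.fn i))).1 y =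
      ∑ k, (J.op k (B.fn i)).1 1 * (J.coeff hd k).1 y := fun i => by
    conv_lhs => rw [J.eq_sum hd]
    rw [LinearMap.sum_apply]
    refine (evalAt_apply y _).symm.trans ?_
    rw [map_sum]
    refine Finset.sum_congr rfl fun k _ => ?_
    change (J.coeff hd k).1 y * (J.op k (leftPull y⁻¹ (B.fn i))).1 y = _
    rw [apply_eq_leftPull_apply_one (J.op_mem k), leftPull_leftPull, inv_mul_cancel, leftPull_one,
      mul_comm]
  rw [LinearMap.sum_apply]
  refine Eq.trans ?_ (evalAt_apply y _)
  rw [map_sum]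
  refine Finset.sum_congr rfl fun i _ => ?_
  rw [h4, ← apply_eq_leftPull_apply_one (leftInvOp_mem _) f y, mul_comm]
  refine Eq.trans (congrArg (· * (leftInvOp (B.basis i) f).1 y) ?_) rfl
  refine Eq.trans ?_ (evalAt_apply y _)
  rw [map_sum]
  rfl

/-- Conjugation by inversion exchanges the left- and right-invariant frames up to sign. -/
theorem leibniz_eq_sum_right {V : SmoothOp E S} (hV : ∀ f g, V (f * g) = f * V g + V f * g) :
    ∃ a : Fin (Module.finrank ℝ E) → SmoothFun E S, V = ∑ i, M (a i) * rightInvOp (B.basis i) := by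
  obtain ⟨c, hc⟩ := B.leibniz_eq_sum (V := invPull * V * invPull) (fun f g => by
    change invPull (V (invPull f * invPull g)) = _
    rw [hV]
    change invPull (invPull f) * invPull (V (invPull g)) + invPull (V (invPull f)) * invPull (invPull g) = _
    rw [invPull_invPull, invPull_invPull]
    rfl)
  refine ⟨fun i => -invPull (c i), ?_⟩
  have h1 : V = invPull * (invPull * V * invPull) * invPull := by
    calc V = (invPull * invPull) * V * (invPull * invPull) := by
          rw [invPull_mul_invPull, one_mul, mul_one]
      _ = _ := by simp only [mul_assoc]
  rw [h1, hc, Finset.mul_sum, Finset.sum_mul]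
  refine Finset.sum_congr rfl fun i _ => LinearMap.ext fun f => ?_
  change invPull (c i) * invPull (leftInvOp (B.basis i) (invPull f)) = -invPull (c i) * _
  rw [invPull_leftInvOp, invPull_invPull]
  exact (mul_neg (invPull (c i)) (rightInvOp (B.basis i) f)).trans
    (neg_mul (invPull (c i)) (rightInvOp (B.basis i) f)).symm

end UnitCoord

end PoissonDerivations
end Retract

namespace Retract
-- Derivations of a left-invariant Poisson bracket have zero divergence.
noncomputable section DivergenceFree

variable {E : Type*} [NormedAddCommGroup E] [NormedSpace ℝ E] [FiniteDimensional ℝ E]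
  {S : Type*} [TopologicalSpace S] [ChartedSpace E S] [Group S] [LieGroup 𝓘(ℝ, E) ∞ S]
  [T2Space S] {om : SymplecticForm E S}

local notation "M" => LinearMap.mulLeft ℂ

theorem rightInvOp_rightPull (v : GroupLieAlgebra 𝓘(ℝ, E) S) (x : S) (f : SmoothFun E S) (y : S) :
    (rightInvOp v (rightPull x f)).1 y = (rightInvOp v f).1 (y * x) := by
  rw [rightInvOp_apply, rightInvOp_apply]
  congr 2
  ext z
  exact congrArg f.1 (mul_assoc z y x)

namespace UnitCoord
variable (B : UnitCoord E S)

/-- The coordinates centred at `y` obtained by right translation. -/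
def fnAt (y : S) (i : Fin (Module.finrank ℝ E)) : SmoothFun E S := rightPull y⁻¹ (B.fn i)

theorem fnAt_im (y : S) (i : Fin (Module.finrank ℝ E)) (x : S) : ((B.fnAt y i).1 x).im = 0 :=
  B.real i _

theorem dual_fnAt (y : S) (i j : Fin (Module.finrank ℝ E)) :
    (rightInvOp (B.basis j) (B.fnAt y i)).1 y = if i = j then 1 else 0 := by
  rw [fnAt, rightInvOp_rightPull, mul_inv_cancel, B.dual_right]

theorem derivation_eq_sum_at (y : S) (l : SmoothFun E S →ₗ[ℂ] ℂ)
    (hl : ∀ f g, l (f * g) = f.1 y * l g + l f * g.1 y) (f : SmoothFun E S) :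
    l f = ∑ i, (rightInvOp (B.basis i) f).1 y * l (B.fnAt y i) := by
  have h := B.derivation_eq_sum (l ∘ₗ rightPull y⁻¹) (fun f g => by
    change l (rightPull y⁻¹ f * rightPull y⁻¹ g) = _
    rw [hl]
    change f.1 (y * y⁻¹) * _ + _ * g.1 (y * y⁻¹) = _
    rw [mul_inv_cancel]
    rfl) (rightPull y f)
  have h1 : rightPull y⁻¹ (rightPull y f) = f := by
    ext z
    change f.1 (z * y⁻¹ * y) = f.1 z
    rw [inv_mul_cancel_right]
  change l (rightPull y⁻¹ (rightPull y f)) = _ at h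
  rw [h1] at h
  rw [h]
  refine Finset.sum_congr rfl fun i _ => ?_
  rw [leftInvOp_apply_one, rightInvOp_rightPull, one_mul]
  rfl

/-- The matrix of the Poisson bracket in the coordinates centred at `y`. -/
def poissonMatrix (star : StarProduct om) (y : S) :
    Matrix (Fin (Module.finrank ℝ E)) (Fin (Module.finrank ℝ E)) ℂ :=
  Matrix.of fun i j => (star.pb (B.fnAt y i) (B.fnAt y j)).1 y

theorem pb_eq_sum_right (star : StarProduct om) (y : S) (f h : SmoothFun E S) :
    (star.pb f h).1 y = ∑ i, (rightInvOp (B.basis i) h).1 y * (star.pb f (B.fnAt y i)).1 y :=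
  B.derivation_eq_sum_at y ((evalAt E y).toLinearMap ∘ₗ star.pb f) (fun g k =>
    congrArg (fun f : SmoothFun E S => f.1 y) (star.pb_mul_right f g k)) h

theorem pb_eq_sum_left (star : StarProduct om) (y : S) (f h : SmoothFun E S) :
    (star.pb f h).1 y = ∑ i, (rightInvOp (B.basis i) f).1 y * (star.pb (B.fnAt y i) h).1 y :=
  B.derivation_eq_sum_at y ((evalAt E y).toLinearMap ∘ₗ star.pb.flip h) (fun g k =>
    congrArg (fun f : SmoothFun E S => f.1 y) (star.pb_mul_left g k h)) f

theorem rightInvOp_eq_sum (v : GroupLieAlgebra 𝓘(ℝ, E) S) :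
    (rightInvOp v : SmoothOp E S) =
      ∑ j, ((B.basis.repr v j : ℝ) : ℂ) • rightInvOp (B.basis j) := by
  conv_lhs => rw [← B.basis.sum_repr v]
  have : ∀ s : Finset (Fin (Module.finrank ℝ E)),
      (rightInvOp (∑ j ∈ s, B.basis.repr v j • B.basis j) : SmoothOp E S) =
      ∑ j ∈ s, ((B.basis.repr v j : ℝ) : ℂ) • rightInvOp (B.basis j) := fun s => by
    classical
    induction s using Finset.induction_on with
    | empty =>
      have := rightInvOp_smul (E := E) (S := S) 0 0
      simpa using this
    | insert i s hi ih =>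
      rw [Finset.sum_insert hi, Finset.sum_insert hi, rightInvOp_add, rightInvOp_smul, ih]
  exact this _

theorem rightInvOp_fnAt (v : GroupLieAlgebra 𝓘(ℝ, E) S) (y : S) (i : Fin (Module.finrank ℝ E)) :
    (rightInvOp v (B.fnAt y i)).1 y = ((B.basis.repr v i : ℝ) : ℂ) := by
  rw [B.rightInvOp_eq_sum v, LinearMap.sum_apply]
  refine (evalAt_apply (E := E) y _).symm.trans ?_
  rw [map_sum]
  simp only [LinearMap.smul_apply, map_smul, evalAt_apply, B.dual_fnAt]
  simp

/-- The right-invariant fields span each tangent space: the map from the Lie algebra is injective,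
as coordinates centred at `y` show, and the dimensions agree. -/
theorem exists_fundVF_eq (y : S) (ξ : TangentSpace 𝓘(ℝ, E) y) :
    ∃ v : GroupLieAlgebra 𝓘(ℝ, E) S, fundVF v y = ξ := by
  obtain ⟨B⟩ := nonempty_unitCoord (E := E) (S := S)
  let L : E →ₗ[ℝ] E := -(mfderiv 𝓘(ℝ, E) 𝓘(ℝ, E) (fun z : S => z * y) 1).toLinearMap
  have hL : ∀ v : GroupLieAlgebra 𝓘(ℝ, E) S, L v = fundVF v y := fun v =>
    (map_neg (mfderiv 𝓘(ℝ, E) 𝓘(ℝ, E) (fun z : S => z * y) 1) v).symm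
  have hinj : Function.Injective L := by
    rw [← LinearMap.ker_eq_bot, LinearMap.ker_eq_bot']
    intro v hv
    let v' : GroupLieAlgebra 𝓘(ℝ, E) S := v
    have h0 : fundVF v' y = 0 := (hL v').symm.trans hv
    refine B.basis.repr.map_eq_zero_iff.1 (Finsupp.ext fun i => ?_ : B.basis.repr v' = 0)
    have h1 := dfun_fundVF v' y (B.fnAt y i)
    rw [h0, map_zero, B.rightInvOp_fnAt] at h1
    simpa using h1
  obtain ⟨v, hv⟩ := LinearMap.surjective_of_injective hinj ξ
  exact ⟨v, (hL v).symm.trans hv⟩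

theorem eq_zero_of_dfun_fnAt {y : S} {ξ : TangentSpace 𝓘(ℝ, E) y}
    (h : ∀ i, dfun (B.fnAt y i).1 y ξ = 0) : ξ = 0 := by
  obtain ⟨v, rfl⟩ := exists_fundVF_eq y ξ
  have hv : v = 0 := by
    refine B.basis.repr.map_eq_zero_iff.1 (Finsupp.ext fun i => ?_)
    have h1 := h i
    rw [dfun_fundVF, B.rightInvOp_fnAt] at h1
    simpa using h1
  rw [hv]
  unfold fundVF
  rw [neg_zero]
  exact map_zero _

/-- A kernel vector gives a combination `F` of coordinates at `y` whose bracket with every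
coordinate vanishes at `y`. Nondegeneracy of ω then forces dF = 0 at `y`, so the vector is zero. -/
theorem det_poissonMatrix_ne_zero (star : StarProduct om) (y : S) :
    (B.poissonMatrix star y).det ≠ 0 := by
  intro hdet
  obtain ⟨c, hc, hcv⟩ := Matrix.exists_vecMul_eq_zero_iff.2 hdet
  set F : SmoothFun E S := ∑ i, c i • B.fnAt y i with hF
  have h1 : ∀ j, (star.pb F (B.fnAt y j)).1 y = 0 := fun j => by
    have h2 := congrFun hcv j
    simp only [Matrix.vecMul, dotProduct, poissonMatrix, Matrix.of_apply, Pi.zero_apply] at h2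
    rw [hF, map_sum, LinearMap.sum_apply, ← evalAt_apply (E := E) y, map_sum, ← h2]
    simp only [map_smul, LinearMap.smul_apply, evalAt_apply, smul_eq_mul]
  -- The kernel vector is complex, so `F` has two Hamiltonian vectors, from its real and imaginary
  -- parts. The coordinates are real, so ξ₁ and ξ₂ can be read off separately as real and imaginary
  -- parts of the bracket.
  set ξ₁ := om.sharp y (Complex.reCLM.comp (dfun F.1 y)) with hξ₁
  set ξ₂ := om.sharp y (Complex.imCLM.comp (dfun F.1 y)) with hξ₂
  have h3 : ∀ j, dfun (B.fnAt y j).1 y ξ₁ = 0 ∧ dfun (B.fnAt y j).1 y ξ₂ = 0 := fun j => by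
    have h4 := h1 j
    rw [star.pb_apply, SymplecticForm.poisson, ← hξ₁, ← hξ₂] at h4
    have i1 := dfun_im_eq_zero _ (B.fnAt_im y j) y ξ₁
    have i2 := dfun_im_eq_zero _ (B.fnAt_im y j) y ξ₂
    have e1 := congrArg Complex.re h4
    have e2 := congrArg Complex.im h4
    simp [i1, i2] at e1 e2
    exact ⟨Complex.ext e1 i1, Complex.ext e2 i2⟩
  have hs : ∀ α, om.sharp y α = 0 → α = 0 := fun α hα => by
    have := ((om.form y).toDual (om.nondegenerate y)).symm.map_eq_zero_iff.1 hα
    exact ContinuousLinearMap.coe_injective this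
  have r1 := hs _ (B.eq_zero_of_dfun_fnAt fun j => (h3 j).1)
  have r2 := hs _ (B.eq_zero_of_dfun_fnAt fun j => (h3 j).2)
  have h5 : ∀ w, dfun F.1 y w = 0 := fun w =>
    Complex.ext (DFunLike.congr_fun r1 w) (DFunLike.congr_fun r2 w)
  refine hc (funext fun k => ?_)
  have h6 := dfun_fundVF (B.basis k) y F
  rw [h5, hF, map_sum, ← evalAt_apply (E := E) y, map_sum] at h6
  simp only [map_smul, evalAt_apply, B.dual_fnAt] at h6
  simpa using h6

variable {star : StarProduct om}

/-- Left invariance of the star-product gives {f, h} = ∑ π_ij L_i f L_j h with constants π_ij, and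
right-invariant fields commute with the L_i. -/
theorem rightInvOp_pb (hstar : star.IsLeftInvariant) (v : GroupLieAlgebra 𝓘(ℝ, E) S)
    (f h : SmoothFun E S) :
    rightInvOp v (star.pb f h) = star.pb (rightInvOp v f) h + star.pb f (rightInvOp v h) := by
  obtain ⟨B⟩ := nonempty_unitCoord (E := E) (S := S)
  have key : ∀ f h, star.pb f h = ∑ i, ∑ j, (star.pb (B.fn i) (B.fn j)).1 1 •
      (leftInvOp (B.basis i) f * leftInvOp (B.basis j) h) := fun f h => by
    ext x
    have e1 : (star.pb f h).1 x = (star.pb (leftPull x f) (leftPull x h)).1 1 := by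
      rw [star.pb_eq (leftPull x f), ← hstar, ← hstar, ← map_sub, ← star.pb_eq]
      exact congrArg (star.pb f h).1 (mul_one x).symm
    have e2 := B.derivation_eq_sum ((evalAt E 1).toLinearMap ∘ₗ star.pb (leftPull x f))
      (fun g k => congrArg (fun f : SmoothFun E S => f.1 1) (star.pb_mul_right _ g k)) (leftPull x h)
    have e3 := fun j => B.derivation_eq_sum ((evalAt E 1).toLinearMap ∘ₗ star.pb.flip (B.fn j))
      (fun g k => congrArg (fun f : SmoothFun E S => f.1 1) (star.pb_mul_left g k _)) (leftPull x f)
    change (star.pb (leftPull x f) (leftPull x h)).1 1 =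
      ∑ j, _ * (star.pb (leftPull x f) (B.fn j)).1 1 at e2
    change ∀ j, (star.pb (leftPull x f) (B.fn j)).1 1 =
      ∑ i, _ * (star.pb (B.fn i) (B.fn j)).1 1 at e3
    rw [e1, e2]
    refine Eq.trans ?_ (evalAt_apply x _)
    simp only [map_sum, map_smul, map_mul, evalAt_apply, smul_eq_mul, e3,
      ← apply_eq_leftPull_apply_one (leftInvOp_mem _)]
    rw [Finset.sum_comm]
    refine Finset.sum_congr rfl fun j _ => ?_
    rw [Finset.mul_sum]
    exact Finset.sum_congr rfl fun i _ => by ring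
  have hc : ∀ i f, rightInvOp v (leftInvOp (B.basis i) f) = leftInvOp (B.basis i) (rightInvOp v f) :=
    fun i f => (LinearMap.congr_fun (commute_leftInvOp_rightInvOp (B.basis i) v).eq f).symm
  rw [key, key, key]
  simp only [map_sum, map_smul, rightInvOp_mul, hc, ← Finset.sum_add_distrib, smul_add]
  exact Finset.sum_congr rfl fun i _ => Finset.sum_congr rfl fun j _ => add_comm _ _

/-- As the R_k are themselves Poisson derivations, the hypothesis reduces to ∑ (R_k f {a_k, h} + R_k
h {f, a_k}) = 0. On coordinates at `y` this says AΠ = −ΠAᵗ with A = (R_k a_l), and conjugation by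
the invertible Π gives tr A = −tr A. -/
theorem sum_rightInvOp_eq_zero (hstar : star.IsLeftInvariant)
    (a : Fin (Module.finrank ℝ E) → SmoothFun E S)
    (ha : ∀ f h, (∑ i, M (a i) * rightInvOp (B.basis i) : SmoothOp E S) (star.pb f h) =
      star.pb ((∑ i, M (a i) * rightInvOp (B.basis i) : SmoothOp E S) f) h +
      star.pb f ((∑ i, M (a i) * rightInvOp (B.basis i) : SmoothOp E S) h)) :
    ∑ i, rightInvOp (B.basis i) (a i) = 0 := by
  have h1 : ∀ f h, ∑ k, (rightInvOp (B.basis k) f * star.pb (a k) h +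
      rightInvOp (B.basis k) h * star.pb f (a k)) = 0 := fun f h => by
    have h2 := ha f h
    simp only [LinearMap.sum_apply, Module.End.mul_apply, LinearMap.mulLeft_apply, map_sum,
      star.pb_mul_left, star.pb_mul_right, rightInvOp_pb hstar] at h2
    rw [← Finset.sum_add_distrib, ← sub_eq_zero, ← Finset.sum_sub_distrib] at h2
    rw [← neg_eq_zero, ← Finset.sum_neg_distrib, ← h2]
    exact Finset.sum_congr rfl fun k _ => by ring
  ext y
  set Pi := B.poissonMatrix star y with hPi
  set A : Matrix (Fin (Module.finrank ℝ E)) (Fin (Module.finrank ℝ E)) ℂ :=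
    Matrix.of fun l k => (rightInvOp (B.basis k) (a l)).1 y with hA
  have h3 : A * Pi = -(Pi * A.transpose) := by
    rw [eq_neg_iff_add_eq_zero]
    ext l m
    have h4 := congrArg (evalAt E y) (h1 (B.fnAt y l) (B.fnAt y m))
    simp only [map_sum, map_add, map_mul, evalAt_apply, B.dual_fnAt, map_zero, ite_mul, one_mul,
      zero_mul, Finset.sum_add_distrib, Finset.sum_ite_eq, Finset.mem_univ, if_true] at h4
    rw [B.pb_eq_sum_left star y (a l), B.pb_eq_sum_right star y _ (a m)] at h4
    simp only [Matrix.add_apply, Matrix.mul_apply, Matrix.transpose_apply, Matrix.zero_apply, hA,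
      hPi, poissonMatrix, Matrix.of_apply]
    rw [← h4]
    congr 1
    exact Finset.sum_congr rfl fun k _ => mul_comm _ _
  have hu : IsUnit Pi.det := isUnit_iff_ne_zero.2 (B.det_poissonMatrix_ne_zero star y)
  have h5 : A.trace = -A.trace := by
    calc A.trace = (A * Pi * Pi⁻¹).trace := by rw [Matrix.mul_nonsing_inv_cancel_right _ _ hu]
      _ = -(Pi * A.transpose * Pi⁻¹).trace := by rw [h3, Matrix.neg_mul, Matrix.trace_neg]
      _ = -A.trace := by
        rw [Matrix.trace_mul_comm, ← Matrix.mul_assoc, Matrix.nonsing_inv_mul _ hu, Matrix.one_mul,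
          Matrix.trace_transpose]
  have h6 : A.trace = 0 := self_eq_neg.1 h5
  refine (evalAt_apply (E := E) y _).symm.trans ?_
  rw [map_sum]
  exact h6

end UnitCoord

/-- Each R_i is skew, so the transpose of ∑ a_i R_i is its negative up to multiplication by the
divergence ∑ R_i a_i, which vanishes. -/
theorem StarProduct.IsDerivation.isTr_neg [SecondCountableTopology S] [MeasurableSpace S]
    [BorelSpace S] {star : StarProduct om} (hstar : star.IsLeftInvariant) (μ : Measure S)
    [μ.IsHaarMeasure] {D : FormalOp E S} (hD : star.IsDerivation D) :
    IsTr μ (coeff 0 D) (-coeff 0 D) := by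
  obtain ⟨B⟩ := nonempty_unitCoord (E := E) (S := S)
  obtain ⟨a, ha⟩ := B.leibniz_eq_sum_right hD.coeff_zero_mul
  have h0 := B.sum_rightInvOp_eq_zero hstar a fun f h => by
    rw [← ha]; exact hD.coeff_zero_pb f h
  have hdo : ∀ v, IsDiffOp (rightInvOp v : SmoothOp E S) := fun v =>
    ⟨1, isDiffOpOfOrder_one_of_leibniz (rightInvOp_mul v)⟩
  have h1 : IsTr μ (∑ i, M (a i) * rightInvOp (B.basis i) : SmoothOp E S)
      (∑ i, (-rightInvOp (B.basis i)) * M (a i)) :=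
    IsTr.sum fun i _ => (IsTr.mulLeft _).mul (IsTr.rightInvOp _) (hdo _) ⟨0, .mulLeft 0 _⟩
  have h2 : (∑ i, (-rightInvOp (B.basis i)) * M (a i) : SmoothOp E S) = -coeff 0 D := by
    rw [ha, eq_neg_iff_add_eq_zero, ← Finset.sum_add_distrib]
    refine LinearMap.ext fun f => ?_
    have h3 : ∀ i, ((-rightInvOp (B.basis i)) * M (a i) + M (a i) * rightInvOp (B.basis i) :
        SmoothOp E S) f = -(rightInvOp (B.basis i) (a i) * f) := fun i => by
      change -(rightInvOp (B.basis i) (a i * f)) + a i * rightInvOp (B.basis i) f = _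
      rw [rightInvOp_mul]
      ring
    rw [LinearMap.sum_apply]
    simp only [h3]
    rw [Finset.sum_neg_distrib, ← Finset.sum_mul, h0, zero_mul, neg_zero]
    rfl
  rwa [h2, ← ha] at h1

end DivergenceFree
end Retract

namespace Retract
-- Uniqueness for linear first-order systems along the right-invariant fields.
noncomputable section FlatSections

variable {E : Type*} [NormedAddCommGroup E] [NormedSpace ℝ E] [FiniteDimensional ℝ E]
  {S : Type*} [TopologicalSpace S] [ChartedSpace E S] [Group S] [LieGroup 𝓘(ℝ, E) ∞ S]
  [T2Space S]

local notation "M" => LinearMap.mulLeft ℂ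

theorem real_smul_op (c : ℝ) (P : SmoothOp E S) : c • P = (c : ℂ) • P := by
  refine LinearMap.ext fun f => Subtype.ext (funext fun x => ?_)
  exact Complex.real_smul

theorem C_real_smul (c : ℝ) (P : SmoothOp E S) : C (c • P) = c • C P := by
  ext1 n
  cases n with
  | zero => exact (coeff_zero_C _).trans (congrArg (c • ·) (coeff_zero_C _).symm)
  | succ n => exact (coeff_succ_C).trans ((smul_zero c).symm.trans
      (congrArg (c • ·) (coeff_succ_C).symm))

/-- Grönwall's inequality along the segments issuing from `a`. -/
theorem eq_zero_of_norm_fderiv_le {F G : Type*} [NormedAddCommGroup F] [NormedSpace ℝ F]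
    [NormedAddCommGroup G] [NormedSpace ℝ G] {c : F → G} {a : F} {ε K : ℝ}
    (hc : Differentiable ℝ c) (ha : c a = 0)
    (h : ∀ p ∈ Metric.closedBall a ε, ∀ η, ‖fderiv ℝ c p η‖ ≤ K * ‖η‖ * ‖c p‖) :
    ∀ p ∈ Metric.closedBall a ε, c p = 0 := by
  intro p hp
  have hd : ∀ t : ℝ, HasDerivAt (fun t : ℝ => c (a + t • (p - a)))
      (fderiv ℝ c (a + t • (p - a)) (p - a)) t := fun t => by
    have h1 : HasDerivAt (fun t : ℝ => a + t • (p - a)) (p - a) t := by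
      simpa using ((hasDerivAt_id t).smul_const (p - a)).const_add a
    exact (hc _).hasFDerivAt.comp_hasDerivAt t h1
  have h1 := eq_zero_of_abs_deriv_le_mul_abs_self_of_eq_zero_right (a := 0) (b := 1)
    (f := fun t : ℝ => c (a + t • (p - a))) (K := K * ‖p - a‖)
    (fun t _ => (hd t).continuousAt.continuousWithinAt) (fun t _ => (hd t).hasDerivWithinAt)
    (by simpa using ha) (fun t ht => h _ ?_ _) 1 (by simp)
  · simpa using h1
  · rw [Metric.mem_closedBall, dist_eq_norm] at hp ⊢
    rw [add_sub_cancel_left, norm_smul, Real.norm_eq_abs, abs_of_nonneg ht.1]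
    exact (mul_le_of_le_one_left (norm_nonneg _) ht.2.le).trans hp

theorem UnitCoord.fderiv_comp (B : UnitCoord E S) {ψ : E → S}
    (hψ : ContMDiff 𝓘(ℝ, E) 𝓘(ℝ, E) ∞ ψ) (f : SmoothFun E S) (p η : E) :
    fderiv ℝ (f.1 ∘ ψ) p η = ∑ i, (rightInvOp (B.basis i) f).1 (ψ p) *
      fderiv ℝ ((B.fnAt (ψ p) i).1 ∘ ψ) p η := by
  have key : ∀ f : SmoothFun E S, fderiv ℝ (f.1 ∘ ψ) p η =
      dfun f.1 (ψ p) (mfderiv 𝓘(ℝ, E) 𝓘(ℝ, E) ψ p η) := fun f => by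
    rw [← mfderiv_eq_fderiv, mfderiv_comp p (f.mdifferentiableAt _) (hψ.mdifferentiable (by simp) p)]
    rfl
  let l : SmoothFun E S →ₗ[ℂ] ℂ :=
    { toFun := fun f => dfun f.1 (ψ p) (mfderiv 𝓘(ℝ, E) 𝓘(ℝ, E) ψ p η)
      map_add' := fun f g => dfun_add (f.mdifferentiableAt _) (g.mdifferentiableAt _) _
      map_smul' := fun c f => dfun_smul (f.mdifferentiableAt _) c _ }
  simp only [key]
  exact B.derivation_eq_sum_at (ψ p) l
    (fun f g => dfun_mul (f.mdifferentiableAt _) (g.mdifferentiableAt _) _) f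

/-- The common zero set is closed. It is also open: in a chart, the components of the coordinate
directions in the right-invariant frame are bounded on a ball, so the system gives the estimate
required by `eq_zero_of_norm_fderiv_le`. Connectedness concludes. -/
theorem UnitCoord.eq_zero_of_rightInvOp_eq_sum [PreconnectedSpace S] (B : UnitCoord E S)
    {m : Type*} [Fintype m] (c : m → SmoothFun E S)
    (Λ : Fin (Module.finrank ℝ E) → m → m → ℂ)
    (h : ∀ k j, rightInvOp (B.basis k) (c j) = ∑ l, Λ k j l • c l)
    (h1 : ∀ j, (c j).1 1 = 0) (j : m) : c j = 0 := by
  have hcont : ∀ j, Continuous (c j).1 := fun j =>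
    ((c j).2 : ContMDiff 𝓘(ℝ, E) 𝓘(ℝ, ℂ) ∞ (c j).1).continuous
  have hclopen : IsClopen {x : S | ∀ j, (c j).1 x = 0} := by
    refine ⟨?_, isOpen_iff_mem_nhds.2 fun x₀ hx₀ => ?_⟩
    · simp only [Set.ofPred_forall]
      exact isClosed_iInter fun j => isClosed_eq (hcont j) continuous_const
    obtain ⟨r, hr, hrt, hre⟩ := exists_retraction_chart (E := E) x₀
    set κ := extChartAt 𝓘(ℝ, E) x₀ with hκ
    set ψ : E → S := fun p => κ.symm (r p) with hψdef
    have hψ : ContMDiff 𝓘(ℝ, E) 𝓘(ℝ, E) ∞ ψ :=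
      (contMDiffOn_extChartAt_symm x₀).comp_contMDiff hr.contMDiff hrt
    have hψa : ψ (κ x₀) = x₀ := by
      rw [hψdef]
      simp only [hre.self_of_nhds]
      exact extChartAt_to_inv x₀
    have hF : ∀ k, ContMDiff (𝓘(ℝ, E).prod 𝓘(ℝ, E)) 𝓘(ℝ, ℂ) ∞
        (fun q : S × E => (B.fn k).1 (ψ q.2 * q.1⁻¹)) := fun k =>
      ((B.fn k).2 : ContMDiff 𝓘(ℝ, E) 𝓘(ℝ, ℂ) ∞ (B.fn k).1).comp
        ((hψ.comp contMDiff_snd).mul contMDiff_fst.inv)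
    have hH : ∀ k, Continuous fun p => fderiv ℝ ((B.fnAt (ψ p) k).1 ∘ ψ) p := fun k =>
      (continuous_fderiv_snd (hF k)).comp (hψ.continuous.prodMk continuous_id)
    have hbd : ∀ k, ∃ A, ∀ p ∈ Metric.closedBall (κ x₀) 1,
        ‖fderiv ℝ ((B.fnAt (ψ p) k).1 ∘ ψ) p‖ ≤ A := fun k =>
      (isCompact_closedBall (κ x₀) 1).exists_bound_of_continuousOn (hH k).continuousOn
    choose A hA using hbd
    have hcs : ∀ j, ContDiff ℝ ∞ ((c j).1 ∘ ψ) := fun j =>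
      (((c j).2 : ContMDiff 𝓘(ℝ, E) 𝓘(ℝ, ℂ) ∞ (c j).1).comp hψ).contDiff
    have hcd : ∀ j, Differentiable ℝ ((c j).1 ∘ ψ) := fun j => (hcs j).differentiable (by simp)
    have hle := eq_zero_of_norm_fderiv_le (c := fun p j => (c j).1 (ψ p)) (a := κ x₀) (ε := 1)
      (K := ∑ j, ∑ k, ∑ l, ‖Λ k j l‖ * A k) (differentiable_pi.2 hcd)
      (funext fun j => by rw [hψa]; exact hx₀ j) (fun p hp η => ?_)
    · have h3 : ∀ᶠ y in 𝓝 x₀, r (κ y) = κ y :=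
        (continuousAt_extChartAt (I := 𝓘(ℝ, E)) x₀).eventually hre
      have h4 : ∀ᶠ y in 𝓝 x₀, κ y ∈ Metric.closedBall (κ x₀) 1 :=
        (continuousAt_extChartAt (I := 𝓘(ℝ, E)) x₀).eventually
          (Metric.closedBall_mem_nhds _ one_pos)
      filter_upwards [h3, h4, extChartAt_source_mem_nhds (I := 𝓘(ℝ, E)) x₀] with y hy hy4 hys j
      have h5 := congrFun (hle _ hy4) j
      simp only [hψdef, hy, κ.left_inv hys] at h5
      exact h5
    · have hA0 : ∀ k, 0 ≤ A k := fun k => (norm_nonneg _).trans (hA k p hp)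
      have hnn : ∀ k j l, 0 ≤ ‖Λ k j l‖ * A k := fun k j l => mul_nonneg (norm_nonneg _) (hA0 k)
      rw [pi_norm_le_iff_of_nonneg (mul_nonneg (mul_nonneg (Finset.sum_nonneg fun j _ =>
        Finset.sum_nonneg fun k _ => Finset.sum_nonneg fun l _ => hnn k j l) (norm_nonneg _))
        (norm_nonneg _))]
      intro j
      have e1 : fderiv ℝ (fun p j => (c j).1 (ψ p)) p η j = fderiv ℝ ((c j).1 ∘ ψ) p η := by
        have e0 : fderiv ℝ (fun p j => ((c j).1 ∘ ψ) p) p = _ := fderiv_pi fun j => hcd j p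
        exact congrFun (congrArg (fun L => L η) e0) j
      rw [e1, B.fderiv_comp hψ]
      have hη := norm_nonneg η
      have hN := norm_nonneg (fun j => (c j).1 (ψ p))
      calc _ ≤ ∑ k, ∑ l, ‖Λ k j l‖ * A k * ‖η‖ * ‖fun j => (c j).1 (ψ p)‖ := by
            refine (norm_sum_le _ _).trans (Finset.sum_le_sum fun k _ => ?_)
            have e2 : (rightInvOp (B.basis k) (c j)).1 (ψ p) = ∑ l, Λ k j l * (c l).1 (ψ p) := by
              rw [h, ← evalAt_apply (E := E), map_sum]
              rfl
            rw [e2, norm_mul]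
            have e3 : ‖∑ l, Λ k j l * (c l).1 (ψ p)‖ ≤
                ∑ l, ‖Λ k j l‖ * ‖fun j => (c j).1 (ψ p)‖ := by
              refine (norm_sum_le _ _).trans (Finset.sum_le_sum fun l _ => ?_)
              rw [norm_mul]
              exact mul_le_mul_of_nonneg_left (norm_le_pi_norm (fun j => (c j).1 (ψ p)) l)
                (norm_nonneg _)
            have e4 : ‖fderiv ℝ ((B.fnAt (ψ p) k).1 ∘ ψ) p η‖ ≤ A k * ‖η‖ :=
              (ContinuousLinearMap.le_opNorm _ _).trans (mul_le_mul_of_nonneg_right (hA k p hp) hη)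
            refine (mul_le_mul e3 e4 (norm_nonneg _) (Finset.sum_nonneg fun l _ =>
              mul_nonneg (norm_nonneg _) hN)).trans (le_of_eq ?_)
            rw [Finset.sum_mul]
            exact Finset.sum_congr rfl fun l _ => by ring
        _ = (∑ k, ∑ l, ‖Λ k j l‖ * A k) * ‖η‖ * ‖fun j => (c j).1 (ψ p)‖ := by
            simp only [Finset.sum_mul]
        _ ≤ _ := by
            refine mul_le_mul_of_nonneg_right (mul_le_mul_of_nonneg_right ?_ hη) hN
            exact Finset.single_le_sum (f := fun j => ∑ k, ∑ l, ‖Λ k j l‖ * A k)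
              (fun j _ => Finset.sum_nonneg fun k _ => Finset.sum_nonneg fun l _ => hnn k j l)
              (Finset.mem_univ j)
  have huniv := hclopen.eq_univ ⟨1, h1⟩
  ext x
  exact (huniv.symm ▸ Set.mem_univ x : x ∈ {x : S | ∀ j, (c j).1 x = 0}) j

/-- Right-invariant fields commute with the operators of a jet family, so bracketing with them just
differentiates the coefficients. The coefficients of the `t X` for a basis of 𝔤 thus satisfy a
constant-coefficient system and vanish at the unit. -/
theorem eq_zero_of_bracket_rightInvOp [PreconnectedSpace S] {𝔤 : Type*} [AddCommGroup 𝔤]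
    [Module ℝ 𝔤] [FiniteDimensional ℝ 𝔤] (t : 𝔤 →ₗ[ℝ] SmoothOp E S) (ht : ∀ X, IsDiffOp (t X))
    (ad : GroupLieAlgebra 𝓘(ℝ, E) S → 𝔤 → 𝔤)
    (had : ∀ v X, rightInvOp v * t X - t X * rightInvOp v = t (ad v X))
    (h1 : ∀ X f, (t X f).1 1 = 0) (X : 𝔤) : t X = 0 := by
  obtain ⟨B⟩ := nonempty_unitCoord (E := E) (S := S)
  let b := Module.finBasis ℝ 𝔤
  have hexp : ∀ X, t X = ∑ j, ((b.repr X j : ℝ) : ℂ) • t (b j) := fun X => by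
    conv_lhs => rw [← b.sum_repr X, map_sum]
    exact Finset.sum_congr rfl fun j _ => by rw [map_smul, real_smul_op]
  choose k hk using fun j => ht (b j)
  set n := Finset.univ.sup k
  have hn : ∀ X, IsDiffOpOfOrder n (t X) := fun X => by
    rw [hexp X]
    exact IsDiffOpOfOrder.sum fun j _ =>
      ((hk j).mono (Finset.le_sup (Finset.mem_univ j))).smul _
  obtain ⟨J⟩ := nonempty_jetFamily (E := E) (S := S) n
  have hlin : ∀ i X, J.coeff (hn X) i = ∑ l, ((b.repr X l : ℝ) : ℂ) • J.coeff (hn (b l)) i :=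
    fun i X => by
      ext x
      rw [J.coeff_apply]
      conv_lhs => rw [hexp X]
      rw [LinearMap.sum_apply]
      refine ((evalAt_apply (E := E) x _).symm.trans ?_).trans (evalAt_apply x _)
      rw [map_sum, map_sum]
      rfl
  have hder : ∀ i v X, rightInvOp v (J.coeff (hn X) i) = J.coeff (hn (ad v X)) i := fun i v X => by
    ext x
    have e1 : t (ad v X) = ∑ i, M (rightInvOp v (J.coeff (hn X) i)) * J.op i := by
      rw [← had]
      conv_lhs => rw [J.eq_sum (hn X)]
      rw [Finset.mul_sum, Finset.sum_mul, ← Finset.sum_sub_distrib]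
      refine Finset.sum_congr rfl fun i _ => LinearMap.ext fun f => ?_
      have e2 : J.op i (rightInvOp v f) = rightInvOp v (J.op i f) :=
        LinearMap.congr_fun (commute_rightInvOp_of_mem (J.op_mem i) v).eq f
      change rightInvOp v (J.coeff (hn X) i * J.op i f) -
        J.coeff (hn X) i * J.op i (rightInvOp v f) = rightInvOp v (J.coeff (hn X) i) * J.op i f
      rw [e2, rightInvOp_mul]
      ring
    rw [J.coeff_apply, e1, J.coeff_sum]
  have hz : ∀ i j, J.coeff (hn (b j)) i = 0 := fun i =>
    B.eq_zero_of_rightInvOp_eq_sum (fun j => J.coeff (hn (b j)) i)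
      (fun k j l => ((b.repr (ad (B.basis k) (b j)) l : ℝ) : ℂ))
      (fun k j => by rw [hder, hlin]) (fun j => h1 _ _)
  rw [J.eq_sum (hn X)]
  refine Finset.sum_eq_zero fun i _ => ?_
  rw [hlin]
  simp [hz]

end FlatSections
end Retract

namespace Retract
-- Part (i): retract operators and the vanishing of the defect.
noncomputable section RetractOperators

open Finset.HasAntidiagonal (antidiagonal)

variable {E : Type*} [NormedAddCommGroup E] [NormedSpace ℝ E] [FiniteDimensional ℝ E]
  {S : Type*} [TopologicalSpace S] [ChartedSpace E S] [Group S] [LieGroup 𝓘(ℝ, E) ∞ S]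
  [T2Space S] [SecondCountableTopology S] [MeasurableSpace S] [BorelSpace S]
  {μ : Measure S} [μ.IsHaarMeasure] {Δ : SmoothFun E S}

theorem IsTr.neg {P Q : SmoothOp E S} (h : IsTr μ P Q) : IsTr μ (-P) (-Q) := by
  have h1 := h.smul (-1)
  rwa [neg_one_smul, neg_one_smul] at h1

theorem IsTr.sub {P Q P' Q' : SmoothOp E S} (h : IsTr μ P Q) (h' : IsTr μ P' Q') :
    IsTr μ (P - P') (Q - Q') := by
  rw [sub_eq_add_neg, sub_eq_add_neg]
  exact h.add h'.neg

theorem IsTr.eq_of_isTranspose {P Q : SmoothOp E S} (h : IsTr μ P Q)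
    {B : TestFun E S →ₗ[ℂ] TestFun E S} (hB : IsTranspose μ P B) (φ : TestFun E S) :
    (B φ).1 = Q φ.1 := by
  rw [← sub_eq_zero]
  refine SmoothFun.eq_zero_of_integral μ _ fun χ => ?_
  have h1 : ∀ y, ((B φ).1 - Q φ.1).1 y * χ.1.1 y =
      (B φ).1.1 y * χ.1.1 y - (Q φ.1).1 y * χ.1.1 y := fun y => sub_mul _ _ _
  simp_rw [h1]
  rw [integral_sub, hB φ χ, h φ χ, sub_self]
  · exact TestFun.integrable μ (χ.smoothMul (B φ).1)
  · exact TestFun.integrable μ (χ.smoothMul (Q φ.1))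

theorem IsModularFunction.exists_op_of_support (hΔ : IsModularFunction μ Δ) {u : FormalDist E S}
    (hu : FormalDist.support u ⊆ {1}) :
    ∃ τ : FormalOp E S, (∀ k, coeff k τ ∈ leftInvAlg E S) ∧
      ∀ k φ, (u k).toLin φ = (coeff k τ (modInv Δ φ.1)).1 1 := by
  choose w hw huw using exists_leftInvAlg_of_support hu
  choose t ht hwt using fun k => hΔ.exists_modInv_mem (hw k)
  refine ⟨PowerSeries.mk t, fun k => by rw [coeff_mk]; exact ht k, fun k φ => ?_⟩
  rw [coeff_mk, ← hwt, huw]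
  have h1 : modInv Δ (modInv Δ φ.1) = φ.1 := LinearMap.congr_fun hΔ.modInv_mul_modInv φ.1
  rw [h1]

/-- Left invariance moves the evaluation at x to the unit, where the two modular factors Δ(y) and
Δ(y⁻¹) cancel. -/
theorem IsModularFunction.isInverseRetractOp (hΔ : IsModularFunction μ Δ) {u : FormalDist E S}
    {τ : FormalOp E S} (hτ : ∀ k, coeff k τ ∈ leftInvAlg E S)
    (hu : ∀ k φ, (u k).toLin φ = (coeff k τ (modInv Δ φ.1)).1 1) : IsInverseRetractOp μ u τ := by
  refine ⟨fun k => leftInvAlg_le_diffOp (hτ k), Δ, hΔ, fun k φ x => ?_⟩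
  rw [hu, apply_eq_leftPull_apply_one (hτ k)]
  refine congrArg (fun f : SmoothFun E S => (coeff k τ f).1 1) (Subtype.ext (funext fun y => ?_))
  change φ.1.1 (x * y) = Δ.1 y * (Δ.1 y⁻¹ * φ.1.1 (x * y⁻¹⁻¹))
  rw [inv_inv, ← mul_assoc, hΔ.mul_inv, one_mul]

theorem IsInverseRetractOp.unique {u : FormalDist E S} {τ τ' : FormalOp E S}
    (h : IsInverseRetractOp μ u τ) (h' : IsInverseRetractOp μ u τ') : τ = τ' := by
  obtain ⟨hd, Δ, hΔ, h1⟩ := h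
  obtain ⟨hd', Δ', hΔ', h1'⟩ := h'
  obtain rfl := hΔ.unique hΔ'
  ext1 k
  refine (hd k).ext_test (hd' k) fun φ => Subtype.ext (funext fun x => ?_)
  rw [h1, h1']

theorem IsInverseRetractOp.coeff_zero {u : FormalDist E S} {τ : FormalOp E S}
    (h : IsInverseRetractOp μ u τ) (hu : ∀ φ : TestFun E S, (u 0).toLin φ = φ.1.1 1) :
    coeff 0 τ = 1 := by
  obtain ⟨hd, Δ, hΔ, h1⟩ := h
  refine (hd 0).ext_test ⟨0, .one 0⟩ fun φ => Subtype.ext (funext fun x => ?_)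
  rw [h1, hu]
  change Δ.1 1 * φ.1.1 (x * 1⁻¹) = φ.1.1 x
  rw [hΔ.apply_one, one_mul, inv_one, mul_one]

section
variable {𝔤 : Type*} [LieRing 𝔤] [LieAlgebra ℝ 𝔤] {om : SymplecticForm E S}
  {ι : GroupLieAlgebra 𝓘(ℝ, E) S →ₗ⁅ℝ⁆ 𝔤} {star : StarProduct om} {D : 𝔤 →ₗ[ℝ] FormalOp E S}

theorem IsRelHom.coeff_zero_rel (hD : IsRelHom ι star D) (Y : GroupLieAlgebra 𝓘(ℝ, E) S) :
    coeff 0 (D (ι Y)) = -rightInvOp Y := by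
  refine LinearMap.ext fun f => Subtype.ext (funext fun x => ?_)
  rw [hD.rel_zero, dfun_fundVF]
  rfl

theorem IsRelHom.rel (hD : IsRelHom ι star D) (Y : GroupLieAlgebra 𝓘(ℝ, E) S) :
    D (ι Y) = C (-rightInvOp Y) := by
  ext1 k
  cases k with
  | zero => rw [hD.coeff_zero_rel, coeff_zero_C]
  | succ k => rw [hD.rel_succ, coeff_succ_C]

/-- This is 𝔤 = 𝔨 + 𝔰: the value at the unit of the field of `X` is matched by a field from 𝔰, since
these span the tangent space. -/
theorem IsRelHom.exists_inStabilizer (hD : IsRelHom ι star D) (X : 𝔤) :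
    ∃ Y, InStabilizer D (X + ι Y) := by
  obtain ⟨B⟩ := nonempty_unitCoord (E := E) (S := S)
  set V := coeff 0 (D X) with hV
  refine ⟨∑ i, ((V (B.fn i)).1 1).re • B.basis i, fun f => ?_⟩
  have h1 := B.derivation_eq_sum ((evalAt E 1).toLinearMap ∘ₗ V) (fun f g =>
    congrArg (fun f : SmoothFun E S => f.1 1) ((hD.derivation X).coeff_zero_mul f g)) f
  change (V f).1 1 = ∑ i, (leftInvOp (B.basis i) f).1 1 * (V (B.fn i)).1 1 at h1
  -- The components are real because `D X` mod ν is a real operator and the coordinates are real;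
  -- only real combinations of the basis lie in the Lie algebra.
  have h2 : ∀ i, (V (B.fn i)).1 1 = (((V (B.fn i)).1 1).re : ℂ) := fun i =>
    Complex.ext rfl (hD.real X (B.fn i) (B.real i) 1)
  rw [map_add, map_add, hD.coeff_zero_rel, ← hV]
  change (V f).1 1 + -(rightInvOp _ f).1 1 = 0
  rw [← sub_eq_add_neg, sub_eq_zero, h1, B.rightInvOp_eq_sum, LinearMap.sum_apply]
  refine Eq.trans ?_ (evalAt_apply _ _)
  rw [map_sum]
  refine Finset.sum_congr rfl fun i _ => ?_
  have h3 : B.basis.repr (∑ i, ((V (B.fn i)).1 1).re • B.basis i) i = ((V (B.fn i)).1 1).re :=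
    B.basis.repr_sum_self (fun i => ((V (B.fn i)).1 1).re) ▸ rfl
  rw [h3, LinearMap.smul_apply, map_smul, evalAt_apply, ← leftInvOp_apply_one, smul_eq_mul,
    ← h2, mul_comm]

/-- The defect of `τ` as an intertwiner between `D_X mod ν` and `D_X`. -/
def defect (D : 𝔤 →ₗ[ℝ] FormalOp E S) (τ : FormalOp E S) (X : 𝔤) : FormalOp E S :=
  D X * τ - τ * C (coeff 0 (D X))

theorem defect_add (D : 𝔤 →ₗ[ℝ] FormalOp E S) (τ : FormalOp E S) (X Y : 𝔤) :
    defect D τ (X + Y) = defect D τ X + defect D τ Y := by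
  simp only [defect, map_add, add_mul, mul_add]
  abel

theorem defect_smul (D : 𝔤 →ₗ[ℝ] FormalOp E S) (τ : FormalOp E S) (c : ℝ) (X : 𝔤) :
    defect D τ (c • X) = c • defect D τ X := by
  have h2 : coeff 0 (c • D X) = c • coeff 0 (D X) := rfl
  simp only [defect, map_smul, h2, C_real_smul, smul_sub, smul_mul_assoc, mul_smul_comm]

theorem C_rightInvOp_mul_comm {τ : FormalOp E S} (hτ : ∀ k, coeff k τ ∈ leftInvAlg E S)
    (Y : GroupLieAlgebra 𝓘(ℝ, E) S) :
    C (-rightInvOp Y) * τ = τ * C (-rightInvOp Y : SmoothOp E S) := by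
  ext1 n
  rw [coeff_C_mul, coeff_mul_C]
  exact ((commute_rightInvOp_of_mem (hτ n) Y).neg_right).eq.symm

theorem IsRelHom.defect_ι (hD : IsRelHom ι star D) {τ : FormalOp E S}
    (hτ : ∀ k, coeff k τ ∈ leftInvAlg E S) (Y : GroupLieAlgebra 𝓘(ℝ, E) S) :
    defect D τ (ι Y) = 0 := by
  rw [defect, hD.coeff_zero_rel, hD.rel, C_rightInvOp_mul_comm hτ, sub_self]

/-- The action of 𝔰 commutes with `τ`, so forming the defect respects brackets by 𝔰. -/
theorem IsRelHom.bracket_defect (hD : IsRelHom ι star D) {τ : FormalOp E S}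
    (hτ : ∀ k, coeff k τ ∈ leftInvAlg E S) (Y : GroupLieAlgebra 𝓘(ℝ, E) S) (X : 𝔤) :
    C (-rightInvOp Y) * defect D τ X - defect D τ X * C (-rightInvOp Y) =
      defect D τ ⁅ι Y, X⁆ := by
  have h1 := C_rightInvOp_mul_comm hτ Y
  have h2 := hD.map_lie (ι Y) X
  have h3 : C (coeff 0 (D ⁅ι Y, X⁆)) = C (-rightInvOp Y) * C (coeff 0 (D X)) -
      C (coeff 0 (D X)) * C (-rightInvOp Y) := by
    rw [← map_mul, ← map_mul, ← map_sub, h2, hD.rel]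
    congr 1
    rw [map_sub, coeff_C_mul, coeff_mul_C]
  unfold defect
  rw [h3, h2, hD.rel]
  generalize C (-rightInvOp Y : SmoothOp E S) = y at *
  generalize D X = x at *
  generalize C (coeff 0 x) = v at *
  simp only [mul_sub, sub_mul]
  have e1 : x * τ * y = x * y * τ := by rw [mul_assoc, ← h1, mul_assoc]
  have e2 : τ * (y * v) = y * (τ * v) := by rw [← mul_assoc, ← h1, mul_assoc]
  rw [e1, e2, ← mul_assoc y x τ, ← mul_assoc τ v y]
  abel

theorem IsRelHom.isDiffOp_defect (hD : IsRelHom ι star D) {τ : FormalOp E S}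
    (hτ : ∀ k, coeff k τ ∈ leftInvAlg E S) (X : 𝔤) (n : ℕ) :
    IsDiffOp (coeff n (defect D τ X)) := by
  rw [defect, map_sub, coeff_mul_C]
  exact (diffOpSubalgebra E S).sub_mem (isDiffOp_coeff_mul (hD.derivation X).diffOp
    (fun k => leftInvAlg_le_diffOp (hτ k)) n) ((diffOpSubalgebra E S).mul_mem
    (leftInvAlg_le_diffOp (hτ n)) ((hD.derivation X).diffOp 0))

/-- As Z_D^⋆ is skew, the transposed defect is ∑ τ_jᵗ D_iᵗ + Z_D^⋆ τ_nᵗ. At the unit the last term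
vanishes because Z lies in 𝔨, and the sum is the pairing of `u` with the transpose of `D Z`. The
identity serves both directions of the theorem. -/
theorem IsRelHom.transpose_defect_apply_one (hD : IsRelHom ι star D) (hstar : star.IsLeftInvariant)
    (hΔ : IsModularFunction μ Δ) {u : FormalDist E S} {τ : FormalOp E S}
    (hτ : ∀ k, coeff k τ ∈ leftInvAlg E S)
    (hu : ∀ k φ, (u k).toLin φ = (coeff k τ (modInv Δ φ.1)).1 1) {Z : 𝔤}
    (hZ : InStabilizer D Z) {B : ℕ → TestFun E S →ₗ[ℂ] TestFun E S}
    (hB : ∀ i, IsTranspose μ (coeff i (D Z)) (B i)) {n : ℕ} {t : SmoothOp E S}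
    (ht : IsTr μ (coeff n (defect D τ Z)) t) (φ : TestFun E S) :
    (t φ.1).1 1 = ∑ p ∈ antidiagonal n, (u p.2).toLin (B p.1 φ) := by
  have hd := (hD.derivation Z).diffOp
  choose s hs hst using fun q => exists_isTr μ (leftInvAlg_le_diffOp (hτ q))
  choose d hdd hdt using fun i => exists_isTr μ (hd i)
  have hV := (hD.derivation Z).isTr_neg hstar μ
  have hQ : IsTr μ (coeff n (defect D τ Z)) (∑ p ∈ antidiagonal n, s p.2 * d p.1 -
      (-coeff 0 (D Z)) * s n) := by
    rw [defect, map_sub, coeff_mul_C, coeff_mul]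
    exact (IsTr.sum fun p _ => (hdt p.1).mul (hst p.2) (leftInvAlg_le_diffOp (hτ p.2))
      (hdd p.1)).sub ((hst n).mul hV (hd 0) (hs n))
  rw [ht.unique hQ]
  have h1 : (((∑ p ∈ antidiagonal n, s p.2 * d p.1) - (-coeff 0 (D Z)) * s n : SmoothOp E S)
      φ.1).1 1 = ∑ p ∈ antidiagonal n, (s p.2 (d p.1 φ.1)).1 1 + (coeff 0 (D Z) (s n φ.1)).1 1 := by
    refine (evalAt_apply (E := E) 1 _).symm.trans ?_
    rw [LinearMap.sub_apply, map_sub, LinearMap.sum_apply, map_sum]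
    exact (sub_eq_add_neg _ _).trans (congrArg (_ + ·) (neg_neg _))
  rw [h1, hZ, add_zero]
  refine Finset.sum_congr rfl fun p _ => ?_
  rw [hu, ← (hdt p.1).eq_of_isTranspose (hB p.1), hΔ.transpose_apply_one (hτ p.2) (hst p.2)]

/-- The retract equation controls the transposed defect at the unit only. Its transposes form a
linear family stable under brackets with right-invariant fields, so `eq_zero_of_bracket_rightInvOp`
spreads the vanishing over the whole group. -/
theorem IsRelHom.defect_eq_zero [PreconnectedSpace S] [FiniteDimensional ℝ 𝔤]
    (hD : IsRelHom ι star D) (hstar : star.IsLeftInvariant)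
    (hΔ : IsModularFunction μ Δ) {u : FormalDist E S} {τ : FormalOp E S}
    (hτ : ∀ k, coeff k τ ∈ leftInvAlg E S)
    (hu : ∀ k φ, (u k).toLin φ = (coeff k τ (modInv Δ φ.1)).1 1)
    (hw : ∀ Z, InStabilizer D Z → IsWeakSolution μ (D Z) u) (X : 𝔤) : defect D τ X = 0 := by
  ext1 n
  choose t hd ht using fun X => exists_isTr μ (hD.isDiffOp_defect hτ X n)
  have huniq : ∀ {P Q Q' : SmoothOp E S}, IsTr μ P Q → IsTr μ P Q' → IsDiffOp Q → IsDiffOp Q' →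
      Q = Q' := fun h h' hQ hQ' => hQ.ext_test hQ' fun φ => h.unique h' φ
  let tl : 𝔤 →ₗ[ℝ] SmoothOp E S :=
    { toFun := t
      map_add' := fun X Y => by
        have h := ht (X + Y)
        rw [defect_add, map_add] at h
        exact huniq h ((ht X).add (ht Y)) (hd _) ((diffOpSubalgebra E S).add_mem (hd X) (hd Y))
      map_smul' := fun c X => by
        have h := ht (c • X)
        rw [defect_smul] at h
        change IsTr μ (c • coeff n (defect D τ X)) _ at h
        rw [real_smul_op] at h
        rw [RingHom.id_apply, real_smul_op]
        exact huniq h ((ht X).smul c) (hd _) ((diffOpSubalgebra E S).smul_mem (hd X) (c : ℂ)) }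
  have hneg : ∀ X, t (-X) = -t X := fun X => map_neg tl X
  have hR : ∀ v, IsDiffOp (rightInvOp v : SmoothOp E S) := fun v =>
    ⟨1, isDiffOpOfOrder_one_of_leibniz (rightInvOp_mul v)⟩
  -- Transposition reverses the commutator and takes −R_v to R_v, whence the sign in −⁅ι v, X⁆.
  have hbr : ∀ v X, rightInvOp v * t X - t X * rightInvOp v = t (-⁅ι v, X⁆) := fun v X => by
    have h1 := congrArg (coeff n) (hD.bracket_defect hτ v X)
    rw [map_sub, coeff_C_mul, coeff_mul_C] at h1
    have hRn : IsTr μ (-rightInvOp v : SmoothOp E S) (rightInvOp v) := by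
      simpa using (IsTr.rightInvOp (μ := μ) v).neg
    have h2 := (hRn.mul (ht X) (hD.isDiffOp_defect hτ X n) (hR v)).sub
      ((ht X).mul hRn ((diffOpSubalgebra E S).neg_mem (hR v)) (hd X))
    rw [h1] at h2
    rw [hneg, huniq (ht _) h2 (hd _) ((diffOpSubalgebra E S).sub_mem
      ((diffOpSubalgebra E S).mul_mem (hd X) (hR v)) ((diffOpSubalgebra E S).mul_mem (hR v) (hd X)))]
    abel
  have h1 : ∀ X f, (t X f).1 1 = 0 := fun X f => by
    -- The defect vanishes on 𝔰, so X may be replaced by X + ι Y in the stabilizer, where the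
    -- retract equation is available.
    obtain ⟨Y, hY⟩ := hD.exists_inStabilizer X
    have h := ht X
    have e : defect D τ X = defect D τ (X + ι Y) := by
      rw [defect_add, hD.defect_ι hτ, add_zero]
    rw [e] at h
    obtain ⟨χ, -⟩ := exists_bump (E := E) (x := (1 : S)) Filter.univ_mem
    rw [(hd X).congr_of_eventuallyEq (g := (TestFun.smoothMul f (bumpTest χ)).1)]
    · obtain ⟨B, hB, hBu⟩ := hw _ hY
      rw [hD.transpose_defect_apply_one hstar hΔ hτ hu hY hB h, hBu]
    · filter_upwards [χ.eventuallyEq_one] with y hy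
      change f.1 y = f.1 y * (χ y : ℂ)
      simp [hy]
  have ht0 := eq_zero_of_bracket_rightInvOp tl hd (fun v X => -⁅ι v, X⁆) hbr h1 X
  have h := ht X
  rw [show t X = 0 from ht0] at h
  rw [h.eq_zero (hD.isDiffOp_defect hτ X n), map_zero]

theorem retract_method_part_one [PreconnectedSpace S] [FiniteDimensional ℝ 𝔤]
    (hD : IsRelHom ι star D) (hstar : star.IsLeftInvariant) {u : FormalDist E S}
    (hu : IsRetract μ D u) :
    (∃! T : FormalOp E S, IsDirectRetractOp μ u T) ∧
      ∀ T : FormalOp E S, IsDirectRetractOp μ u T →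
        ∃ sharp : StarProduct om, StarProduct.IsTransport T star sharp ∧
          ∀ X : 𝔤, sharp.IsDerivation (C (coeff 0 (D X))) := by
  obtain ⟨Δ, hΔ, -⟩ := exists_isModularFunction (E := E) μ
  obtain ⟨τ, hτ, huτ⟩ := hΔ.exists_op_of_support hu.support.le
  have hinv := hΔ.isInverseRetractOp hτ huτ
  have hτ0 := hinv.coeff_zero hu.semiclassical
  obtain ⟨T, hT, hT0, hτT, hTτ⟩ := exists_formal_inverse (leftInvAlg E S) hτ hτ0
  have huniq : ∀ T', IsDirectRetractOp μ u T' → T' = T := fun T' ⟨τ', hτ', h1, h2⟩ => by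
    obtain rfl := hτ'.unique hinv
    exact left_inv_eq_right_inv h1 hτT
  refine ⟨⟨T, ⟨τ, hinv, hTτ, hτT⟩, huniq⟩, fun T' hT' => ?_⟩
  obtain rfl := huniq T' hT'
  have hτd : ∀ k, IsDiffOp (coeff k τ) := fun k => leftInvAlg_le_diffOp (hτ k)
  have hTd : ∀ k, IsDiffOp (coeff k T') := fun k => leftInvAlg_le_diffOp (hT k)
  have htr := star.isTransport_transport hTd hτd hT0 hτ0 hτT
  refine ⟨_, htr, fun X => ?_⟩
  have h := htr.isDerivation_conj (htr.symm hτd hτ0 hτT hTτ) hTτ (hD.derivation X)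
  -- With D_X τ = τ X_D^⋆ the conjugated derivation T D_X τ equals X_D^⋆.
  have h0 := sub_eq_zero.1 (hD.defect_eq_zero hstar hΔ hτ huτ hu.weak X)
  rwa [mul_assoc, h0, ← mul_assoc, hTτ, one_mul] at h

end

end RetractOperators
end Retract

namespace Retract
-- The bracket of vector fields acts as the commutator of derivations.
noncomputable section LieBrackets

variable {E : Type*} [NormedAddCommGroup E] [NormedSpace ℝ E] [FiniteDimensional ℝ E]
  {S : Type*} [TopologicalSpace S] [ChartedSpace E S] [IsManifold 𝓘(ℝ, E) ∞ S]

theorem SmoothVF.lieDer_apply (V : SmoothVF E S) (f : SmoothFun E S) (x : S) :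
    (V.lieDer f).1 x = dfun f.1 x (V.val x) := rfl

theorem fderiv_comp_extChartAt_symm (f : SmoothFun E S) (x : S) {p : E}
    (hp : p ∈ (extChartAt 𝓘(ℝ, E) x).target) (η : E) :
    fderiv ℝ (f.1 ∘ (extChartAt 𝓘(ℝ, E) x).symm) p η =
      dfun f.1 ((extChartAt 𝓘(ℝ, E) x).symm p)
        (mfderiv 𝓘(ℝ, E) 𝓘(ℝ, E) (extChartAt 𝓘(ℝ, E) x).symm p η) := by
  have : IsManifold 𝓘(ℝ, E) 1 S := .of_le (n := ∞) (by simp)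
  have h := mdifferentiableWithinAt_extChartAt_symm hp
  simp only [modelWithCornersSelf_coe, Set.range_id, mdifferentiableWithinAt_univ] at h
  rw [← mfderiv_eq_fderiv, mfderiv_comp p (f.mdifferentiableAt _) h]
  rfl

/-- Both fields are pulled back to the chart at `x`, where the identity is symmetry of second
derivatives on a vector space. It turns the bracket condition on ρ into one on operators. -/
theorem dfun_mlieBracket (V W : SmoothVF E S) (f : SmoothFun E S) (x : S) :
    dfun f.1 x (VectorField.mlieBracket 𝓘(ℝ, E) V.val W.val x) =
      (V.lieDer (W.lieDer f)).1 x - (W.lieDer (V.lieDer f)).1 x := by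
  have i1 : IsManifold 𝓘(ℝ, E) 1 S := .of_le (n := ∞) (by simp)
  have i2 : IsManifold 𝓘(ℝ, E) 2 S := .of_le (n := ∞) (by exact ENat.LEInfty.out)
  set κ := extChartAt 𝓘(ℝ, E) x with hκ
  let pb : SmoothVF E S → E → E := fun V =>
    VectorField.mpullbackWithin 𝓘(ℝ, E) 𝓘(ℝ, E) κ.symm V.val (Set.range 𝓘(ℝ, E))
  have hpb : ∀ V : SmoothVF E S, DifferentiableAt ℝ (pb V) (κ x) := fun V => by
    have h := MDifferentiableWithinAt.differentiableWithinAt_mpullbackWithin_vectorField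
      (V.smooth.mdifferentiable (by simp) x).mdifferentiableWithinAt (s := Set.univ)
    rw [Set.preimage_univ, Set.univ_inter] at h
    have h' : DifferentiableWithinAt ℝ (pb V) (Set.range 𝓘(ℝ, E)) (κ x) := h
    rwa [modelWithCornersSelf_coe, Set.range_id, differentiableWithinAt_univ] at h'
  have hder : ∀ (V : SmoothVF E S) (f : SmoothFun E S), ∀ p ∈ κ.target,
      fderiv ℝ (f.1 ∘ κ.symm) p (pb V p) = (V.lieDer f).1 (κ.symm p) := fun V f p hp => by
    rw [fderiv_comp_extChartAt_symm f x hp, V.lieDer_apply]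
    congr 1
    have h := isInvertible_mfderivWithin_extChartAt_symm (I := 𝓘(ℝ, E)) hp
    have h2 := h.self_apply_inverse (V.val (κ.symm p))
    rw [modelWithCornersSelf_coe, Set.range_id, mfderivWithin_univ] at h2
    simp only [pb, VectorField.mpullbackWithin_apply, modelWithCornersSelf_coe, Set.range_id,
      mfderivWithin_univ]
    exact h2
  have hev : ∀ᶠ p in 𝓝 (κ x), p ∈ κ.target := extChartAt_target_mem_nhds x
  have hder2 : ∀ (V W : SmoothVF E S),
      fderiv ℝ (fun p => fderiv ℝ (f.1 ∘ κ.symm) p (pb W p)) (κ x) (pb V (κ x)) =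
        (V.lieDer (W.lieDer f)).1 x := fun V W => by
    have h : (fun p => fderiv ℝ (f.1 ∘ κ.symm) p (pb W p)) =ᶠ[𝓝 (κ x)]
        (W.lieDer f).1 ∘ κ.symm := by
      filter_upwards [hev] with p hp using hder W f p hp
    rw [h.fderiv_eq, hder V (W.lieDer f) _ (mem_extChartAt_target x)]
    exact congrArg (V.lieDer (W.lieDer f)).1 (extChartAt_to_inv x)
  have hf : ContDiffAt ℝ ∞ (f.1 ∘ κ.symm) (κ x) := by
    have h : ContMDiffOn 𝓘(ℝ, E) 𝓘(ℝ, ℂ) ∞ (f.1 ∘ κ.symm) κ.target :=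
      (f.2 : ContMDiff 𝓘(ℝ, E) 𝓘(ℝ, ℂ) ∞ f.1).comp_contMDiffOn (contMDiffOn_extChartAt_symm x)
    exact (h.contDiffOn.contDiffAt hev)
  have key := VectorField.fderiv_apply_lieBracket hf
    (by rw [minSmoothness_of_isRCLikeNormedField]; exact ENat.LEInfty.out) (hpb W) (hpb V)
  rw [hder2, hder2] at key
  rw [← key]
  have hfκ : f.1 =ᶠ[𝓝 x] (f.1 ∘ κ.symm) ∘ κ := by
    filter_upwards [extChartAt_source_mem_nhds (I := 𝓘(ℝ, E)) x] with y hy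
    exact congrArg f.1 (κ.left_inv hy).symm
  have hκd : MDifferentiableAt 𝓘(ℝ, E) 𝓘(ℝ, E) κ x :=
    mdifferentiableAt_extChartAt (mem_chart_source E x)
  have h1 : dfun f.1 x = (fderiv ℝ (f.1 ∘ κ.symm) (κ x)).comp (mfderiv 𝓘(ℝ, E) 𝓘(ℝ, E) κ x) := by
    unfold dfun
    rw [hfκ.mfderiv_eq, mfderiv_comp x ((hf.differentiableAt (by simp)).mdifferentiableAt) hκd,
      mfderiv_eq_fderiv]
    rfl
  rw [h1, ← VectorField.mlieBracketWithin_univ, VectorField.mlieBracketWithin_apply]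
  have h2 := (isInvertible_mfderiv_extChartAt (I := 𝓘(ℝ, E))
    (mem_extChartAt_source x)).self_apply_inverse
  have h3 : VectorField.lieBracketWithin ℝ (pb V) (pb W)
      (κ.symm ⁻¹' Set.univ ∩ Set.range 𝓘(ℝ, E)) (κ x) =
      VectorField.lieBracket ℝ (pb V) (pb W) (κ x) := by
    rw [Set.preimage_univ, Set.univ_inter, modelWithCornersSelf_coe, Set.range_id,
      VectorField.lieBracketWithin_univ]
  exact congrArg (fderiv ℝ (f.1 ∘ κ.symm) (κ x)) ((h2 _).trans h3)

end LieBrackets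
end Retract

namespace Retract
-- Part (ii): every equivariantly equivalent invariant star-product comes from a retract.
noncomputable section ConverseRetract

open Finset.HasAntidiagonal (antidiagonal)

variable {E : Type*} [NormedAddCommGroup E] [NormedSpace ℝ E] [FiniteDimensional ℝ E]
  {S : Type*} [TopologicalSpace S] [ChartedSpace E S] [Group S] [LieGroup 𝓘(ℝ, E) ∞ S]
  [T2Space S]

/-- The distribution `φ ↦ (P φ)(1)` defined by a differential operator. -/
def distOfOp (P : SmoothOp E S) (hP : IsDiffOp P) : MDistribution E S where
  toLin := (evalAt E (1 : S)).toLinearMap ∘ₗ P ∘ₗ (testSubmodule E S).subtype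
  continuous _ _ := ⟨{P}, 1, by simpa using hP, fun φ B _ h _ => by
    rw [one_mul]
    exact h P (by simp) 1⟩

theorem SmoothVF.isRealOp_lieDer (V : SmoothVF E S) : IsRealOp V.lieDer :=
  fun f hf x => dfun_im_eq_zero f hf x _

section
variable {𝔤 : Type*} [LieRing 𝔤] [LieAlgebra ℝ 𝔤] {om : SymplecticForm E S}
  {ι : GroupLieAlgebra 𝓘(ℝ, E) S →ₗ⁅ℝ⁆ 𝔤} {ρ : 𝔤 → SmoothVF E S}

theorem IsSymplecticAction.lieDer_add (hρ : IsSymplecticAction om ι ρ) (X Y : 𝔤) :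
    (ρ (X + Y)).lieDer = (ρ X).lieDer + (ρ Y).lieDer := by
  refine LinearMap.ext fun f => Subtype.ext (funext fun x => ?_)
  rw [SmoothVF.lieDer_apply, hρ.map_add]
  exact (dfun f.1 x).map_add _ _

theorem IsSymplecticAction.lieDer_smul (hρ : IsSymplecticAction om ι ρ) (c : ℝ) (X : 𝔤) :
    (ρ (c • X)).lieDer = c • (ρ X).lieDer := by
  refine LinearMap.ext fun f => Subtype.ext (funext fun x => ?_)
  rw [SmoothVF.lieDer_apply, hρ.map_smul]
  exact (dfun f.1 x).map_smul _ _

theorem IsSymplecticAction.lieDer_lie (hρ : IsSymplecticAction om ι ρ) (X Y : 𝔤) :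
    (ρ ⁅X, Y⁆).lieDer = (ρ X).lieDer * (ρ Y).lieDer - (ρ Y).lieDer * (ρ X).lieDer := by
  refine LinearMap.ext fun f => Subtype.ext (funext fun x => ?_)
  rw [SmoothVF.lieDer_apply, hρ.map_lie, dfun_mlieBracket]
  rfl

theorem IsSymplecticAction.lieDer_rel (hρ : IsSymplecticAction om ι ρ)
    (Y : GroupLieAlgebra 𝓘(ℝ, E) S) : (ρ (ι Y)).lieDer = -rightInvOp Y := by
  refine LinearMap.ext fun f => Subtype.ext (funext fun x => ?_)
  rw [SmoothVF.lieDer_apply, hρ.rel, dfun_fundVF]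
  rfl

/-- `X ↦ τ ρ(X) T`. -/
def conjAction (hρ : IsSymplecticAction om ι ρ) (T τ : FormalOp E S) : 𝔤 →ₗ[ℝ] FormalOp E S where
  toFun X := τ * C (ρ X).lieDer * T
  map_add' X Y := by rw [hρ.lieDer_add, map_add, mul_add, add_mul]
  map_smul' c X := by
    rw [hρ.lieDer_smul, C_real_smul, mul_smul_comm, smul_mul_assoc, RingHom.id_apply]

theorem conjAction_apply (hρ : IsSymplecticAction om ι ρ) (T τ : FormalOp E S) (X : 𝔤) :
    conjAction hρ T τ X = τ * C (ρ X).lieDer * T := rfl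

theorem coeff_zero_conjAction (hρ : IsSymplecticAction om ι ρ) {T τ : FormalOp E S}
    (hT0 : coeff 0 T = 1) (hτ0 : coeff 0 τ = 1) (X : 𝔤) :
    coeff 0 (conjAction hρ T τ X) = (ρ X).lieDer := by
  have h : ∀ A B : FormalOp E S, coeff 0 (A * B) = coeff 0 A * coeff 0 B := fun A B => by
    simp only [coeff_zero_eq_constantCoeff_apply, map_mul]
  rw [conjAction_apply, h, coeff_mul_C, hT0, hτ0, one_mul, mul_one]

variable [SecondCountableTopology S] [MeasurableSpace S] [BorelSpace S] {μ : Measure S}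
  [μ.IsHaarMeasure]

theorem isRelHom_conjAction (hρ : IsSymplecticAction om ι ρ) {star sharp : StarProduct om}
    (hsharp : ∀ X, sharp.IsDerivation (C (ρ X).lieDer)) {T τ : FormalOp E S}
    (hT : StarProduct.IsTransport T star sharp) (hτ : ∀ k, coeff k τ ∈ leftInvAlg E S)
    (hτ0 : coeff 0 τ = 1) (hτT : τ * T = 1) (hTτ : T * τ = 1) :
    IsRelHom ι star (conjAction hρ T τ) := by
  have hrel : ∀ Y, conjAction hρ T τ (ι Y) = C (-rightInvOp Y) := fun Y => by
    rw [conjAction_apply, hρ.lieDer_rel, ← C_rightInvOp_mul_comm hτ, mul_assoc, hτT, mul_one]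
  refine ⟨fun X => ?_, fun X Y => ?_, fun Y f x => ?_, fun Y k => ?_, fun X => ?_⟩
  · exact (hT.symm (fun k => leftInvAlg_le_diffOp (hτ k)) hτ0 hτT hTτ).isDerivation_conj hT hτT
      (hsharp X)
  · have h : ∀ X Y, conjAction hρ T τ X * conjAction hρ T τ Y =
        τ * C ((ρ X).lieDer * (ρ Y).lieDer) * T := fun X Y => by
      calc _ = τ * C (ρ X).lieDer * (T * τ) * C (ρ Y).lieDer * T := by
            simp only [conjAction_apply, mul_assoc]
        _ = _ := by rw [hTτ, mul_one, map_mul, mul_assoc τ]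
    rw [h, h, ← sub_mul, ← mul_sub, ← map_sub, ← hρ.lieDer_lie, conjAction_apply]
  · rw [hrel, coeff_zero_C, dfun_fundVF]
    rfl
  · rw [hrel, coeff_succ_C]
  · rw [coeff_zero_conjAction hρ hT.coeff_zero hτ0]
    exact (ρ X).isRealOp_lieDer

theorem defect_conjAction (hρ : IsSymplecticAction om ι ρ) {T τ : FormalOp E S}
    (hT0 : coeff 0 T = 1) (hτ0 : coeff 0 τ = 1) (hTτ : T * τ = 1) (X : 𝔤) :
    defect (conjAction hρ T τ) τ X = 0 := by
  rw [defect, coeff_zero_conjAction hρ hT0 hτ0, conjAction_apply, mul_assoc _ T τ, hTτ, mul_one,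
    sub_self]

/-- Conjugating ρ by τ = T⁻¹ gives `D`, and `u` is read off from the transposes of the τ_k at the
unit. That `D` extends the action of 𝔰 uses that `τ` is left-invariant. -/
theorem retract_method_part_two (hρ : IsSymplecticAction om ι ρ) {star sharp : StarProduct om}
    (hstar : star.IsLeftInvariant) (hsharp : ∀ X, sharp.IsDerivation (C (ρ X).lieDer))
    (heq : star.EquivariantlyEquivalent sharp) :
    ∃ D : 𝔤 →ₗ[ℝ] FormalOp E S, IsRelHom ι star D ∧ (∀ X, coeff 0 (D X) = (ρ X).lieDer) ∧
      ∃ u : FormalDist E S, IsRetract μ D u ∧ ∃ T : FormalOp E S, IsDirectRetractOp μ u T ∧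
        StarProduct.IsTransport T star sharp := by
  obtain ⟨T, hT, hTl⟩ := heq
  have hTW : ∀ k, coeff k T ∈ leftInvAlg E S := fun k =>
    mem_leftInvAlg_of_leftPull (hT.diffOp k) fun g f => LinearMap.congr_fun (hTl g k) f
  obtain ⟨τ, hτ, hτ0, hTτ, hτT⟩ := exists_formal_inverse (leftInvAlg E S) hTW hT.coeff_zero
  obtain ⟨Δ, hΔ, -⟩ := exists_isModularFunction (E := E) μ
  have hD := isRelHom_conjAction hρ hsharp hT hτ hτ0 hτT hTτ
  have hP : ∀ k, IsDiffOp (modInv Δ * coeff k τ * modInv Δ) := fun k => by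
    obtain ⟨n, hn⟩ := leftInvAlg_le_diffOp (hτ k)
    exact ⟨n, hn.conj_modInv Δ⟩
  -- The intended value is (τ_k (Δ φ^∨))(1). The additional outer factor `modInv Δ` does not change
  -- values at 1 and makes the composite a differential operator, so it defines a distribution.
  let u : FormalDist E S := fun k => distOfOp _ (hP k)
  have hu : ∀ k φ, (u k).toLin φ = (coeff k τ (modInv Δ φ.1)).1 1 := fun k φ =>
    modInv_apply_one hΔ.apply_one _
  have hu0 : ∀ φ : TestFun E S, (u 0).toLin φ = φ.1.1 1 := fun φ => by
    rw [hu, hτ0]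
    exact modInv_apply_one hΔ.apply_one _
  refine ⟨conjAction hρ T τ, hD, coeff_zero_conjAction hρ hT.coeff_zero hτ0, u,
    ⟨fun Z hZ => ?_, ?_, hu0⟩, T, ⟨τ, hΔ.isInverseRetractOp hτ hu, hTτ, hτT⟩, hT⟩
  · choose d hdd hdt using fun i => exists_isTr μ ((hD.derivation Z).diffOp i)
    have hB : ∀ i, IsTranspose μ (coeff i (conjAction hρ T τ Z)) (hdd i).onTest :=
      fun i φ χ => hdt i φ χ
    refine ⟨_, hB, fun n φ => ?_⟩
    -- The defect of the conjugated action is zero, so t = 0 is a transpose of it and the identity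
    -- yields the weak equation.
    refine (hD.transpose_defect_apply_one hstar hΔ hτ hu hZ hB (n := n) (t := 0) ?_ φ).symm.trans rfl
    · rw [defect_conjAction hρ hT.coeff_zero hτ0 hTτ, map_zero]
      intro φ χ
      simp
  · refine Set.eq_singleton_iff_unique_mem.2 ⟨fun U hU => ?_, fun x hx => ?_⟩
    · obtain ⟨χ, hχ⟩ := exists_bump (E := E) hU
      refine ⟨0, bumpTest χ, ?_, ?_⟩
      · refine (closure_mono fun y hy => ?_).trans hχ
        exact fun h => hy ((bumpTest_apply χ y).trans (by rw [h, Complex.ofReal_zero]))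
      · rw [hu0, bumpTest_apply, χ.eq_one]
        simp
    · by_contra hne
      obtain ⟨k, φ, hφ, h⟩ := hx {1}ᶜ (isOpen_compl_singleton.mem_nhds hne)
      exact h ((hP k).apply_eq_zero_of_notMem_tsupport fun h1 => hφ h1 rfl)

end

end ConverseRetract
end Retract

theorem mainTheorem4
    {E : Type*} [NormedAddCommGroup E] [NormedSpace ℝ E] [FiniteDimensional ℝ E]
    {S : Type*} [TopologicalSpace S] [ChartedSpace E S] [Group S] [LieGroup 𝓘(ℝ, E) ∞ S]
    [T2Space S] [SecondCountableTopology S] [SimplyConnectedSpace S] [Group.IsSolvable S]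
    [MeasurableSpace S] [BorelSpace S] (μ : Measure S) [μ.IsHaarMeasure]
    (om : SymplecticForm E S) (hom : om.IsLeftInvariant)
    {𝔤 : Type*} [LieRing 𝔤] [LieAlgebra ℝ 𝔤] [FiniteDimensional ℝ 𝔤]
    (ι : GroupLieAlgebra 𝓘(ℝ, E) S →ₗ⁅ℝ⁆ 𝔤) (hι : Function.Injective ι)
    (star : StarProduct om) (hstar : star.IsLeftInvariant) :
    (∀ D : 𝔤 →ₗ[ℝ] FormalOp E S, IsRelHom ι star D →
      ∀ u : FormalDist E S, IsRetract μ D u →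
        (∃! T : FormalOp E S, IsDirectRetractOp μ u T) ∧
        ∀ T : FormalOp E S, IsDirectRetractOp μ u T →
          ∃ sharp : StarProduct om, StarProduct.IsTransport T star sharp ∧
            ∀ X : 𝔤, sharp.IsDerivation (PowerSeries.C (PowerSeries.coeff 0 (D X)))) ∧
    (∀ ρ : 𝔤 → SmoothVF E S, IsSymplecticAction om ι ρ →
      ∀ sharp : StarProduct om,
        (∀ X : 𝔤, sharp.IsDerivation (PowerSeries.C (ρ X).lieDer)) →
        star.EquivariantlyEquivalent sharp →
        ∃ D : 𝔤 →ₗ[ℝ] FormalOp E S, IsRelHom ι star D ∧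
          (∀ X : 𝔤, PowerSeries.coeff 0 (D X) = (ρ X).lieDer) ∧
          ∃ u : FormalDist E S, IsRetract μ D u ∧
            ∃ T : FormalOp E S, IsDirectRetractOp μ u T ∧
              StarProduct.IsTransport T star sharp) :=
  ⟨fun _ hD _ hu => retract_method_part_one hD hstar hu,
    fun _ hρ _ hsharp heq => retract_method_part_two hρ hstar hsharp heq⟩
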